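/- Let $X_1,X_2,\dots$ be independent real random variables with common Lebesgue density $f$, where $f$ is twice continuously differentiable and $f,f',f''$ are bounded and square integrable; put $\gamma=\int f''(x)^2\,dx$. Let $K$ be a bounded probability density on $\mathbb R$, symmetric around zero, with compact support and twice continuously differentiable (so $\int K^2<\infty$ and $c_K:=\int u^2K(u)\,du<\infty$). For $h>0$ let $\hat f_h(x)=\frac1{nh}\sum_{m=1}^nK\big(\frac{X_m-x}{h}\big)$ and, for an estimator $\hat g$ of $f$, let $\operatorname{ISE}(\hat g)=\int(\hat g(x)-f(x))^2\,dx$. Fix $k\ge1$ and let $h_1,\dots,h_k>0$ be (possibly data-driven, i.e. random) bandwidths depending on $n$. Assume that there are deterministic bandwidths $h_i^*=h_i^*(n)>0$ such that, for every $i$, $h_i^*\asymp n^{-1/5}$ (that is, $n^{1/5}h_i^*$ is bounded and bounded away from $0$ for large $n$) and $h_i-h_i^*=o_p(n^{-2/5})$. Assume also that the $h_i^*$ are asymptotically distinct: for $i\ne j$, $n^{1/5}|h_i^*-h_j^*|$ is bounded away from $0$ for large $n$. Define the $k\times k$ matrices $$\Sigma_{ij}=\int(\hat f_{h_i}-f)(\hat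 f_{h_j}-f)\,dx,\qquad A_{ij}=\frac1{n h_ih_j}\int K\Big(\frac u{h_i}\Big)K\Big(\frac u{h_j}\Big)du,\qquad B_{ij}=\frac14h_i^2h_j^2c_K^2 .$$ Let $\hat\gamma$ be a (random) estimator of $\gamma$ with $\hat\gamma-\gamma=o_p(1)$, and let $\widehat\Sigma=A+\hat\gamma B$. Assume that $\Sigma$ and $\widehat\Sigma$ are invertible with probability tending to one. Write $\hat f_\lambda=\sum_i\lambda_i\hat f_{h_i}$, and let $\hat f^*=\hat f_{\lambda^*}$ and $\hat f_{AV}=\hat f_{\hat\lambda}$ with $$\lambda^*=\frac{\Sigma^{-1}\mathbf 1}{\mathbf 1^\top\Sigma^{-1}\mathbf 1},\qquad \hat\lambda=\frac{\widehat\Sigma^{-1}\mathbf 1}{\mathbf 1^\top\widehat\Sigma^{-1}\mathbf 1}.$$ Then, whenever $\Sigma$ is invertible, $\lambda^*$ has entries summing to $1$ and minimizes $\operatorname{ISE}(\hat f_\lambda)$ over all $\lambda\in\mathbb R^k$ with $\sum_i\lambda_i=1$ (so $\hat f^*$ is the oracle), and, as $n\to\infty$, $$\operatorname{ISE}(\hat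 f_{AV})=\operatorname{ISE}(\hat f^*)\,\big(1+o_p(1)\big).$$ -/

import Mathlib

open MeasureTheory ProbabilityTheory Filter Topology Asymptotics
open scoped Matrix

namespace KernelAveraging

noncomputable section

/-- A kernel: a bounded density on the line, symmetric around zero, with finite `∫ K²` and finite
second moment. -/
structure IsKernel (K : ℝ → ℝ) : Prop where
  nonneg : ∀ u, 0 ≤ K u
  integrable : Integrable K
  integral_eq_one : ∫ u, K u = 1
  bounded : ∃ C : ℝ, ∀ u, K u ≤ C
  symmetric : ∀ u, K (-u) = K u
  integrable_sq : Integrable (fun u => K u ^ 2)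
  integrable_second_moment : Integrable (fun u => u ^ 2 * K u)

/-- A density on the line that is twice continuously differentiable, such that the density and its
first two derivatives are bounded and square integrable. -/
structure IsSmoothDensity (f : ℝ → ℝ) : Prop where
  nonneg : ∀ x, 0 ≤ f x
  integrable : Integrable f
  integral_eq_one : ∫ x, f x = 1
  contDiff : ContDiff ℝ 2 f
  bounded : ∀ j ≤ 2, ∃ C : ℝ, ∀ x, |iteratedDeriv j f x| ≤ C
  sq_integrable : ∀ j ≤ 2, Integrable (fun x => iteratedDeriv j f x ^ 2)

/-- `X 0, X 1, …` are independent real random variables with common Lebesgue density `f`. -/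
structure IsIIDSample {Ω : Type*} [MeasurableSpace Ω] (μ : Measure Ω) (X : ℕ → Ω → ℝ)
    (f : ℝ → ℝ) : Prop where
  measurable : ∀ m, Measurable (X m)
  indep : iIndepFun X μ
  law : ∀ m, μ.map (X m) = volume.withDensity (fun x => ENNReal.ofReal (f x))

/-- `Z = o_p(Y)`: for every `ε > 0`, the probability that `|Z n| ≤ ε |Y n|` fails tends to zero.
The comparison sequence `Y` may be deterministic or random. -/
def IsLittleOp {Ω : Type*} [MeasurableSpace Ω] (μ : Measure Ω) (Z Y : ℕ → Ω → ℝ) : Prop :=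
  ∀ ε : ℝ, 0 < ε → Tendsto (fun n => μ {ω | ε * |Y n ω| < |Z n ω|}) atTop (𝓝 0)

/-- The kernel estimator `(n h)⁻¹ ∑ K (h⁻¹ (X_i - x))` computed from the `n` data points
`x 0, …, x (n - 1)` with bandwidth `h`. -/
def kde (K : ℝ → ℝ) (n : ℕ) (x : ℕ → ℝ) (h : ℝ) (t : ℝ) : ℝ :=
  (n * h)⁻¹ * ∑ m ∈ Finset.range n, K (h⁻¹ * (x m - t))

/-- The linear combination `∑ λ_i f̂_{h_i}` of the kernel estimators. -/
def combination {k : ℕ} (K : ℝ → ℝ) (n : ℕ) (x : ℕ → ℝ) (h : Fin k → ℝ) (w : Fin k → ℝ)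
    (t : ℝ) : ℝ :=
  ∑ i, w i * kde K n x (h i) t

/-- The integrated square error of an estimator `g` of `f`. -/
def ISE (f g : ℝ → ℝ) : ℝ := ∫ t, (g t - f t) ^ 2

/-- The Gram matrix `Σ` of the estimation errors. -/
def errorGram {k : ℕ} (K f : ℝ → ℝ) (n : ℕ) (x : ℕ → ℝ) (h : Fin k → ℝ) :
    Matrix (Fin k) (Fin k) ℝ :=
  Matrix.of fun i j => ∫ t, (kde K n x (h i) t - f t) * (kde K n x (h j) t - f t)

/-- The matrix `A`, with entries `(n h_i h_j)⁻¹ ∫ K(u/h_i) K(u/h_j) du`. -/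
def matA {k : ℕ} (K : ℝ → ℝ) (n : ℕ) (h : Fin k → ℝ) : Matrix (Fin k) (Fin k) ℝ :=
  Matrix.of fun i j => (n * h i * h j)⁻¹ * ∫ u, K (u / h i) * K (u / h j)

/-- The matrix `B`, with entries `h_i² h_j² c_K² / 4`, where `c_K = ∫ u² K(u) du`. -/
def matB {k : ℕ} (K : ℝ → ℝ) (h : Fin k → ℝ) : Matrix (Fin k) (Fin k) ℝ :=
  Matrix.of fun i j => 1 / 4 * h i ^ 2 * h j ^ 2 * (∫ u, u ^ 2 * K u) ^ 2

/-- `γ = ∫ (f'')²`. -/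
def roughness (f : ℝ → ℝ) : ℝ := ∫ x, iteratedDeriv 2 f x ^ 2

/-- The approximation `A + g B` of `Σ`, for an estimate `g` of `γ`. -/
def approxGram {k : ℕ} (K : ℝ → ℝ) (n : ℕ) (h : Fin k → ℝ) (g : ℝ) :
    Matrix (Fin k) (Fin k) ℝ :=
  matA K n h + g • matB K h

/-- The weights `(1ᵀ S⁻¹ 1)⁻¹ S⁻¹ 1`. -/
def weights {k : ℕ} (S : Matrix (Fin k) (Fin k) ℝ) : Fin k → ℝ :=
  ((1 : Fin k → ℝ) ⬝ᵥ (S⁻¹ *ᵥ 1))⁻¹ • (S⁻¹ *ᵥ 1)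

/-- The oracle `f̂*`: the combination with weights `(1ᵀ Σ⁻¹ 1)⁻¹ Σ⁻¹ 1`. -/
def oracle {k : ℕ} (K f : ℝ → ℝ) (n : ℕ) (x : ℕ → ℝ) (h : Fin k → ℝ) : ℝ → ℝ :=
  combination K n x h (weights (errorGram K f n x h))

/-- The average estimator `f̂_AV`: the combination with weights `(1ᵀ Σ̂⁻¹ 1)⁻¹ Σ̂⁻¹ 1`. -/
def averageEstimator {k : ℕ} (K : ℝ → ℝ) (n : ℕ) (x : ℕ → ℝ) (h : Fin k → ℝ) (g : ℝ) : ℝ → ℝ :=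
  combination K n x h (weights (approxGram K n h g))

end

end KernelAveraging

/-!
Both weight vectors minimize a quadratic form over the vectors with sum one: the oracle weights the
form of `Σ`, which on such vectors is the integrated square error, and the estimated weights the
form of `Σ̂`. So it suffices that the two forms agree up to a factor `1 + o_p(1)`: the minimizer of
one is then nearly optimal for the other (`quadForm_weights_sub_le`). No convergence of the inverse
matrices or of the weights is needed.

The comparison is made with the deterministic matrix `A + γ B` at the bandwidths `h*`. Multiplied
by `n ^ (4/5)` it is a fixed continuous function of the rescaled bandwidths `n ^ (1/5) h*_i`
(`approxGram_eq_scaledGram`), which stay in a compact set of vectors with distinct positive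
entries. The form of the rescaled `A` is the square norm of a combination of dilations of `K`;
these are linearly independent, because the even moments of a vanishing combination form a
Vandermonde system, and compactness gives a uniform lower bound
(`exists_lower_bound_dilationGram`). It remains to show that the entries of `Σ` and of `Σ̂` differ
from those of `A + γ B` by `o_p(n ^ (-4/5))`. For `Σ̂` this is uniform continuity
(`isLittleOp_approxGram_sub`). For `Σ` there are two steps.

At the deterministic bandwidths the estimation error splits into noise and bias. The bias is
`½ h² c_K f''` up to `o(h²)` in `L²`, by Taylor's formula and continuity of translations
(`exists_delta_bias`); its inner products give `γ B`. The inner products of two noise terms are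
`n⁻² ∑ ψ(X_m, X_l)`: the diagonal gives `A` up to `O(n⁻¹)`, and the off-diagonal part is a
degenerate U-statistic of variance `O(n ^ (-9/5))` (`lintegral_sq_noise_mul_noise_le`). The mixed
products are averages of centred terms (`lintegral_sq_noise_mul_le`).

Passing from `h*` to the random `h` uses no independence between `h` and the data:
`f̂_h - f̂_{h*}` is the integral of `∂_s f̂_s` over bandwidths `s` between `h*` and `h`, and the
mean of `∫ (∂_s f̂_s)²` is bounded uniformly over `s ≍ n ^ (-1/5)`. A window of width
`o(n ^ (-2/5))` therefore changes the estimator by `o_p(n ^ (-2/5))` in `L²`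
(`isLittleOp_integral_sq_kde_sub`).
-/

namespace KernelAveraging

noncomputable section

/-! ### Events of probability tending to one -/

/-- The property `p n` holds with probability tending to one (with respect to the outer measure of
its failure, so that no measurability is needed). -/
def EventuallyInProb {Ω : Type*} [MeasurableSpace Ω] (μ : Measure Ω) (p : ℕ → Ω → Prop) : Prop :=
  Tendsto (fun n => μ {ω | ¬ p n ω}) atTop (𝓝 0)

section Probability

variable {Ω : Type*} [MeasurableSpace Ω] {μ : Measure Ω}

theorem EventuallyInProb.mono {p q : ℕ → Ω → Prop} (hp : EventuallyInProb μ p)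
    (h : ∀ᶠ n in atTop, ∀ ω, p n ω → q n ω) : EventuallyInProb μ q := by
  refine tendsto_of_tendsto_of_tendsto_of_le_of_le' tendsto_const_nhds hp
    (Eventually.of_forall fun _ => zero_le) ?_
  filter_upwards [h] with n hn
  exact measure_mono fun ω hω hp => hω (hn ω hp)

theorem EventuallyInProb.and {p q : ℕ → Ω → Prop} (hp : EventuallyInProb μ p)
    (hq : EventuallyInProb μ q) : EventuallyInProb μ fun n ω => p n ω ∧ q n ω := by
  have h := Tendsto.add hp hq
  rw [add_zero] at h
  refine tendsto_of_tendsto_of_tendsto_of_le_of_le tendsto_const_nhds h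
    (fun _ => zero_le) fun n => ?_
  refine (measure_mono ?_).trans (measure_union_le _ _)
  intro ω hω
  by_contra hc
  simp only [Set.mem_union, Set.mem_ofPred_eq, not_or, not_not] at hc
  exact hω hc

theorem EventuallyInProb.forall {ι : Type*} [Finite ι] {p : ι → ℕ → Ω → Prop}
    (hp : ∀ i, EventuallyInProb μ (p i)) : EventuallyInProb μ fun n ω => ∀ i, p i n ω := by
  cases nonempty_fintype ι
  have h := tendsto_finsetSum (Finset.univ : Finset ι) fun i _ => hp i
  rw [Finset.sum_const_zero] at h
  refine tendsto_of_tendsto_of_tendsto_of_le_of_le tendsto_const_nhds h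
    (fun _ => zero_le) fun n => ?_
  refine (measure_mono ?_).trans (measure_biUnion_finset_le _ _)
  intro ω hω
  simpa using hω

theorem isLittleOp_iff {Z Y : ℕ → Ω → ℝ} :
    IsLittleOp μ Z Y ↔ ∀ ε : ℝ, 0 < ε → EventuallyInProb μ fun n ω => |Z n ω| ≤ ε * |Y n ω| := by
  simp only [IsLittleOp, EventuallyInProb, not_le]

/-- Chebyshev's inequality for a deterministic rate: second moments of smaller order than `r ^ 2`
give `o_p(r)`. -/
theorem isLittleOp_of_lintegral_sq {Z : ℕ → Ω → ℝ} {r a : ℕ → ℝ}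
    (hZ : ∀ n, AEMeasurable (Z n) μ) (hr : ∀ᶠ n in atTop, 0 < r n)
    (ha : ∀ᶠ n in atTop, ∫⁻ ω, ENNReal.ofReal (Z n ω ^ 2) ∂μ ≤ ENNReal.ofReal (a n))
    (har : Tendsto (fun n => a n / r n ^ 2) atTop (𝓝 0)) :
    IsLittleOp μ Z fun n _ => r n := by
  intro ε hε
  have h0 : Tendsto (fun n => ENNReal.ofReal (a n / r n ^ 2 * (ε ^ 2)⁻¹)) atTop (𝓝 0) := by
    have := ENNReal.tendsto_ofReal (har.mul_const ((ε ^ 2)⁻¹))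
    simpa using this
  refine tendsto_of_tendsto_of_tendsto_of_le_of_le' tendsto_const_nhds h0
    (Eventually.of_forall fun _ => zero_le) ?_
  filter_upwards [hr, ha] with n hrn han
  have hpos : 0 < ε ^ 2 * r n ^ 2 := by positivity
  have hsub : {ω | ε * |r n| < |Z n ω|} ⊆
      {ω | ENNReal.ofReal (ε ^ 2 * r n ^ 2) ≤ ENNReal.ofReal (Z n ω ^ 2)} := by
    intro ω hω
    have hω' : ε * |r n| < |Z n ω| := hω
    refine ENNReal.ofReal_le_ofReal ?_
    rw [← mul_pow, sq_le_sq, abs_mul, abs_of_pos hε]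
    exact hω'.le
  refine (measure_mono hsub).trans ?_
  refine (meas_ge_le_lintegral_div ((hZ n).pow_const 2).ennreal_ofReal
    (by simpa using hpos) ENNReal.ofReal_ne_top).trans ?_
  refine (ENNReal.div_le_div_right han _).trans ?_
  rw [← ENNReal.ofReal_div_of_pos hpos]
  refine ENNReal.ofReal_le_ofReal (le_of_eq ?_)
  field_simp

end Probability

/-! ### Minimizing a quadratic form over weights that sum to one -/

section Weights

variable {k : ℕ} {S T : Matrix (Fin k) (Fin k) ℝ}

theorem sum_eq_one_dotProduct (w : Fin k → ℝ) : ∑ i, w i = (1 : Fin k → ℝ) ⬝ᵥ w := by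
  simp [dotProduct]

theorem one_dotProduct_inv_pos (hS : S.PosDef) (hk : 1 ≤ k) :
    0 < (1 : Fin k → ℝ) ⬝ᵥ (S⁻¹ *ᵥ 1) := by
  have h1 : (1 : Fin k → ℝ) ≠ 0 := fun h => one_ne_zero (congrFun h ⟨0, hk⟩)
  simpa using hS.inv.dotProduct_mulVec_pos h1

theorem sum_weights (hS : S.PosDef) (hk : 1 ≤ k) : ∑ i, weights S i = 1 := by
  rw [sum_eq_one_dotProduct, weights, dotProduct_smul, smul_eq_mul,
    inv_mul_cancel₀ (one_dotProduct_inv_pos hS hk).ne']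

/-- The normal equation: `S` maps the weights to a constant vector, so the weights are orthogonal,
for the form of `S`, to all vectors with sum zero. -/
theorem quadForm_weights_le (hS : S.PosDef) (hk : 1 ≤ k) {w : Fin k → ℝ} (hw : ∑ i, w i = 1) :
    weights S ⬝ᵥ (S *ᵥ weights S) ≤ w ⬝ᵥ (S *ᵥ w) := by
  set v := weights S with hv
  have hSv : S *ᵥ v = ((1 : Fin k → ℝ) ⬝ᵥ (S⁻¹ *ᵥ 1))⁻¹ • (1 : Fin k → ℝ) := by
    rw [hv, weights, Matrix.mulVec_smul, Matrix.mulVec_mulVec,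
      Matrix.mul_nonsing_inv _ ((Matrix.isUnit_iff_isUnit_det _).1 hS.isUnit), Matrix.one_mulVec]
  have hsymm : ∀ x y : Fin k → ℝ, x ⬝ᵥ (S *ᵥ y) = y ⬝ᵥ (S *ᵥ x) := by
    intro x y
    have ht : Sᵀ = S := by
      rw [← Matrix.conjTranspose_eq_transpose_of_trivial]
      exact hS.isHermitian.eq
    rw [Matrix.dotProduct_mulVec, ← Matrix.mulVec_transpose, ht, dotProduct_comm]
  have hz : (w - v) ⬝ᵥ (S *ᵥ v) = 0 := by
    rw [hSv, dotProduct_smul, dotProduct_comm (w - v), dotProduct_sub, ← sum_eq_one_dotProduct w,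
      ← sum_eq_one_dotProduct v, hw, sum_weights hS hk, sub_self, smul_zero]
  have hnn : 0 ≤ (w - v) ⬝ᵥ (S *ᵥ (w - v)) := by
    simpa using hS.posSemidef.dotProduct_mulVec_nonneg (w - v)
  have hexp : w ⬝ᵥ (S *ᵥ w) = v ⬝ᵥ (S *ᵥ v) + 2 * ((w - v) ⬝ᵥ (S *ᵥ v))
      + (w - v) ⬝ᵥ (S *ᵥ (w - v)) := by
    have h1 := hsymm v w
    simp only [Matrix.mulVec_sub, dotProduct_sub, sub_dotProduct]
    linarith
  rw [hexp, hz]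
  linarith

/-- If two forms agree up to the factor `1 ± η`, then the minimizer of one nearly minimizes the
other. -/
theorem quadForm_weights_sub_le (hS : S.PosDef) (hT : T.PosDef) (hk : 1 ≤ k) {η : ℝ}
    (hη : η ≤ 1 / 2)
    (hST : ∀ w : Fin k → ℝ, |w ⬝ᵥ (T *ᵥ w) - w ⬝ᵥ (S *ᵥ w)| ≤ η * (w ⬝ᵥ (S *ᵥ w))) :
    weights T ⬝ᵥ (S *ᵥ weights T) - weights S ⬝ᵥ (S *ᵥ weights S)
      ≤ 4 * η * (weights S ⬝ᵥ (S *ᵥ weights S)) := by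
  have h1 := (abs_le.1 (hST (weights T))).1
  have h2 := (abs_le.1 (hST (weights S))).2
  have h3 := quadForm_weights_le hT hk (sum_weights hS hk)
  have h4 := quadForm_weights_le hS hk (sum_weights hT hk)
  have h5 := (abs_nonneg _).trans (hST (weights T))
  have h6 := (abs_nonneg _).trans (hST (weights S))
  have h7 : 0 ≤ weights S ⬝ᵥ (S *ᵥ weights S) := by
    simpa using hS.posSemidef.dotProduct_mulVec_nonneg (weights S)
  have h8 : 0 ≤ weights T ⬝ᵥ (S *ᵥ weights T) := h7.trans h4
  nlinarith [mul_nonneg (sub_nonneg.2 hη) (sub_nonneg.2 h4)]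

theorem quadForm_eq_sum (S : Matrix (Fin k) (Fin k) ℝ) (w : Fin k → ℝ) :
    w ⬝ᵥ (S *ᵥ w) = ∑ i, ∑ j, w i * w j * S i j := by
  simp only [dotProduct, Matrix.mulVec, Finset.mul_sum]
  exact Finset.sum_congr rfl fun i _ => Finset.sum_congr rfl fun j _ => by ring

theorem abs_quadForm_sub_le {d : ℝ} (h : ∀ i j, |T i j - S i j| ≤ d) (w : Fin k → ℝ) :
    |w ⬝ᵥ (T *ᵥ w) - w ⬝ᵥ (S *ᵥ w)| ≤ k * d * ∑ i, w i ^ 2 := by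
  rw [quadForm_eq_sum, quadForm_eq_sum, ← Finset.sum_sub_distrib]
  simp_rw [← Finset.sum_sub_distrib, ← mul_sub]
  refine (Finset.abs_sum_le_sum_abs _ _).trans ?_
  have hb : ∀ i j, |w i * w j * (T i j - S i j)| ≤ d * ((w i ^ 2 + w j ^ 2) / 2) := by
    intro i j
    rw [abs_mul, mul_comm]
    refine mul_le_mul (h i j) ?_ (abs_nonneg _) ((abs_nonneg _).trans (h i j))
    rw [abs_le]
    constructor <;> nlinarith [sq_nonneg (w i + w j), sq_nonneg (w i - w j)]
  refine (Finset.sum_le_sum fun i _ => (Finset.abs_sum_le_sum_abs _ _).trans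
    (Finset.sum_le_sum fun j _ => hb i j)).trans (le_of_eq ?_)
  simp only [← Finset.mul_sum, add_div, Finset.sum_add_distrib, Finset.sum_const,
    Finset.card_univ, Fintype.card_fin, nsmul_eq_mul, ← Finset.sum_div]
  ring

end Weights

/-! ### The integrated square error as a quadratic form -/

section Gram

variable {k : ℕ} {a : Fin k → ℝ → ℝ}

theorem quadForm_gram (ha : ∀ i, MemLp (a i) 2) (w : Fin k → ℝ) :
    w ⬝ᵥ ((Matrix.of fun i j => ∫ t, a i t * a j t) *ᵥ w) = ∫ t, (∑ i, w i * a i t) ^ 2 := by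
  have hint : ∀ i j, Integrable fun t => w i * w j * (a i t * a j t) := fun i j =>
    ((ha i).integrable_mul (ha j)).const_mul _
  have h1 : ∀ t, (∑ i, w i * a i t) ^ 2 = ∑ i, ∑ j, w i * w j * (a i t * a j t) := by
    intro t
    rw [sq, Finset.sum_mul_sum]
    exact Finset.sum_congr rfl fun i _ => Finset.sum_congr rfl fun j _ => by ring
  simp_rw [h1]
  rw [integral_finsetSum _ fun i _ => integrable_finsetSum _ fun j _ => hint i j,
    quadForm_eq_sum]
  refine Finset.sum_congr rfl fun i _ => ?_
  rw [integral_finsetSum _ fun j _ => hint i j]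
  exact Finset.sum_congr rfl fun j _ => (integral_const_mul _ _).symm

theorem posSemidef_gram (ha : ∀ i, MemLp (a i) 2) :
    (Matrix.of fun i j => ∫ t, a i t * a j t : Matrix (Fin k) (Fin k) ℝ).PosSemidef := by
  refine Matrix.PosSemidef.of_dotProduct_mulVec_nonneg ?_ fun w => ?_
  · ext i j
    simp [Matrix.conjTranspose, mul_comm]
  · rw [star_trivial, quadForm_gram ha]
    exact integral_nonneg fun t => sq_nonneg _

end Gram

section Error

variable {K f : ℝ → ℝ} {n k : ℕ} {x : ℕ → ℝ}

theorem ISE_combination {h : Fin k → ℝ} (he : ∀ i, MemLp (fun t => kde K n x (h i) t - f t) 2)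
    {w : Fin k → ℝ} (hw : ∑ i, w i = 1) :
    ISE f (combination K n x h w) = w ⬝ᵥ (errorGram K f n x h *ᵥ w) := by
  rw [errorGram, quadForm_gram he, ISE]
  refine integral_congr_ae (Eventually.of_forall fun t => ?_)
  simp only [combination, mul_sub, Finset.sum_sub_distrib, ← Finset.sum_mul, hw, one_mul]

/-- The kernel estimator is continuous with compact support. -/
theorem memLp_kde (hK : Continuous K) (hKs : HasCompactSupport K) {h : ℝ} (hh : 0 < h) :
    MemLp (kde K n x h) 2 := by
  have h1 : ∀ m, MemLp (fun t => K (h⁻¹ * (x m - t))) 2 := by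
    intro m
    have hc : Continuous fun t => K (h⁻¹ * (x m - t)) := by fun_prop
    refine hc.memLp_of_hasCompactSupport ?_
    have h2 : IsHomeomorph fun t : ℝ => h⁻¹ * (x m - t) :=
      ((Homeomorph.subLeft (x m)).trans (Homeomorph.mulLeft₀ h⁻¹ (inv_pos.2 hh).ne')).isHomeomorph
    exact hKs.comp_isClosedEmbedding h2.isClosedEmbedding
  exact (memLp_finsetSum (Finset.range n) fun m _ => h1 m).const_mul _

theorem memLp_density (hf : IsSmoothDensity f) : MemLp f 2 := by
  have h := hf.sq_integrable 0 (by norm_num)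
  simp only [iteratedDeriv_zero] at h
  exact (memLp_two_iff_integrable_sq hf.contDiff.continuous.aestronglyMeasurable).2 h

theorem posSemidef_errorGram {h : Fin k → ℝ}
    (he : ∀ i, MemLp (fun t => kde K n x (h i) t - f t) 2) :
    (errorGram K f n x h).PosSemidef := posSemidef_gram he

end Error

/-! ### The rescaled limit matrix -/

/-- The entry of `n ^ (4/5) (A + g B)` as a function of the rescaled bandwidths
`a = n ^ (1/5) h_i` and `b = n ^ (1/5) h_j`; it does not depend on `n`. -/
def scaledGram (K : ℝ → ℝ) (a b g : ℝ) : ℝ :=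
  (a * b)⁻¹ * (∫ u, K (u / a) * K (u / b)) + g * (1 / 4 * a ^ 2 * b ^ 2 * (∫ u, u ^ 2 * K u) ^ 2)

section Scaling

variable {K : ℝ → ℝ} {n k : ℕ}

theorem rpow_fifth_pos (hn : 1 ≤ n) : 0 < (n : ℝ) ^ (1 / 5 : ℝ) :=
  Real.rpow_pos_of_pos (by exact_mod_cast hn) _

theorem rpow_fifth_pow_five (n : ℕ) : ((n : ℝ) ^ (1 / 5 : ℝ)) ^ 5 = n := by
  rw [← Real.rpow_natCast, ← Real.rpow_mul (Nat.cast_nonneg n)]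
  norm_num

theorem rpow_neg_div_five (n j : ℕ) :
    (n : ℝ) ^ (-(j / 5) : ℝ) = (((n : ℝ) ^ (1 / 5 : ℝ)) ^ j)⁻¹ := by
  rw [← Real.rpow_natCast, ← Real.rpow_mul (Nat.cast_nonneg n), Real.rpow_neg (Nat.cast_nonneg n)]
  congr 2
  ring

theorem integral_dilation_mul {s : ℝ} (hs : 0 < s) (a b : ℝ) :
    ∫ u, K (u / (s * a)) * K (u / (s * b)) = s * ∫ u, K (u / a) * K (u / b) := by
  have h := Measure.integral_comp_div (fun u => K (u / a) * K (u / b)) s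
  rw [abs_of_pos hs, smul_eq_mul] at h
  rw [← h]
  simp only [div_div]

theorem approxGram_eq_scaledGram {s : ℝ} (hs : 0 < s) (hsn : s ^ 5 = n) {h : Fin k → ℝ}
    (hh : ∀ i, 0 < h i) (g : ℝ) (i j : Fin k) :
    approxGram K n h g i j = (s ^ 4)⁻¹ * scaledGram K (s * h i) (s * h j) g := by
  have hi := (hh i).ne'
  have hj := (hh j).ne'
  simp only [approxGram, matA, matB, scaledGram, Matrix.add_apply, Matrix.smul_apply,
    Matrix.of_apply, smul_eq_mul, integral_dilation_mul hs, ← hsn]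
  field_simp

end Scaling

section Continuity

variable {K : ℝ → ℝ}

theorem exists_support_bound (hKs : HasCompactSupport K) :
    ∃ R : ℝ, 0 < R ∧ ∀ u, R < |u| → K u = 0 := by
  obtain ⟨R, hR⟩ := hKs.isCompact.isBounded.subset_closedBall 0
  refine ⟨max R 1, by positivity, fun u hu => ?_⟩
  by_contra h
  have h1 := hR (subset_tsupport K h)
  rw [mem_closedBall_zero_iff, Real.norm_eq_abs] at h1
  exact absurd (h1.trans (le_max_left R 1)) (not_le.2 hu)

theorem continuousAt_integral_dilation_mul (hK : Continuous K) (hKs : HasCompactSupport K)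
    {a b : ℝ} (ha : 0 < a) (hb : 0 < b) :
    ContinuousAt (fun p : ℝ × ℝ => ∫ u, K (u / p.1) * K (u / p.2)) (a, b) := by
  obtain ⟨R, hR, hKR⟩ := exists_support_bound hKs
  obtain ⟨C, hC⟩ := hK.bounded_above_of_compact_support hKs
  have hC0 : 0 ≤ C := (norm_nonneg _).trans (hC 0)
  refine continuousAt_of_dominated (bound := (Set.Icc (-(R * (a + 1))) (R * (a + 1))).indicator
    fun _ => C * C) (Eventually.of_forall fun p => ?_) ?_ ?_ (Eventually.of_forall fun u => ?_)
  · exact (by fun_prop : Continuous fun u => K (u / p.1) * K (u / p.2)).aestronglyMeasurable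
  · have h1 : ∀ᶠ p : ℝ × ℝ in 𝓝 (a, b), 0 < p.1 :=
      continuousAt_fst.eventually (lt_mem_nhds ha)
    have h2 : ∀ᶠ p : ℝ × ℝ in 𝓝 (a, b), p.1 < a + 1 :=
      continuousAt_fst.eventually (gt_mem_nhds (lt_add_one a))
    filter_upwards [h1, h2] with p hp1 hp2
    refine Eventually.of_forall fun u => ?_
    by_cases hu : u ∈ Set.Icc (-(R * (a + 1))) (R * (a + 1))
    · rw [Set.indicator_of_mem hu, norm_mul]
      exact mul_le_mul (hC _) (hC _) (norm_nonneg _) hC0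
    · rw [Set.indicator_of_notMem hu, hKR (u / p.1), zero_mul, norm_zero]
      rw [abs_div, abs_of_pos hp1, lt_div_iff₀ hp1]
      rw [Set.mem_Icc, ← abs_le, not_le] at hu
      exact (mul_lt_mul_of_pos_left hp2 hR).trans hu
  · exact (integrable_indicator_iff measurableSet_Icc).2 (integrableOn_const (by simp))
  · have h1 : ContinuousAt (fun p : ℝ × ℝ => u / p.1) (a, b) :=
      continuousAt_const.div continuousAt_fst ha.ne'
    have h2 : ContinuousAt (fun p : ℝ × ℝ => u / p.2) (a, b) :=
      continuousAt_const.div continuousAt_snd hb.ne'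
    exact (hK.continuousAt.comp h1).mul (hK.continuousAt.comp h2)

theorem continuousOn_scaledGram (hK : Continuous K) (hKs : HasCompactSupport K) :
    ContinuousOn (fun p : ℝ × ℝ × ℝ => scaledGram K p.1 p.2.1 p.2.2)
      {p | 0 < p.1 ∧ 0 < p.2.1} := by
  rintro ⟨a, b, g⟩ ⟨ha, hb⟩
  refine ContinuousAt.continuousWithinAt ?_
  have h1 : ContinuousAt (fun p : ℝ × ℝ × ℝ => ∫ u, K (u / p.1) * K (u / p.2.1)) (a, b, g) :=
    ContinuousAt.comp (f := fun p : ℝ × ℝ × ℝ => (p.1, p.2.1))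
      (continuousAt_integral_dilation_mul hK hKs ha hb) (by fun_prop)
  have h2 : ContinuousAt (fun p : ℝ × ℝ × ℝ => (p.1 * p.2.1)⁻¹) (a, b, g) :=
    ContinuousAt.inv₀ (by fun_prop) (mul_pos ha hb).ne'
  exact (h2.mul h1).add (by fun_prop)

/-- On compact sets of bandwidths and of values of `g` the rescaled matrix is uniformly
continuous. -/
theorem exists_delta_scaledGram (hK : Continuous K) (hKs : HasCompactSupport K) {c₁ c₂ : ℝ}
    (hc₁ : 0 < c₁) (γ : ℝ) {ε : ℝ} (hε : 0 < ε) :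
    ∃ δ > 0, ∀ a b a' b' g : ℝ, a ∈ Set.Icc c₁ c₂ → b ∈ Set.Icc c₁ c₂ → |a' - a| ≤ δ →
      |b' - b| ≤ δ → |g - γ| ≤ δ → |scaledGram K a' b' g - scaledGram K a b γ| ≤ ε := by
  set s : Set (ℝ × ℝ × ℝ) := Set.Icc (c₁ / 2) (c₂ + 1) ×ˢ
    (Set.Icc (c₁ / 2) (c₂ + 1) ×ˢ Set.Icc (γ - 1) (γ + 1))
  have hs : IsCompact s := isCompact_Icc.prod (isCompact_Icc.prod isCompact_Icc)
  have hcont : ContinuousOn (fun p : ℝ × ℝ × ℝ => scaledGram K p.1 p.2.1 p.2.2) s :=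
    (continuousOn_scaledGram hK hKs).mono fun p hp =>
      ⟨(half_pos hc₁).trans_le hp.1.1, (half_pos hc₁).trans_le hp.2.1.1⟩
  obtain ⟨δ, hδ, H⟩ := Metric.uniformContinuousOn_iff_le.1
    (hs.uniformContinuousOn_of_continuous hcont) ε hε
  refine ⟨min δ (min 1 (c₁ / 2)), by positivity, fun a b a' b' g ha hb haa hbb hg => ?_⟩
  simp only [le_min_iff, abs_le] at haa hbb hg
  have := H (a', b', g) ⟨⟨by linarith [ha.1], by linarith [ha.2]⟩,
    ⟨by linarith [hb.1], by linarith [hb.2]⟩, ⟨by linarith, by linarith⟩⟩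
    (a, b, γ) ⟨⟨by linarith [ha.1], by linarith [ha.2]⟩,
    ⟨by linarith [hb.1], by linarith [hb.2]⟩, ⟨by linarith, by linarith⟩⟩ ?_
  · simpa [Real.dist_eq] using this
  · simp only [Prod.dist_eq, Real.dist_eq, max_le_iff, abs_le]
    refine ⟨⟨?_, ?_⟩, ⟨?_, ?_⟩, ?_, ?_⟩ <;> linarith

theorem exists_bound_scaledGram (hK : Continuous K) (hKs : HasCompactSupport K) {c₁ c₂ : ℝ}
    (hc₁ : 0 < c₁) (γ : ℝ) :
    ∃ C : ℝ, ∀ a ∈ Set.Icc c₁ c₂, ∀ b ∈ Set.Icc c₁ c₂, |scaledGram K a b γ| ≤ C := by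
  have hs : IsCompact (Set.Icc c₁ c₂ ×ˢ (Set.Icc c₁ c₂ ×ˢ ({γ} : Set ℝ))) :=
    isCompact_Icc.prod (isCompact_Icc.prod isCompact_singleton)
  obtain ⟨C, hC⟩ := hs.exists_bound_of_continuousOn ((continuousOn_scaledGram hK hKs).mono
    fun p hp => ⟨hc₁.trans_le hp.1.1, hc₁.trans_le hp.2.1.1⟩)
  exact ⟨C, fun a ha b hb => hC (a, b, γ) ⟨ha, hb, rfl⟩⟩

end Continuity

/-! ### Linear independence of the dilations of the kernel -/

section Dilations

variable {K : ℝ → ℝ} {k : ℕ}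

theorem hasCompactSupport_comp_div (hKs : HasCompactSupport K) {a : ℝ} (ha : 0 < a) :
    HasCompactSupport fun u => K (u / a) := by
  simp only [div_eq_mul_inv]
  exact hKs.comp_isClosedEmbedding
    (Homeomorph.mulRight₀ a⁻¹ (inv_pos.2 ha).ne').isClosedEmbedding

theorem integral_even_moment_pos (hK : IsKernel K) (hKc : Continuous K)
    (hKs : HasCompactSupport K) (p : ℕ) : 0 < ∫ u, (u ^ 2) ^ p * K u := by
  have hnn : ∀ u, 0 ≤ (u ^ 2) ^ p * K u := fun u => mul_nonneg (by positivity) (hK.nonneg u)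
  have hint : Integrable fun u => (u ^ 2) ^ p * K u :=
    (by fun_prop : Continuous fun u => (u ^ 2) ^ p * K u).integrable_of_hasCompactSupport
      hKs.mul_left
  refine lt_of_le_of_ne (integral_nonneg hnn) fun h0 => ?_
  have h1 := (integral_eq_zero_iff_of_nonneg hnn hint).1 h0.symm
  have h2 : K =ᵐ[volume] 0 := by
    filter_upwards [h1, Measure.ae_ne volume (0 : ℝ)] with u hu hu0
    simpa [hu0] using hu
  have h3 := hK.integral_eq_one
  rw [integral_congr_ae h2] at h3
  simp at h3

/-- Dilations of the kernel by distinct factors are linearly independent: a vanishing combination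
has vanishing even moments, and these form a Vandermonde system. -/
theorem eq_zero_of_sum_dilation_eq_zero (hK : IsKernel K) (hKc : Continuous K)
    (hKs : HasCompactSupport K) {a : Fin k → ℝ} (ha : ∀ i, 0 < a i)
    (hinj : Function.Injective a) {w : Fin k → ℝ}
    (hw : ∀ u, ∑ i, w i * ((a i)⁻¹ * K (u / a i)) = 0) : w = 0 := by
  refine Matrix.eq_zero_of_forall_pow_sum_mul_pow_eq_zero (f := fun i => a i ^ 2)
    (fun i j hij => hinj ((pow_left_inj₀ (ha i).le (ha j).le two_ne_zero).1 hij)) fun p => ?_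
  have hterm : ∀ i, ∫ u, (u ^ 2) ^ (p : ℕ) * (w i * ((a i)⁻¹ * K (u / a i)))
      = w i * (a i ^ 2) ^ (p : ℕ) * ∫ u, (u ^ 2) ^ (p : ℕ) * K u := by
    intro i
    have h := Measure.integral_comp_div (fun v => (v ^ 2) ^ (p : ℕ) * K v) (a i)
    rw [abs_of_pos (ha i), smul_eq_mul] at h
    have h1 : ∀ u, (u ^ 2) ^ (p : ℕ) * (w i * ((a i)⁻¹ * K (u / a i)))
        = w i * (a i ^ 2) ^ (p : ℕ) * (a i)⁻¹ * (((u / a i) ^ 2) ^ (p : ℕ) * K (u / a i)) := by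
      intro u
      have := (ha i).ne'
      rw [div_pow, div_pow]
      field_simp
    simp_rw [h1]
    rw [integral_const_mul, h]
    have := (ha i).ne'
    field_simp
  have hint : ∀ i, Integrable fun u => (u ^ 2) ^ (p : ℕ) * (w i * ((a i)⁻¹ * K (u / a i))) := by
    intro i
    refine (by fun_prop : Continuous _).integrable_of_hasCompactSupport ?_
    exact (((hasCompactSupport_comp_div hKs (ha i)).mul_left).mul_left).mul_left
  have hsum : ∑ i, w i * (a i ^ 2) ^ (p : ℕ) * ∫ u, (u ^ 2) ^ (p : ℕ) * K u = 0 := by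
    simp_rw [← hterm]
    rw [← integral_finsetSum _ fun i _ => hint i]
    simp_rw [← Finset.mul_sum, hw, mul_zero, integral_zero]
  rw [← Finset.sum_mul] at hsum
  exact (mul_eq_zero.1 hsum).resolve_right (integral_even_moment_pos hK hKc hKs p).ne'

theorem quadForm_dilationGram (hK : Continuous K) (hKs : HasCompactSupport K) {a : Fin k → ℝ}
    (ha : ∀ i, 0 < a i) (w : Fin k → ℝ) :
    ∑ i, ∑ j, w i * w j * ((a i * a j)⁻¹ * ∫ u, K (u / a i) * K (u / a j))
      = ∫ u, (∑ i, w i * ((a i)⁻¹ * K (u / a i))) ^ 2 := by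
  have hm : ∀ i, MemLp (fun u => (a i)⁻¹ * K (u / a i)) 2 := by
    intro i
    refine (by fun_prop : Continuous _).memLp_of_hasCompactSupport ?_
    exact (hasCompactSupport_comp_div hKs (ha i)).mul_left
  rw [← quadForm_gram hm, quadForm_eq_sum]
  refine Finset.sum_congr rfl fun i _ => Finset.sum_congr rfl fun j _ => ?_
  rw [Matrix.of_apply, ← integral_const_mul]
  congr 2
  ext u
  rw [mul_inv]
  ring

theorem quadForm_dilationGram_pos (hK : IsKernel K) (hKc : Continuous K)
    (hKs : HasCompactSupport K) {a : Fin k → ℝ} (ha : ∀ i, 0 < a i)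
    (hinj : Function.Injective a) {w : Fin k → ℝ} (hw : w ≠ 0) :
    0 < ∑ i, ∑ j, w i * w j * ((a i * a j)⁻¹ * ∫ u, K (u / a i) * K (u / a j)) := by
  rw [quadForm_dilationGram hKc hKs ha]
  have hm : ∀ i, MemLp (fun u => w i * ((a i)⁻¹ * K (u / a i))) 2 := by
    intro i
    refine (by fun_prop : Continuous _).memLp_of_hasCompactSupport ?_
    exact ((hasCompactSupport_comp_div hKs (ha i)).mul_left).mul_left
  have hint : Integrable fun u => (∑ i, w i * ((a i)⁻¹ * K (u / a i))) ^ 2 :=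
    (memLp_finsetSum Finset.univ fun i _ => hm i).integrable_sq
  refine lt_of_le_of_ne (integral_nonneg fun u => sq_nonneg _) fun h0 => hw ?_
  have h1 := (integral_eq_zero_iff_of_nonneg (fun u => sq_nonneg _) hint).1 h0.symm
  have hc : Continuous fun u => (∑ i, w i * ((a i)⁻¹ * K (u / a i))) ^ 2 := by fun_prop
  have h2 := (hc.ae_eq_iff_eq volume continuous_const).1 h1
  refine eq_zero_of_sum_dilation_eq_zero hK hKc hKs ha hinj fun u => ?_
  exact pow_eq_zero_iff two_ne_zero |>.1 (congrFun h2 u)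

/-- By compactness the form of the dilation Gram matrix is bounded below, uniformly over dilation
factors in a compact interval that stay apart from each other. -/
theorem exists_lower_bound_dilationGram (hK : IsKernel K) (hKc : Continuous K)
    (hKs : HasCompactSupport K) {c₁ c₂ c₃ : ℝ} (hc₁ : 0 < c₁) (hc₃ : 0 < c₃) :
    ∃ c > 0, ∀ a : Fin k → ℝ, (∀ i, a i ∈ Set.Icc c₁ c₂) →
      (∀ i j, i ≠ j → c₃ ≤ |a i - a j|) → ∀ w : Fin k → ℝ, c * ∑ i, w i ^ 2 ≤
        ∑ i, ∑ j, w i * w j * ((a i * a j)⁻¹ * ∫ u, K (u / a i) * K (u / a j)) := by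
  set F : (Fin k → ℝ) × (Fin k → ℝ) → ℝ := fun p =>
    ∑ i, ∑ j, p.2 i * p.2 j * ((p.1 i * p.1 j)⁻¹ * ∫ u, K (u / p.1 i) * K (u / p.1 j)) with hF
  set s : Set (Fin k → ℝ) := Set.Icc (fun _ => c₁) (fun _ => c₂) ∩
    {a | ∀ i j, i ≠ j → c₃ ≤ |a i - a j|}
  set t : Set (Fin k → ℝ) := Set.Icc (fun _ => -1) (fun _ => 1) ∩ {w | ∑ i, w i ^ 2 = 1}
  have hs : IsCompact s := by
    refine isCompact_Icc.inter_right ?_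
    simp only [Set.ofPred_forall]
    exact isClosed_iInter fun i => isClosed_iInter fun j => isClosed_iInter fun _ =>
      isClosed_le continuous_const (by fun_prop)
  have ht : IsCompact t := isCompact_Icc.inter_right (isClosed_eq (by fun_prop) continuous_const)
  have hcont : ContinuousOn F (s ×ˢ t) := by
    rintro ⟨a, w⟩ ⟨⟨ha, -⟩, -⟩
    have hpos : ∀ i, 0 < a i := fun i => hc₁.trans_le (ha.1 i)
    refine ContinuousAt.continuousWithinAt ?_
    refine tendsto_finsetSum _ fun i _ => tendsto_finsetSum _ fun j _ => ?_
    have h1 : ContinuousAt (fun p : (Fin k → ℝ) × (Fin k → ℝ) => p.2 i * p.2 j) (a, w) := by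
      fun_prop
    have h2 : ContinuousAt (fun p : (Fin k → ℝ) × (Fin k → ℝ) => (p.1 i * p.1 j)⁻¹) (a, w) :=
      ContinuousAt.inv₀ (by fun_prop) (mul_pos (hpos i) (hpos j)).ne'
    have h3 : ContinuousAt (fun p : (Fin k → ℝ) × (Fin k → ℝ) =>
        ∫ u, K (u / p.1 i) * K (u / p.1 j)) (a, w) :=
      ContinuousAt.comp (f := fun p : (Fin k → ℝ) × (Fin k → ℝ) => (p.1 i, p.1 j))
        (continuousAt_integral_dilation_mul hKc hKs (hpos i) (hpos j)) (by fun_prop)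
    exact h1.mul (h2.mul h3)
  have hlow : ∃ c > 0, ∀ p ∈ s ×ˢ t, c ≤ F p := by
    refine (hs.prod ht).exists_forall_le' hcont (a := 0) ?_
    rintro ⟨a, w⟩ ⟨⟨ha, hsep⟩, -, hw⟩
    refine quadForm_dilationGram_pos hK hKc hKs (fun i => hc₁.trans_le (ha.1 i)) ?_ ?_
    · intro i j hij
      by_contra hne
      have := hsep i j hne
      rw [hij, sub_self, abs_zero] at this
      exact absurd this (not_le.2 hc₃)
    · rintro rfl
      simp at hw
  obtain ⟨c, hc, H⟩ := hlow
  refine ⟨c, hc, fun a ha hsep w => ?_⟩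
  rcases (Finset.sum_nonneg fun i _ => sq_nonneg (w i) : 0 ≤ ∑ i, w i ^ 2).eq_or_lt with h0 | h0
  · have hw : w = 0 := by
      ext i
      have := (Finset.sum_eq_zero_iff_of_nonneg fun i _ => sq_nonneg (w i)).1 h0.symm i
        (Finset.mem_univ i)
      simpa using this
    simp [hw]
  · set N := √(∑ i, w i ^ 2) with hN
    have hNpos : 0 < N := Real.sqrt_pos.2 h0
    have hNsq : N ^ 2 = ∑ i, w i ^ 2 := Real.sq_sqrt h0.le
    have hle : ∀ i, |w i| ≤ N := fun i => Real.abs_le_sqrt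
      (Finset.single_le_sum (f := fun i => w i ^ 2) (fun j _ => sq_nonneg (w j))
        (Finset.mem_univ i))
    have h1 := H (a, fun i => w i / N) ⟨⟨⟨fun i => (ha i).1, fun i => (ha i).2⟩, hsep⟩,
      ⟨fun i => ?_, fun i => ?_⟩, ?_⟩
    · have h2 : F (a, fun i => w i / N) = F (a, w) / N ^ 2 := by
        simp only [hF, Finset.sum_div]
        refine Finset.sum_congr rfl fun i _ => Finset.sum_congr rfl fun j _ => ?_
        field_simp
      rw [h2, le_div_iff₀ (by positivity), hNsq] at h1
      exact h1
    · rw [le_div_iff₀ hNpos]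
      linarith [neg_le_of_abs_le (hle i)]
    · exact (div_le_one hNpos).2 (le_of_abs_le (hle i))
    · simp only [Set.mem_ofPred_eq, div_pow, ← Finset.sum_div, hNsq]
      exact div_self h0.ne'

end Dilations

/-! ### Cauchy–Schwarz inequalities -/

section CauchySchwarz

open scoped ENNReal

variable {α β : Type*} [MeasurableSpace α] [MeasurableSpace β] {μ : Measure α} {ν : Measure β}

theorem sq_lintegral_mul_le {a b : α → ℝ≥0∞} (ha : AEMeasurable a μ) (hb : AEMeasurable b μ) :
    (∫⁻ u, a u * b u ∂μ) ^ 2 ≤ (∫⁻ u, a u ^ 2 ∂μ) * ∫⁻ u, b u ^ 2 ∂μ := by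
  have h := ENNReal.lintegral_mul_le_Lp_mul_Lq μ Real.HolderConjugate.two_two ha hb
  simp only [Pi.mul_apply, ENNReal.rpow_ofNat] at h
  refine (pow_le_pow_left₀ zero_le h 2).trans (le_of_eq ?_)
  rw [mul_pow, ← ENNReal.rpow_ofNat, ← ENNReal.rpow_ofNat, ← ENNReal.rpow_mul, ← ENNReal.rpow_mul]
  norm_num

theorem ofReal_sq_integral_mul_le {a b : α → ℝ} (ha : AEMeasurable a μ) (hb : AEMeasurable b μ) :
    ENNReal.ofReal ((∫ u, a u * b u ∂μ) ^ 2) ≤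
      (∫⁻ u, ENNReal.ofReal (a u ^ 2) ∂μ) * ∫⁻ u, ENNReal.ofReal (b u ^ 2) ∂μ := by
  have h1 : ∀ x : ℝ, ENNReal.ofReal (x ^ 2) = ‖x‖ₑ ^ 2 := fun x => by
    rw [← Real.enorm_of_nonneg (sq_nonneg x), enorm_pow]
  simp_rw [h1]
  refine (pow_le_pow_left₀ zero_le (enorm_integral_le_lintegral_enorm _) 2).trans ?_
  simp_rw [enorm_mul]
  exact sq_lintegral_mul_le ha.enorm hb.enorm

/-- An integral of functions, weighted by `a`, has square norm at most `∫ a²` times the integral of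
the square norms. -/
theorem lintegral_sq_integral_mul_le [SFinite μ] [SFinite ν] {a : β → ℝ} {Φ : α → β → ℝ}
    (ha : Measurable a) (hΦ : Measurable fun p : α × β => Φ p.1 p.2) :
    ∫⁻ t, ENNReal.ofReal ((∫ u, a u * Φ t u ∂ν) ^ 2) ∂μ ≤
      (∫⁻ u, ENNReal.ofReal (a u ^ 2) ∂ν) *
        ∫⁻ u, ∫⁻ t, ENNReal.ofReal (Φ t u ^ 2) ∂μ ∂ν := by
  have hm : Measurable fun p : α × β => ENNReal.ofReal (Φ p.1 p.2 ^ 2) :=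
    (hΦ.pow_const 2).ennreal_ofReal
  rw [← lintegral_lintegral_swap hm.aemeasurable,
    ← lintegral_const_mul _ hm.lintegral_prod_right']
  exact lintegral_mono fun t => ofReal_sq_integral_mul_le ha.aemeasurable
    (hΦ.comp measurable_prodMk_left).aemeasurable

theorem abs_integral_mul_le {a b : α → ℝ} (ha : MemLp a 2 μ) (hb : MemLp b 2 μ) :
    |∫ t, a t * b t ∂μ| ≤ √(∫ t, a t ^ 2 ∂μ) * √(∫ t, b t ^ 2 ∂μ) := by
  rw [← Real.sqrt_mul (integral_nonneg fun t => sq_nonneg _)]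
  refine Real.abs_le_sqrt ?_
  have h := ofReal_sq_integral_mul_le (μ := μ) ha.aestronglyMeasurable.aemeasurable
    hb.aestronglyMeasurable.aemeasurable
  rw [← ofReal_integral_eq_lintegral_ofReal ha.integrable_sq
      (Eventually.of_forall fun t => sq_nonneg _),
    ← ofReal_integral_eq_lintegral_ofReal hb.integrable_sq
      (Eventually.of_forall fun t => sq_nonneg _),
    ← ENNReal.ofReal_mul (integral_nonneg fun t => sq_nonneg _)] at h
  exact (ENNReal.ofReal_le_ofReal_iff (mul_nonneg (integral_nonneg fun t => sq_nonneg _)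
    (integral_nonneg fun t => sq_nonneg _))).1 h

theorem integral_sq_le_of_lintegral_sq_le {g : α → ℝ} (hg : AEStronglyMeasurable g μ) {B : ℝ}
    (hB : 0 ≤ B) (h : ∫⁻ t, ENNReal.ofReal (g t ^ 2) ∂μ ≤ ENNReal.ofReal B) :
    ∫ t, g t ^ 2 ∂μ ≤ B := by
  rw [integral_eq_lintegral_of_nonneg_ae (Eventually.of_forall fun t => sq_nonneg _) (hg.pow 2)]
  exact ENNReal.toReal_le_of_le_ofReal hB h

end CauchySchwarz

/-! ### Square norms of Taylor remainders -/

section Taylor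

open scoped ENNReal

theorem lintegral_sq_translate (g : ℝ → ℝ) (z : ℝ) :
    ∫⁻ t, ENNReal.ofReal (g (t + z) ^ 2) = ∫⁻ t, ENNReal.ofReal (g t ^ 2) :=
  lintegral_add_right_eq_self (fun t => ENNReal.ofReal (g t ^ 2)) z

/-- Translation is continuous in `L²`. -/
theorem exists_delta_lintegral_sq_translate_sub {g : ℝ → ℝ} (hg : MemLp g 2)
    {ε : ℝ} (hε : 0 < ε) :
    ∃ δ > 0, ∀ z : ℝ, |z| ≤ δ →
      ∫⁻ t, ENNReal.ofReal ((g (t + z) - g t) ^ 2) ≤ ENNReal.ofReal ε := by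
  let T : ℝ → C(ℝ, ℝ) := fun z => ⟨fun t => t + z, by fun_prop⟩
  have hT : Continuous T :=
    ContinuousMap.continuous_of_continuous_uncurry _ (by
      change Continuous fun p : ℝ × ℝ => p.2 + p.1
      fun_prop)
  have hTm : ∀ z, MeasurePreserving (T z) volume volume := fun z =>
    measurePreserving_add_right volume z
  have hcont : Continuous fun z => Lp.compMeasurePreserving (T z) (hTm z) (hg.toLp g) :=
    continuous_const.compMeasurePreservingLp hT hTm (by simp)
  have hlim := (hcont.tendsto 0).edist (tendsto_const_nhds
    (x := Lp.compMeasurePreserving (T 0) (hTm 0) (hg.toLp g)))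
  rw [edist_self] at hlim
  have hev := hlim.eventually (gt_mem_nhds
    (show (0 : ℝ≥0∞) < ENNReal.ofReal (√ε) by simpa using hε))
  obtain ⟨δ, hδ, H⟩ := Metric.eventually_nhds_iff.1 hev
  refine ⟨δ / 2, half_pos hδ, fun z hz => ?_⟩
  have h1 := (H (y := z) (by rw [Real.dist_eq, sub_zero]; linarith)).le
  have hzero : Lp.compMeasurePreserving (T 0) (hTm 0) (hg.toLp g) = hg.toLp g := by
    rw [Lp.toLp_compMeasurePreserving]
    congr 1
    ext t
    simp [T]
  have hz' : Lp.compMeasurePreserving (T z) (hTm z) (hg.toLp g)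
      = (hg.comp_measurePreserving (hTm z)).toLp _ := Lp.toLp_compMeasurePreserving hg (hTm z)
  rw [hzero, hz', Lp.edist_toLp_toLp] at h1
  have h2 : ∀ x : ℝ, ENNReal.ofReal (x ^ 2) = ‖x‖ₑ ^ 2 := fun x => by
    rw [← Real.enorm_of_nonneg (sq_nonneg x), enorm_pow]
  have h3 := pow_le_pow_left₀ zero_le h1 2
  have h4 := eLpNorm_nnreal_pow_eq_lintegral (f := g ∘ T z - g) (μ := volume) (p := 2) two_ne_zero
  simp only [NNReal.coe_ofNat, ENNReal.coe_ofNat, ENNReal.rpow_ofNat] at h4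
  rw [h4, ← ENNReal.ofReal_pow (Real.sqrt_nonneg _), Real.sq_sqrt hε.le] at h3
  simp_rw [h2]
  exact h3

variable {g g' g'' : ℝ → ℝ}

theorem sub_eq_integral_deriv (h1 : ∀ x, HasDerivAt g (g' x) x) (hc : Continuous g') (t z : ℝ) :
    g (t + z) - g t = ∫ v in (0 : ℝ)..1, z * g' (t + v * z) := by
  have hd : ∀ v ∈ Set.uIcc (0 : ℝ) 1,
      HasDerivAt (fun v => g (t + v * z)) (z * g' (t + v * z)) v := by
    intro v _
    have h2 : HasDerivAt (fun v : ℝ => t + v * z) z v := by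
      simpa using ((hasDerivAt_id v).mul_const z).const_add t
    exact ((h1 (t + v * z)).comp v h2).congr_deriv (mul_comm _ _)
  rw [intervalIntegral.integral_eq_sub_of_hasDerivAt hd
    ((by fun_prop : Continuous fun v => z * g' (t + v * z)).intervalIntegrable _ _)]
  simp

theorem taylor_remainder_eq_integral (h1 : ∀ x, HasDerivAt g (g' x) x)
    (h2 : ∀ x, HasDerivAt g' (g'' x) x) (hc : Continuous g'') (t z : ℝ) :
    g (t + z) - g t - z * g' t = ∫ v in (0 : ℝ)..1, z ^ 2 * (1 - v) * g'' (t + v * z) := by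
  -- The antiderivative is the first-order expansion around `t + v z`, evaluated at `t + z`.
  have hd : ∀ v ∈ Set.uIcc (0 : ℝ) 1, HasDerivAt
      (fun v => g (t + v * z) + (1 - v) * (z * g' (t + v * z)))
      (z ^ 2 * (1 - v) * g'' (t + v * z)) v := by
    intro v _
    have h3 : HasDerivAt (fun v : ℝ => t + v * z) z v := by
      simpa using ((hasDerivAt_id v).mul_const z).const_add t
    have h4 := (h1 (t + v * z)).comp v h3
    have h5 := (((h2 (t + v * z)).comp v h3).const_mul z)
    have h6 := ((hasDerivAt_id v).const_sub 1).mul h5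
    convert! h4.add h6 using 1
    simp only [Function.comp_apply, id]
    ring
  rw [intervalIntegral.integral_eq_sub_of_hasDerivAt hd
    ((by fun_prop : Continuous fun v => z ^ 2 * (1 - v) * g'' (t + v * z)).intervalIntegrable _ _)]
  simp
  ring

theorem taylor_remainder_second_eq_integral (h1 : ∀ x, HasDerivAt g (g' x) x)
    (h2 : ∀ x, HasDerivAt g' (g'' x) x) (hc : Continuous g'') (t z : ℝ) :
    g (t + z) - g t - z * g' t - z ^ 2 / 2 * g'' t
      = ∫ v in (0 : ℝ)..1, z ^ 2 * (1 - v) * (g'' (t + v * z) - g'' t) := by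
  have hi : ∫ v in (0 : ℝ)..1, z ^ 2 * (1 - v) * g'' t = z ^ 2 / 2 * g'' t := by
    rw [intervalIntegral.integral_mul_const, intervalIntegral.integral_const_mul,
      intervalIntegral.integral_sub (by simp) (by simp)]
    simp
    left
    ring
  rw [taylor_remainder_eq_integral h1 h2 hc, ← hi, ← intervalIntegral.integral_sub]
  · simp_rw [mul_sub]
  · exact (by fun_prop :
      Continuous fun v => z ^ 2 * (1 - v) * g'' (t + v * z)).intervalIntegrable _ _
  · exact (by fun_prop : Continuous fun v => z ^ 2 * (1 - v) * g'' t).intervalIntegrable _ _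

theorem abs_taylor_remainder_le (h1 : ∀ x, HasDerivAt g (g' x) x)
    (h2 : ∀ x, HasDerivAt g' (g'' x) x) (hc : Continuous g'') {C : ℝ} (hC : ∀ x, |g'' x| ≤ C)
    (t z : ℝ) : |g (t + z) - g t - z * g' t| ≤ C * z ^ 2 := by
  rw [taylor_remainder_eq_integral h1 h2 hc, ← Real.norm_eq_abs]
  have h := intervalIntegral.norm_integral_le_of_norm_le_const (a := 0) (b := 1) (C := C * z ^ 2)
    (f := fun v => z ^ 2 * (1 - v) * g'' (t + v * z)) fun v hv => ?_
  · simpa using h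
  · rw [Set.uIoc_of_le zero_le_one] at hv
    rw [norm_mul, norm_mul, Real.norm_eq_abs, Real.norm_eq_abs, Real.norm_eq_abs,
      abs_of_nonneg (sq_nonneg z), abs_of_nonneg (by linarith [hv.2] : (0 : ℝ) ≤ 1 - v)]
    have h3 : z ^ 2 * (1 - v) ≤ z ^ 2 := by nlinarith [hv.1, sq_nonneg z]
    calc z ^ 2 * (1 - v) * |g'' (t + v * z)| ≤ z ^ 2 * C :=
          mul_le_mul h3 (hC _) (abs_nonneg _) (sq_nonneg z)
      _ = C * z ^ 2 := mul_comm _ _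

theorem lintegral_sq_sub_le (h1 : ∀ x, HasDerivAt g (g' x) x) (hc : Continuous g') (z : ℝ) :
    ∫⁻ t, ENNReal.ofReal ((g (t + z) - g t) ^ 2) ≤
      ENNReal.ofReal (z ^ 2) * ∫⁻ t, ENNReal.ofReal (g' t ^ 2) := by
  simp_rw [sub_eq_integral_deriv h1 hc, intervalIntegral.integral_of_le zero_le_one]
  refine (lintegral_sq_integral_mul_le (a := fun _ => z) (Φ := fun t v => g' (t + v * z))
    measurable_const (by fun_prop)).trans ?_
  simp_rw [lintegral_sq_translate g']
  simp

/-- The second-order Taylor remainder is controlled in `L²` by the `L²` modulus of continuity of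
`g''` under translation. -/
theorem lintegral_sq_taylor_remainder_le (h1 : ∀ x, HasDerivAt g (g' x) x)
    (h2 : ∀ x, HasDerivAt g' (g'' x) x) (hc : Continuous g'') {z : ℝ} {B : ℝ≥0∞}
    (hB : ∀ y, |y| ≤ |z| → ∫⁻ t, ENNReal.ofReal ((g'' (t + y) - g'' t) ^ 2) ≤ B) :
    ∫⁻ t, ENNReal.ofReal ((g (t + z) - g t - z * g' t - z ^ 2 / 2 * g'' t) ^ 2) ≤
      ENNReal.ofReal (z ^ 4) * B := by
  simp_rw [taylor_remainder_second_eq_integral h1 h2 hc,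
    intervalIntegral.integral_of_le zero_le_one]
  refine (lintegral_sq_integral_mul_le (a := fun v => z ^ 2 * (1 - v))
    (Φ := fun t v => g'' (t + v * z) - g'' t) (by fun_prop) (by fun_prop)).trans ?_
  refine mul_le_mul' ?_ ?_
  · calc ∫⁻ v in Set.Ioc (0 : ℝ) 1, ENNReal.ofReal ((z ^ 2 * (1 - v)) ^ 2)
        ≤ ∫⁻ _ in Set.Ioc (0 : ℝ) 1, ENNReal.ofReal (z ^ 4) := by
          refine setLIntegral_mono measurable_const fun v hv => ENNReal.ofReal_le_ofReal ?_
          have h3 : (1 - v) ^ 2 ≤ 1 := by nlinarith [hv.1, hv.2]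
          nlinarith [mul_le_mul_of_nonneg_left h3 (by positivity : 0 ≤ z ^ 4)]
      _ = ENNReal.ofReal (z ^ 4) := by simp
  · calc ∫⁻ v in Set.Ioc (0 : ℝ) 1, ∫⁻ t, ENNReal.ofReal ((g'' (t + v * z) - g'' t) ^ 2)
        ≤ ∫⁻ _ in Set.Ioc (0 : ℝ) 1, B := by
          refine setLIntegral_mono measurable_const fun v hv => hB _ ?_
          rw [abs_mul, abs_of_pos hv.1]
          exact mul_le_of_le_one_left (abs_nonneg z) hv.2
      _ = B := by simp

end Taylor

/-! ### Smoothing and the bias of the kernel estimator -/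

/-- The rescaled kernel `K_h = h⁻¹ K(h⁻¹ ·)`. -/
def dilate (K : ℝ → ℝ) (h u : ℝ) : ℝ := h⁻¹ * K (h⁻¹ * u)

/-- The smoothed density `t ↦ ∫ G(x - t) f(x) dx`, that is, the expectation of `G(X - t)`. -/
def smoothed (f G : ℝ → ℝ) (t : ℝ) : ℝ := ∫ x, G (x - t) * f x

namespace IsSmoothDensity

variable {f : ℝ → ℝ}

theorem continuous (hf : IsSmoothDensity f) : Continuous f := hf.contDiff.continuous

theorem hasDerivAt (hf : IsSmoothDensity f) (x : ℝ) : HasDerivAt f (iteratedDeriv 1 f x) x := by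
  rw [iteratedDeriv_one]
  exact (hf.contDiff.differentiable (by norm_num) x).hasDerivAt

theorem hasDerivAt_iteratedDeriv_one (hf : IsSmoothDensity f) (x : ℝ) :
    HasDerivAt (iteratedDeriv 1 f) (iteratedDeriv 2 f x) x := by
  rw [iteratedDeriv_succ (n := 1)]
  exact (hf.contDiff.differentiable_iteratedDeriv 1 (by norm_num) x).hasDerivAt

theorem continuous_iteratedDeriv_one (hf : IsSmoothDensity f) : Continuous (iteratedDeriv 1 f) :=
  hf.contDiff.continuous_iteratedDeriv 1 (by norm_num)

theorem continuous_iteratedDeriv_two (hf : IsSmoothDensity f) : Continuous (iteratedDeriv 2 f) :=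
  hf.contDiff.continuous_iteratedDeriv 2 le_rfl

theorem memLp_iteratedDeriv_two (hf : IsSmoothDensity f) : MemLp (iteratedDeriv 2 f) 2 :=
  (memLp_two_iff_integrable_sq hf.continuous_iteratedDeriv_two.aestronglyMeasurable).2
    (hf.sq_integrable 2 le_rfl)

theorem exists_bound (hf : IsSmoothDensity f) : ∃ C : ℝ, 0 ≤ C ∧ ∀ x, f x ≤ C := by
  obtain ⟨C, hC⟩ := hf.bounded 0 (by norm_num)
  simp only [iteratedDeriv_zero] at hC
  exact ⟨C, (abs_nonneg _).trans (hC 0), fun x => (le_abs_self _).trans (hC x)⟩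

end IsSmoothDensity

section Smoothing

variable {f G : ℝ → ℝ}

theorem integrable_mul_of_hasCompactSupport {g : ℝ → ℝ} (hG : Continuous G)
    (hGs : HasCompactSupport G) (hg : Continuous g) : Integrable fun u => G u * g u :=
  (hG.mul hg).integrable_of_hasCompactSupport hGs.mul_right

theorem hasCompactSupport_dilate (hGs : HasCompactSupport G) {h : ℝ} (hh : 0 < h) :
    HasCompactSupport (dilate G h) := by
  have h1 := hasCompactSupport_comp_div hGs hh
  simp only [div_eq_inv_mul] at h1
  exact h1.mul_left

theorem continuous_dilate (hG : Continuous G) (h : ℝ) : Continuous (dilate G h) := by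
  unfold dilate
  fun_prop

theorem integral_dilate {h : ℝ} (hh : 0 < h) : ∫ u, dilate G h u = ∫ u, G u := by
  simp only [dilate]
  rw [integral_const_mul, Measure.integral_comp_mul_left, inv_inv, abs_of_pos hh, smul_eq_mul,
    inv_mul_cancel_left₀ hh.ne']

theorem smoothed_dilate {h : ℝ} (hh : 0 < h) (t : ℝ) :
    smoothed f (dilate G h) t = ∫ u, G u * f (t + h * u) := by
  have h1 := Measure.integral_comp_mul_left (fun x => G (h⁻¹ * x) * f (t + x)) h
  have h2 := integral_sub_right_eq_self (μ := volume) (fun x => G (h⁻¹ * x) * f (t + x)) t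
  simp only [add_sub_cancel] at h2
  simp only [inv_mul_cancel_left₀ hh.ne', abs_of_pos (inv_pos.2 hh), smul_eq_mul] at h1
  rw [h1, ← h2, smoothed, ← integral_const_mul]
  exact integral_congr_ae (Eventually.of_forall fun x => by simp only [dilate]; ring)

/-- Averaging over a kernel supported in `[-R, R]` does not increase square norms by more than a
factor that depends on the kernel. -/
theorem lintegral_sq_kernel_average_le (hG : Continuous G) {R : ℝ}
    (hR : ∀ u, R < |u| → G u = 0) (hG2 : Integrable fun u => G u ^ 2)
    {Φ : ℝ → ℝ → ℝ} (hΦ : Measurable fun p : ℝ × ℝ => Φ p.1 p.2) {B : ENNReal}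
    (hB : ∀ u, |u| ≤ R → ∫⁻ t, ENNReal.ofReal (Φ t u ^ 2) ≤ B) :
    ∫⁻ t, ENNReal.ofReal ((∫ u, G u * Φ t u) ^ 2) ≤
      ENNReal.ofReal (∫ u, G u ^ 2) * (ENNReal.ofReal (2 * R) * B) := by
  have h1 : ∀ t, ∫ u, G u * Φ t u = ∫ u in Set.Icc (-R) R, G u * Φ t u := by
    intro t
    refine (setIntegral_eq_integral_of_forall_compl_eq_zero fun u hu => ?_).symm
    rw [Set.mem_Icc, ← abs_le, not_le] at hu
    rw [hR u hu, zero_mul]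
  simp_rw [h1]
  refine (lintegral_sq_integral_mul_le hG.measurable hΦ).trans (mul_le_mul' ?_ ?_)
  · rw [ofReal_integral_eq_lintegral_ofReal hG2 (Eventually.of_forall fun u => sq_nonneg _)]
    exact setLIntegral_le_lintegral _ _
  · calc ∫⁻ u in Set.Icc (-R) R, ∫⁻ t, ENNReal.ofReal (Φ t u ^ 2)
        ≤ ∫⁻ _ in Set.Icc (-R) R, B :=
          setLIntegral_mono measurable_const fun u hu => hB u (abs_le.2 hu)
      _ = ENNReal.ofReal (2 * R) * B := by
          rw [setLIntegral_const, Real.volume_Icc, mul_comm]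
          congr 2
          ring

/-- Smoothing with a kernel of total mass zero gains a factor `h`. -/
theorem exists_lintegral_sq_smoothed_dilate_le (hf : IsSmoothDensity f) (hG : Continuous G)
    (hGs : HasCompactSupport G) (hG0 : ∫ u, G u = 0) :
    ∃ C : ℝ, 0 ≤ C ∧ ∀ h : ℝ, 0 < h →
      ∫⁻ t, ENNReal.ofReal (smoothed f (dilate G h) t ^ 2) ≤ ENNReal.ofReal (C * h ^ 2) := by
  obtain ⟨R, hR0, hR⟩ := exists_support_bound hGs
  have hG2 : Integrable fun u => G u ^ 2 := (hG.memLp_of_hasCompactSupport hGs).integrable_sq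
  set D := ∫ t, iteratedDeriv 1 f t ^ 2 with hD
  have hD0 : 0 ≤ D := integral_nonneg fun t => sq_nonneg _
  have hG20 : 0 ≤ ∫ u, G u ^ 2 := integral_nonneg fun t => sq_nonneg _
  refine ⟨(∫ u, G u ^ 2) * (2 * R * (R ^ 2 * D)), by positivity, fun h hh => ?_⟩
  have h1 : ∀ t, smoothed f (dilate G h) t = ∫ u, G u * (f (t + h * u) - f t) := by
    intro t
    have hc := hf.continuous
    simp_rw [mul_sub]
    rw [smoothed_dilate hh, integral_sub (integrable_mul_of_hasCompactSupport hG hGs (by fun_prop))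
      (integrable_mul_of_hasCompactSupport hG hGs continuous_const), integral_mul_const, hG0,
      zero_mul, sub_zero]
  simp_rw [h1]
  have hc := hf.continuous
  refine (lintegral_sq_kernel_average_le hG hR hG2 (by fun_prop)
    (B := ENNReal.ofReal ((h * R) ^ 2 * D)) fun u hu => ?_).trans (le_of_eq ?_)
  · refine (lintegral_sq_sub_le hf.hasDerivAt hf.continuous_iteratedDeriv_one (h * u)).trans ?_
    rw [← ofReal_integral_eq_lintegral_ofReal (hf.sq_integrable 1 (by norm_num))
      (Eventually.of_forall fun u => sq_nonneg _), ← ENNReal.ofReal_mul (sq_nonneg _)]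
    refine ENNReal.ofReal_le_ofReal (mul_le_mul_of_nonneg_right ?_ hD0)
    rw [sq_le_sq, abs_mul, abs_mul, abs_of_pos hR0]
    exact mul_le_mul_of_nonneg_left hu (abs_nonneg h)
  · rw [← ENNReal.ofReal_mul (by positivity), ← ENNReal.ofReal_mul hG20]
    congr 1
    ring

end Smoothing

section Bias

variable {f K : ℝ → ℝ}

theorem integral_id_mul_kernel (hK : IsKernel K) : ∫ u, u * K u = 0 := by
  have h := integral_neg_eq_self (fun u => u * K u) volume
  simp only [hK.symmetric, neg_mul, integral_neg] at h
  linarith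

theorem smoothed_sub_eq (hf : IsSmoothDensity f) (hK : IsKernel K) (hKc : Continuous K)
    (hKs : HasCompactSupport K) {h : ℝ} (hh : 0 < h) (t : ℝ) :
    smoothed f (dilate K h) t - f t
      = ∫ u, K u * (f (t + h * u) - f t - h * u * iteratedDeriv 1 f t) := by
  have hc := hf.continuous
  have i1 := integrable_mul_of_hasCompactSupport hKc hKs
    (by fun_prop : Continuous fun u => f (t + h * u))
  have i2 := integrable_mul_of_hasCompactSupport hKc hKs
    (continuous_const : Continuous fun _ => f t)
  have i3 := integrable_mul_of_hasCompactSupport hKc hKs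
    (by fun_prop : Continuous fun u => h * u * iteratedDeriv 1 f t)
  have i12 : Integrable fun u => K u * f (t + h * u) - K u * f t := i1.sub i2
  have h3 : ∫ u, K u * (h * u * iteratedDeriv 1 f t) = 0 := by
    have : ∀ u, K u * (h * u * iteratedDeriv 1 f t) = h * iteratedDeriv 1 f t * (u * K u) :=
      fun u => by ring
    simp_rw [this]
    rw [integral_const_mul, integral_id_mul_kernel hK, mul_zero]
  simp_rw [mul_sub]
  rw [integral_sub i12 i3, integral_sub i1 i2, h3, integral_mul_const, hK.integral_eq_one,
    smoothed_dilate hh]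
  ring

theorem exists_abs_bias_le (hf : IsSmoothDensity f) (hK : IsKernel K) (hKc : Continuous K)
    (hKs : HasCompactSupport K) :
    ∃ C : ℝ, 0 ≤ C ∧ ∀ h : ℝ, 0 < h → ∀ t, |smoothed f (dilate K h) t - f t| ≤ C * h ^ 2 := by
  obtain ⟨C, hC⟩ := hf.bounded 2 le_rfl
  have hC0 : 0 ≤ C := (abs_nonneg _).trans (hC 0)
  refine ⟨C * ∫ u, u ^ 2 * K u, mul_nonneg hC0
    (integral_nonneg fun u => mul_nonneg (sq_nonneg u) (hK.nonneg u)), fun h hh t => ?_⟩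
  rw [smoothed_sub_eq hf hK hKc hKs hh]
  have hb : ∀ u, ‖K u * (f (t + h * u) - f t - h * u * iteratedDeriv 1 f t)‖
      ≤ C * h ^ 2 * (u ^ 2 * K u) := by
    intro u
    rw [norm_mul, Real.norm_eq_abs, Real.norm_eq_abs, abs_of_nonneg (hK.nonneg u)]
    have := abs_taylor_remainder_le hf.hasDerivAt hf.hasDerivAt_iteratedDeriv_one
      hf.continuous_iteratedDeriv_two hC t (h * u)
    nlinarith [mul_le_mul_of_nonneg_left this (hK.nonneg u)]
  refine (norm_integral_le_of_norm_le (hK.integrable_second_moment.const_mul _)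
    (Eventually.of_forall hb)).trans (le_of_eq ?_)
  rw [integral_const_mul]
  ring

/-- The bias is `½ h² c_K f''` up to an error of smaller order in `L²`. -/
theorem exists_delta_bias (hf : IsSmoothDensity f) (hK : IsKernel K) (hKc : Continuous K)
    (hKs : HasCompactSupport K) {ε : ℝ} (hε : 0 < ε) :
    ∃ δ > 0, ∀ h : ℝ, 0 < h → h ≤ δ →
      ∫⁻ t, ENNReal.ofReal ((smoothed f (dilate K h) t - f t
        - h ^ 2 / 2 * (∫ u, u ^ 2 * K u) * iteratedDeriv 2 f t) ^ 2)
        ≤ ENNReal.ofReal (ε * h ^ 4) := by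
  obtain ⟨R, hR0, hR⟩ := exists_support_bound hKs
  have hK20 : 0 ≤ ∫ u, K u ^ 2 := integral_nonneg fun t => sq_nonneg _
  set A := (∫ u, K u ^ 2) * (2 * R * R ^ 4) with hA
  have hA0 : 0 ≤ A := by positivity
  obtain ⟨δ, hδ, H⟩ := exists_delta_lintegral_sq_translate_sub hf.memLp_iteratedDeriv_two
    (ε := ε / (A + 1)) (by positivity)
  have hc := hf.continuous
  have hc1 := hf.continuous_iteratedDeriv_one
  have hc2 := hf.continuous_iteratedDeriv_two
  refine ⟨δ / R, by positivity, fun h hh hhδ => ?_⟩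
  have h1 : ∀ t, smoothed f (dilate K h) t - f t
      - h ^ 2 / 2 * (∫ u, u ^ 2 * K u) * iteratedDeriv 2 f t
      = ∫ u, K u * (f (t + h * u) - f t - h * u * iteratedDeriv 1 f t
        - (h * u) ^ 2 / 2 * iteratedDeriv 2 f t) := by
    intro t
    have h2 : ∫ u, K u * ((h * u) ^ 2 / 2 * iteratedDeriv 2 f t)
        = h ^ 2 / 2 * (∫ u, u ^ 2 * K u) * iteratedDeriv 2 f t := by
      have : ∀ u, K u * ((h * u) ^ 2 / 2 * iteratedDeriv 2 f t)
          = h ^ 2 / 2 * iteratedDeriv 2 f t * (u ^ 2 * K u) := fun u => by ring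
      simp_rw [this]
      rw [integral_const_mul]
      ring
    rw [smoothed_sub_eq hf hK hKc hKs hh, ← h2, ← integral_sub
      (integrable_mul_of_hasCompactSupport hKc hKs (by fun_prop))
      (integrable_mul_of_hasCompactSupport hKc hKs (by fun_prop))]
    simp_rw [mul_sub]
  simp_rw [h1]
  refine (lintegral_sq_kernel_average_le hKc hR hK.integrable_sq (by fun_prop)
    (B := ENNReal.ofReal ((h * R) ^ 4 * (ε / (A + 1)))) fun u hu => ?_).trans ?_
  · refine (lintegral_sq_taylor_remainder_le hf.hasDerivAt hf.hasDerivAt_iteratedDeriv_one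
      hc2 (B := ENNReal.ofReal (ε / (A + 1))) fun y hy => H y (hy.trans ?_)).trans ?_
    · rw [abs_mul, abs_of_pos hh]
      exact (mul_le_mul hhδ hu (abs_nonneg u) (by positivity)).trans
        (div_mul_cancel₀ δ hR0.ne').le
    · rw [← ENNReal.ofReal_mul (by positivity)]
      refine ENNReal.ofReal_le_ofReal (mul_le_mul_of_nonneg_right ?_ (by positivity))
      rw [mul_pow, mul_pow]
      refine mul_le_mul_of_nonneg_left ?_ (by positivity)
      rw [← (by decide : Even 4).pow_abs]
      exact pow_le_pow_left₀ (abs_nonneg u) hu 4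
  · rw [← ENNReal.ofReal_mul (by positivity), ← ENNReal.ofReal_mul hK20]
    refine ENNReal.ofReal_le_ofReal ?_
    have h3 : (∫ u, K u ^ 2) * (2 * R * ((h * R) ^ 4 * (ε / (A + 1))))
        = A / (A + 1) * (ε * h ^ 4) := by
      rw [hA]
      field_simp
    rw [h3]
    exact mul_le_of_le_one_left (by positivity) ((div_le_one (by positivity)).2 (by linarith))

end Bias

/-! ### Second moments of averages and of degenerate U-statistics -/

section IID

variable {Ω E : Type*} [MeasurableSpace Ω] [MeasurableSpace E] {μ : Measure Ω}
  {P : Measure E} {X : ℕ → Ω → E}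

theorem integral_comp_eq (hXm : ∀ m, Measurable (X m)) (hlaw : ∀ m, μ.map (X m) = P) {φ : E → ℝ}
    (hφ : Measurable φ) (m : ℕ) : ∫ ω, φ (X m ω) ∂μ = ∫ x, φ x ∂P := by
  rw [← hlaw m, integral_map (hXm m).aemeasurable hφ.aestronglyMeasurable]

variable [IsProbabilityMeasure μ]

theorem isProbabilityMeasure_of_law (hXm : ∀ m, Measurable (X m)) (hlaw : ∀ m, μ.map (X m) = P) :
    IsProbabilityMeasure P := by
  rw [← hlaw 0]
  exact Measure.isProbabilityMeasure_map (hXm 0).aemeasurable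

theorem lintegral_sq_average_le (hXm : ∀ m, Measurable (X m)) (hind : iIndepFun X μ)
    (hlaw : ∀ m, μ.map (X m) = P) {φ : E → ℝ} (hφ : Measurable φ) {C : ℝ} (hC : ∀ x, |φ x| ≤ C)
    {n : ℕ} (hn : 1 ≤ n) :
    ∫⁻ ω, ENNReal.ofReal (((n : ℝ)⁻¹ * ∑ m ∈ Finset.range n, φ (X m ω)) ^ 2) ∂μ ≤
      ENNReal.ofReal ((n : ℝ)⁻¹ * (∫ x, φ x ^ 2 ∂P) + (∫ x, φ x ∂P) ^ 2) := by
  have hn0 : (n : ℝ) ≠ 0 := by positivity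
  have hmeas : ∀ m, Measurable fun ω => φ (X m ω) := fun m => hφ.comp (hXm m)
  have hL : ∀ m, MemLp (fun ω => φ (X m ω)) 2 μ := fun m =>
    MemLp.of_bound (hmeas m).aestronglyMeasurable C (Eventually.of_forall fun ω => hC _)
  set Y : Ω → ℝ := ∑ m ∈ Finset.range n, fun ω => φ (X m ω) with hY
  have hYapp : ∀ ω, Y ω = ∑ m ∈ Finset.range n, φ (X m ω) := fun ω => by
    rw [hY, Finset.sum_apply]
  have hYL : MemLp Y 2 μ := memLp_finsetSum' _ fun m _ => hL m
  have hvar : variance Y μ ≤ n * ∫ x, φ x ^ 2 ∂P := by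
    rw [hY, IndepFun.variance_sum (fun m _ => hL m) fun i _ j _ hij =>
      (hind.indepFun hij).comp hφ hφ]
    refine (Finset.sum_le_sum fun m _ => (variance_le_expectation_sq
      (hmeas m).aestronglyMeasurable).trans (integral_comp_eq hXm hlaw (hφ.pow_const 2) m).le).trans
      (le_of_eq ?_)
    simp
  have hmean : ∫ ω, Y ω ∂μ = n * ∫ x, φ x ∂P := by
    simp_rw [hYapp]
    rw [integral_finsetSum _ fun m _ => (hL m).integrable one_le_two]
    simp [integral_comp_eq hXm hlaw hφ]
  have hsq : ∫ ω, Y ω ^ 2 ∂μ = variance Y μ + (∫ ω, Y ω ∂μ) ^ 2 := by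
    rw [variance_eq_sub hYL]
    simp
  have hint : Integrable (fun ω => ((n : ℝ)⁻¹ * Y ω) ^ 2) μ := (hYL.const_mul _).integrable_sq
  simp_rw [← hYapp]
  rw [← ofReal_integral_eq_lintegral_ofReal hint (Eventually.of_forall fun ω => sq_nonneg _)]
  refine ENNReal.ofReal_le_ofReal ?_
  simp_rw [mul_pow]
  rw [integral_const_mul, hsq, hmean]
  have : ((n : ℝ)⁻¹) ^ 2 * (variance Y μ + (n * ∫ x, φ x ∂P) ^ 2)
      = ((n : ℝ)⁻¹) ^ 2 * variance Y μ + (∫ x, φ x ∂P) ^ 2 := by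
    field_simp
  rw [this]
  refine add_le_add_left ((mul_le_mul_of_nonneg_left hvar (sq_nonneg _)).trans (le_of_eq ?_)) _
  field_simp

/-- If `X m` occurs only in a factor that is centred in it, the expectation of the product
vanishes. -/
theorem integral_mul_eq_zero_of_centred (hXm : ∀ m, Measurable (X m)) (hind : iIndepFun X μ)
    (hlaw : ∀ m, μ.map (X m) = P) {ψ a : E → E → ℝ} (hψ : Measurable fun p : E × E => ψ p.1 p.2)
    (ha : Measurable fun p : E × E => a p.1 p.2) {C D : ℝ} (hC : ∀ x y, |ψ x y| ≤ C)
    (hD : ∀ x y, |a x y| ≤ D) (h0 : ∀ y, ∫ x, ψ x y ∂P = 0) {m l p q : ℕ} (hml : m ≠ l)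
    (hmp : m ≠ p) (hmq : m ≠ q) :
    ∫ ω, ψ (X m ω) (X l ω) * a (X p ω) (X q ω) ∂μ = 0 := by
  have := isProbabilityMeasure_of_law hXm hlaw
  set Z : Ω → E × E × E := fun ω => (X l ω, X p ω, X q ω) with hZ
  have hZm : Measurable Z := (hXm l).prodMk ((hXm p).prodMk (hXm q))
  have hXZ : IndepFun (X m) Z μ := by
    classical
    have hdisj : Disjoint ({m} : Finset ℕ) {l, p, q} := by simp [hml, hmp, hmq]
    have h1 := hind.indepFun_finset {m} {l, p, q} hdisj hXm
    exact h1.comp (φ := fun v : ({m} : Finset ℕ) → E => v ⟨m, by simp⟩)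
      (ψ := fun v : ({l, p, q} : Finset ℕ) → E =>
        (v ⟨l, by simp⟩, v ⟨p, by simp⟩, v ⟨q, by simp⟩)) (by fun_prop) (by fun_prop)
  have hmap : μ.map (fun ω => (X m ω, Z ω)) = P.prod (μ.map Z) := by
    rw [(indepFun_iff_map_prod_eq_prod_map_map (hXm m).aemeasurable hZm.aemeasurable).1 hXZ,
      hlaw m]
  have : IsProbabilityMeasure (μ.map Z) := Measure.isProbabilityMeasure_map hZm.aemeasurable
  set F : E × E × E × E → ℝ := fun z => ψ z.1 z.2.1 * a z.2.2.1 z.2.2.2 with hF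
  have hFm : Measurable F :=
    (hψ.comp (measurable_fst.prodMk (measurable_fst.comp measurable_snd))).mul
      (ha.comp (measurable_snd.comp measurable_snd))
  have hFint : Integrable F (P.prod (μ.map Z)) := by
    refine Integrable.of_bound hFm.aestronglyMeasurable (C * D) (Eventually.of_forall fun z => ?_)
    rw [hF, norm_mul]
    exact mul_le_mul (hC _ _) (hD _ _) (norm_nonneg _) ((abs_nonneg _).trans (hC z.1 z.1))
  have h2 : ∫ ω, F (X m ω, Z ω) ∂μ = ∫ z, F z ∂(P.prod (μ.map Z)) := by
    rw [← hmap, integral_map ((hXm m).prodMk hZm).aemeasurable hFm.aestronglyMeasurable]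
  have h3 : ∫ z, F z ∂(P.prod (μ.map Z)) = 0 := by
    rw [integral_prod_symm F hFint]
    simp [hF, integral_mul_const, h0]
  exact h2.trans h3

theorem integral_comp_pair_eq (hXm : ∀ m, Measurable (X m)) (hind : iIndepFun X μ)
    (hlaw : ∀ m, μ.map (X m) = P) {a : E → E → ℝ} (ha : Measurable fun p : E × E => a p.1 p.2)
    {D : ℝ} (hD : ∀ x y, |a x y| ≤ D) {m l : ℕ} (hml : m ≠ l) :
    ∫ ω, a (X m ω) (X l ω) ∂μ = ∫ x, ∫ y, a x y ∂P ∂P := by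
  have := isProbabilityMeasure_of_law hXm hlaw
  have hmap : μ.map (fun ω => (X m ω, X l ω)) = P.prod P := by
    rw [(indepFun_iff_map_prod_eq_prod_map_map (hXm m).aemeasurable (hXm l).aemeasurable).1
      (hind.indepFun hml), hlaw m, hlaw l]
  have h1 : ∫ ω, a (X m ω) (X l ω) ∂μ = ∫ z, a z.1 z.2 ∂(P.prod P) := by
    rw [← hmap, integral_map ((hXm m).prodMk (hXm l)).aemeasurable ha.aestronglyMeasurable]
  rw [h1, integral_prod _ (Integrable.of_bound ha.aestronglyMeasurable D
    (Eventually.of_forall fun z => hD _ _))]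

/-- Second moment of a degenerate U-statistic: two terms are uncorrelated unless they involve the
same pair of observations. -/
theorem integral_sq_degenerate_le (hXm : ∀ m, Measurable (X m)) (hind : iIndepFun X μ)
    (hlaw : ∀ m, μ.map (X m) = P) {ψ : E → E → ℝ} (hψ : Measurable fun p : E × E => ψ p.1 p.2)
    {C : ℝ} (hC : ∀ x y, |ψ x y| ≤ C) (h1 : ∀ y, ∫ x, ψ x y ∂P = 0)
    (h2 : ∀ x, ∫ y, ψ x y ∂P = 0) (n : ℕ) :
    ∫ ω, (∑ b ∈ (Finset.range n).offDiag, ψ (X b.1 ω) (X b.2 ω)) ^ 2 ∂μ ≤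
      2 * n ^ 2 * ∫ x, ∫ y, ψ x y ^ 2 ∂P ∂P := by
  set θ := ∫ x, ∫ y, ψ x y ^ 2 ∂P ∂P with hθ
  have hθ0 : 0 ≤ θ := integral_nonneg fun x => integral_nonneg fun y => sq_nonneg _
  have hm : ∀ b : ℕ × ℕ, Measurable fun ω => ψ (X b.1 ω) (X b.2 ω) := fun b =>
    hψ.comp ((hXm b.1).prodMk (hXm b.2))
  have hL : ∀ b : ℕ × ℕ, MemLp (fun ω => ψ (X b.1 ω) (X b.2 ω)) 2 μ := fun b =>
    MemLp.of_bound (hm b).aestronglyMeasurable C (Eventually.of_forall fun ω => hC _ _)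
  have hint : ∀ b c : ℕ × ℕ, Integrable
      (fun ω => ψ (X b.1 ω) (X b.2 ω) * ψ (X c.1 ω) (X c.2 ω)) μ :=
    fun b c => (hL b).integrable_mul (hL c)
  have hsq : ∀ b : ℕ × ℕ, b.1 ≠ b.2 → ∫ ω, ψ (X b.1 ω) (X b.2 ω) ^ 2 ∂μ = θ := by
    intro b hb
    refine integral_comp_pair_eq hXm hind hlaw (a := fun x y => ψ x y ^ 2) (hψ.pow_const 2)
      (D := C ^ 2) (fun x y => ?_) hb
    rw [abs_pow]
    exact pow_le_pow_left₀ (abs_nonneg _) (hC x y) 2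
  have hswap : Measurable fun p : E × E => ψ p.2 p.1 := hψ.comp measurable_swap
  have hcov : ∀ b c : ℕ × ℕ, b.1 ≠ b.2 → c.1 ≠ c.2 →
      ∫ ω, ψ (X b.1 ω) (X b.2 ω) * ψ (X c.1 ω) (X c.2 ω) ∂μ ≤
        (if c = b then θ else 0) + (if c = b.swap then θ else 0) := by
    intro b c hb hc
    by_cases hcb : c = b ∨ c = b.swap
    · calc ∫ ω, ψ (X b.1 ω) (X b.2 ω) * ψ (X c.1 ω) (X c.2 ω) ∂μ
          ≤ ∫ ω, (ψ (X b.1 ω) (X b.2 ω) ^ 2 + ψ (X c.1 ω) (X c.2 ω) ^ 2) / 2 ∂μ := by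
            refine integral_mono (hint b c)
              (((hL b).integrable_sq.add (hL c).integrable_sq).div_const 2) fun ω => ?_
            dsimp only [Pi.add_apply]
            nlinarith [sq_nonneg (ψ (X b.1 ω) (X b.2 ω) - ψ (X c.1 ω) (X c.2 ω))]
        _ = θ := by
            rw [integral_div, integral_add (hL b).integrable_sq (hL c).integrable_sq, hsq b hb,
              hsq c hc]
            ring
        _ ≤ _ := by
            rcases hcb with h | h
            · rw [if_pos h]
              split_ifs <;> linarith
            · rw [if_pos h]
              split_ifs <;> linarith
    · have hz : ∫ ω, ψ (X b.1 ω) (X b.2 ω) * ψ (X c.1 ω) (X c.2 ω) ∂μ = 0 := by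
        by_cases hb1 : b.1 ≠ c.1 ∧ b.1 ≠ c.2
        · exact integral_mul_eq_zero_of_centred hXm hind hlaw hψ hψ hC hC h1 hb hb1.1 hb1.2
        · have hb2 : b.2 ≠ c.1 ∧ b.2 ≠ c.2 := by
            simp only [Prod.ext_iff, Prod.fst_swap, Prod.snd_swap] at hcb
            omega
          exact integral_mul_eq_zero_of_centred hXm hind hlaw hswap hψ (fun x y => hC y x) hC h2
            hb.symm hb2.1 hb2.2
      rw [hz]
      refine add_nonneg ?_ ?_ <;> split_ifs <;> first | exact hθ0 | exact le_rfl
  have hexp : ∀ ω, (∑ b ∈ (Finset.range n).offDiag, ψ (X b.1 ω) (X b.2 ω)) ^ 2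
      = ∑ b ∈ (Finset.range n).offDiag, ∑ c ∈ (Finset.range n).offDiag,
        ψ (X b.1 ω) (X b.2 ω) * ψ (X c.1 ω) (X c.2 ω) := fun ω => by
    rw [sq, Finset.sum_mul_sum]
  simp_rw [hexp]
  rw [integral_finsetSum _ fun b _ => integrable_finsetSum _ fun c _ => hint b c]
  have hrow : ∀ b ∈ (Finset.range n).offDiag, ∫ ω, ∑ c ∈ (Finset.range n).offDiag,
      ψ (X b.1 ω) (X b.2 ω) * ψ (X c.1 ω) (X c.2 ω) ∂μ ≤ 2 * θ := by
    intro b hb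
    rw [integral_finsetSum _ fun c _ => hint b c]
    refine (Finset.sum_le_sum fun c hc => hcov b c (Finset.mem_offDiag.1 hb).2.2
      (Finset.mem_offDiag.1 hc).2.2).trans ?_
    rw [Finset.sum_add_distrib, Finset.sum_ite_eq', Finset.sum_ite_eq']
    split_ifs <;> linarith
  refine (Finset.sum_le_sum hrow).trans ?_
  rw [Finset.sum_const, nsmul_eq_mul, Finset.offDiag_card, Finset.card_range]
  have h3 : ((n * n - n : ℕ) : ℝ) ≤ n ^ 2 := by
    rw [sq]
    exact_mod_cast Nat.sub_le _ _
  nlinarith [mul_le_mul_of_nonneg_right h3 (by positivity : 0 ≤ 2 * θ)]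

end IID

/-! ### The noise of the kernel estimator -/

/-- The law with density `f`. -/
def densityLaw (f : ℝ → ℝ) : Measure ℝ := volume.withDensity fun x => ENNReal.ofReal (f x)

theorem integral_densityLaw {f : ℝ → ℝ} (hf : IsSmoothDensity f) (φ : ℝ → ℝ) :
    ∫ x, φ x ∂densityLaw f = ∫ x, φ x * f x := by
  rw [densityLaw, integral_withDensity_eq_integral_toReal_smul
    hf.continuous.measurable.ennreal_ofReal (Eventually.of_forall fun x => ENNReal.ofReal_lt_top)]
  refine integral_congr_ae (Eventually.of_forall fun x => ?_)
  simp only [ENNReal.toReal_ofReal (hf.nonneg x), smul_eq_mul, mul_comm]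

theorem isProbabilityMeasure_densityLaw {f : ℝ → ℝ} (hf : IsSmoothDensity f) :
    IsProbabilityMeasure (densityLaw f) := by
  constructor
  rw [densityLaw, withDensity_apply _ MeasurableSet.univ, Measure.restrict_univ,
    ← ofReal_integral_eq_lintegral_ofReal hf.integrable (Eventually.of_forall hf.nonneg),
    hf.integral_eq_one, ENNReal.ofReal_one]

/-- A continuous probability density with compact support. -/
structure IsContinuousKernel (G : ℝ → ℝ) : Prop where
  continuous : Continuous G
  hasCompactSupport : HasCompactSupport G
  nonneg : ∀ u, 0 ≤ G u
  integral_eq_one : ∫ u, G u = 1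

theorem isContinuousKernel_dilate {K : ℝ → ℝ} (hK : IsKernel K) (hKc : Continuous K)
    (hKs : HasCompactSupport K) {h : ℝ} (hh : 0 < h) : IsContinuousKernel (dilate K h) where
  continuous := continuous_dilate hKc h
  hasCompactSupport := hasCompactSupport_dilate hKs hh
  nonneg u := mul_nonneg (inv_pos.2 hh).le (hK.nonneg _)
  integral_eq_one := by rw [integral_dilate hh, hK.integral_eq_one]

namespace IsContinuousKernel

variable {f G H : ℝ → ℝ}

theorem integrable (hG : IsContinuousKernel G) : Integrable G :=
  hG.continuous.integrable_of_hasCompactSupport hG.hasCompactSupport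

theorem hasCompactSupport_sub (hG : IsContinuousKernel G) (x : ℝ) :
    HasCompactSupport fun t => G (x - t) :=
  hG.hasCompactSupport.comp_isClosedEmbedding (Homeomorph.subLeft x).isClosedEmbedding

theorem integrable_sub (hG : IsContinuousKernel G) (x : ℝ) : Integrable fun t => G (x - t) :=
  hG.integrable.comp_sub_left x

theorem integral_sub (hG : IsContinuousKernel G) (x : ℝ) : ∫ t, G (x - t) = 1 := by
  rw [integral_sub_left_eq_self G volume x, hG.integral_eq_one]

theorem memLp_sub (hG : IsContinuousKernel G) (x : ℝ) : MemLp (fun t => G (x - t)) 2 := by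
  have hc := hG.continuous
  exact (by fun_prop : Continuous fun t => G (x - t)).memLp_of_hasCompactSupport
    (hG.hasCompactSupport_sub x)

theorem smoothed_nonneg (hf : IsSmoothDensity f) (hG : IsContinuousKernel G) (t : ℝ) :
    0 ≤ smoothed f G t :=
  integral_nonneg fun x => mul_nonneg (hG.nonneg _) (hf.nonneg x)

theorem smoothed_le (hf : IsSmoothDensity f) (hG : IsContinuousKernel G) {D : ℝ}
    (hD : ∀ x, f x ≤ D) (t : ℝ) : smoothed f G t ≤ D := by
  have h1 : Integrable fun x => G (x - t) := hG.integrable.comp_sub_right t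
  have hc := hG.continuous
  calc smoothed f G t ≤ ∫ x, G (x - t) * D := by
        refine integral_mono_of_nonneg
          (Eventually.of_forall fun x => mul_nonneg (hG.nonneg _) (hf.nonneg x))
          (h1.mul_const D) (Eventually.of_forall fun x => ?_)
        exact mul_le_mul_of_nonneg_left (hD x) (hG.nonneg _)
    _ = D := by
        rw [integral_mul_const, integral_sub_right_eq_self G t, hG.integral_eq_one, one_mul]

theorem measurable_smoothed (hf : IsSmoothDensity f) (hG : IsContinuousKernel G) :
    Measurable (smoothed f G) := by
  have hc := hG.continuous
  have hcf := hf.continuous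
  have : StronglyMeasurable (Function.uncurry fun t x => G (x - t) * f x) :=
    (by unfold Function.uncurry; fun_prop : Continuous _).stronglyMeasurable
  exact (this.integral_prod_right (ν := volume)).measurable

/-- The family `(x, t) ↦ G(x - t)` is integrable under the law of the data times Lebesgue
measure. -/
theorem integrable_prod (hf : IsSmoothDensity f) (hG : IsContinuousKernel G) :
    Integrable (fun p : ℝ × ℝ => G (p.1 - p.2)) ((densityLaw f).prod volume) := by
  have := isProbabilityMeasure_densityLaw hf
  have hc := hG.continuous
  rw [integrable_prod_iff (by fun_prop : Continuous fun p : ℝ × ℝ =>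
    G (p.1 - p.2)).aestronglyMeasurable]
  refine ⟨Eventually.of_forall fun x => hG.integrable_sub x, ?_⟩
  simp_rw [Real.norm_of_nonneg (hG.nonneg _), hG.integral_sub]
  exact integrable_const 1

theorem smoothed_eq_integral_densityLaw (hf : IsSmoothDensity f) (t : ℝ) :
    smoothed f G t = ∫ x, G (x - t) ∂densityLaw f := (integral_densityLaw hf _).symm

theorem integrable_smoothed (hf : IsSmoothDensity f) (hG : IsContinuousKernel G) :
    Integrable (smoothed f G) := by
  have := isProbabilityMeasure_densityLaw hf
  have h := (hG.integrable_prod hf).integral_prod_right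
  simpa only [← smoothed_eq_integral_densityLaw hf] using h

theorem integral_smoothed (hf : IsSmoothDensity f) (hG : IsContinuousKernel G) :
    ∫ t, smoothed f G t = 1 := by
  have := isProbabilityMeasure_densityLaw hf
  have h := integral_integral_swap (f := fun x t => G (x - t)) (hG.integrable_prod hf)
  simp_rw [smoothed_eq_integral_densityLaw hf, ← h, hG.integral_sub]
  simp

theorem memLp_smoothed (hf : IsSmoothDensity f) (hG : IsContinuousKernel G) :
    MemLp (smoothed f G) 2 := by
  obtain ⟨D, -, hD⟩ := hf.exists_bound
  rw [memLp_two_iff_integrable_sq (hG.measurable_smoothed hf).aestronglyMeasurable]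
  simp_rw [sq]
  refine (hG.integrable_smoothed hf).mul_bdd (c := D)
    (hG.measurable_smoothed hf).aestronglyMeasurable (Eventually.of_forall fun t => ?_)
  rw [Real.norm_of_nonneg (hG.smoothed_nonneg hf t)]
  exact hG.smoothed_le hf hD t

/-- The centred kernel at a random point is orthogonal in mean to every bounded function. -/
theorem integral_centred_mul_eq_zero (hf : IsSmoothDensity f) (hG : IsContinuousKernel G)
    {b : ℝ → ℝ} (hb : Measurable b) {C : ℝ} (hC : ∀ t, |b t| ≤ C) :
    ∫ x, (∫ t, (G (x - t) - smoothed f G t) * b t) ∂densityLaw f = 0 := by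
  have := isProbabilityMeasure_densityLaw hf
  have h1 : Integrable (fun p : ℝ × ℝ => smoothed f G p.2) ((densityLaw f).prod volume) :=
    (hG.integrable_smoothed hf).comp_snd _
  have h2 : Integrable (fun p : ℝ × ℝ => (G (p.1 - p.2) - smoothed f G p.2) * b p.2)
      ((densityLaw f).prod volume) :=
    ((hG.integrable_prod hf).sub h1).mul_bdd (c := C)
      (hb.comp measurable_snd).aestronglyMeasurable (Eventually.of_forall fun p => hC _)
  have hc := hG.continuous
  rw [integral_integral_swap (f := fun x t => (G (x - t) - smoothed f G t) * b t) h2]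
  refine integral_eq_zero_of_ae (Eventually.of_forall fun t => ?_)
  obtain ⟨B, hB⟩ := hG.continuous.bounded_above_of_compact_support hG.hasCompactSupport
  have h3 : Integrable (fun x => G (x - t)) (densityLaw f) :=
    Integrable.of_bound (by fun_prop : Continuous fun x => G (x - t)).aestronglyMeasurable B
      (Eventually.of_forall fun x => hB _)
  simp only [Pi.zero_apply]
  rw [integral_mul_const, MeasureTheory.integral_sub h3 (integrable_const _),
    ← smoothed_eq_integral_densityLaw hf]
  simp

end IsContinuousKernel

/-- The centred average `n⁻¹ ∑ (G(x_m - t) - E G(X - t))`. -/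
def noise (f G : ℝ → ℝ) (n : ℕ) (x : ℕ → ℝ) (t : ℝ) : ℝ :=
  (n : ℝ)⁻¹ * ∑ m ∈ Finset.range n, (G (x m - t) - smoothed f G t)

/-- The estimation error is the sum of noise and bias. -/
theorem kde_sub_eq {f K : ℝ → ℝ} {n : ℕ} (hn : 1 ≤ n) (x : ℕ → ℝ) (h t : ℝ) :
    kde K n x h t - f t = noise f (dilate K h) n x t + (smoothed f (dilate K h) t - f t) := by
  have hn0 : (n : ℝ) ≠ 0 := by positivity
  simp only [kde, noise, dilate, Finset.sum_sub_distrib, Finset.sum_const, Finset.card_range,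
    nsmul_eq_mul, ← Finset.mul_sum, mul_inv]
  field_simp
  ring

section Noise

variable {f G H : ℝ → ℝ}

theorem memLp_centred (hf : IsSmoothDensity f) (hG : IsContinuousKernel G) (x : ℝ) :
    MemLp (fun t => G (x - t) - smoothed f G t) 2 :=
  (hG.memLp_sub x).sub (hG.memLp_smoothed hf)

theorem memLp_noise (hf : IsSmoothDensity f) (hG : IsContinuousKernel G) (n : ℕ) (x : ℕ → ℝ) :
    MemLp (noise f G n x) 2 :=
  (memLp_finsetSum _ fun m _ => memLp_centred hf hG (x m)).const_mul _

/-- The kernel of the U-statistic in the inner product of two noise terms. -/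
def noiseKernel (f G H : ℝ → ℝ) (x y : ℝ) : ℝ :=
  ∫ t, (G (x - t) - smoothed f G t) * (H (y - t) - smoothed f H t)

theorem measurable_noiseKernel (hf : IsSmoothDensity f) (hG : IsContinuousKernel G)
    (hH : IsContinuousKernel H) :
    Measurable fun p : ℝ × ℝ => noiseKernel f G H p.1 p.2 := by
  have hcG := hG.continuous.measurable
  have hcH := hH.continuous.measurable
  have hsG := hG.measurable_smoothed hf
  have hsH := hH.measurable_smoothed hf
  have : StronglyMeasurable (Function.uncurry fun (p : ℝ × ℝ) t =>
      (G (p.1 - t) - smoothed f G t) * (H (p.2 - t) - smoothed f H t)) := by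
    refine Measurable.stronglyMeasurable ?_
    unfold Function.uncurry
    fun_prop
  exact (this.integral_prod_right (ν := volume)).measurable

theorem noiseKernel_eq (hf : IsSmoothDensity f) (hG : IsContinuousKernel G)
    (hH : IsContinuousKernel H) (x y : ℝ) :
    noiseKernel f G H x y = (∫ t, G (x - t) * H (y - t)) - (∫ t, G (x - t) * smoothed f H t)
      - (∫ t, smoothed f G t * H (y - t)) + ∫ t, smoothed f G t * smoothed f H t := by
  have i1 : Integrable fun t => G (x - t) * H (y - t) :=
    (hG.memLp_sub x).integrable_mul (hH.memLp_sub y)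
  have i2 : Integrable fun t => G (x - t) * smoothed f H t :=
    (hG.memLp_sub x).integrable_mul (hH.memLp_smoothed hf)
  have i3 : Integrable fun t => smoothed f G t * H (y - t) :=
    (hG.memLp_smoothed hf).integrable_mul (hH.memLp_sub y)
  have i4 : Integrable fun t => smoothed f G t * smoothed f H t :=
    (hG.memLp_smoothed hf).integrable_mul (hH.memLp_smoothed hf)
  have i12 : Integrable fun t => G (x - t) * H (y - t) - G (x - t) * smoothed f H t := i1.sub i2
  have i123 : Integrable fun t => G (x - t) * H (y - t) - G (x - t) * smoothed f H t
      - smoothed f G t * H (y - t) := i12.sub i3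
  rw [← integral_sub i1 i2, ← integral_sub i12 i3, ← integral_add i123 i4]
  exact integral_congr_ae (Eventually.of_forall fun t => by ring)

/-- An average of values in `[0, D]` over a probability density `p` lies in `[0, D]`. -/
theorem integral_mul_mem_Icc {p b : ℝ → ℝ} (hp : Integrable p) (hp0 : ∀ t, 0 ≤ p t)
    (hp1 : ∫ t, p t = 1) (hb0 : ∀ t, 0 ≤ b t) {D : ℝ} (hD : ∀ t, b t ≤ D) :
    ∫ t, p t * b t ∈ Set.Icc 0 D := by
  refine ⟨integral_nonneg fun t => mul_nonneg (hp0 t) (hb0 t), ?_⟩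
  calc ∫ t, p t * b t ≤ ∫ t, p t * D :=
        integral_mono_of_nonneg (Eventually.of_forall fun t => mul_nonneg (hp0 t) (hb0 t))
          (hp.mul_const D) (Eventually.of_forall fun t =>
            mul_le_mul_of_nonneg_left (hD t) (hp0 t))
    _ = D := by rw [integral_mul_const, hp1, one_mul]

theorem abs_noiseKernel_sub_le (hf : IsSmoothDensity f) (hG : IsContinuousKernel G)
    (hH : IsContinuousKernel H) {D : ℝ} (hD : ∀ x, f x ≤ D) (x y : ℝ) :
    |noiseKernel f G H x y - ∫ t, G (x - t) * H (y - t)| ≤ 2 * D := by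
  have h1 := integral_mul_mem_Icc (hG.integrable_sub x) (fun _ => hG.nonneg _) (hG.integral_sub x)
    (hH.smoothed_nonneg hf) (hH.smoothed_le hf hD)
  have h2 := integral_mul_mem_Icc (hH.integrable_sub y) (fun _ => hH.nonneg _) (hH.integral_sub y)
    (hG.smoothed_nonneg hf) (hG.smoothed_le hf hD)
  have h3 := integral_mul_mem_Icc (hG.integrable_smoothed hf) (hG.smoothed_nonneg hf)
    (hG.integral_smoothed hf) (hH.smoothed_nonneg hf) (hH.smoothed_le hf hD)
  simp_rw [mul_comm (H _)] at h2
  rw [noiseKernel_eq hf hG hH, abs_le]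
  constructor <;> linarith [h1.1, h1.2, h2.1, h2.2, h3.1, h3.2]

theorem integral_kernel_mul_mem_Icc (hG : IsContinuousKernel G) (hH : IsContinuousKernel H)
    {B : ℝ} (hB : ∀ u, H u ≤ B) (x y : ℝ) : ∫ t, G (x - t) * H (y - t) ∈ Set.Icc 0 B :=
  integral_mul_mem_Icc (hG.integrable_sub x) (fun _ => hG.nonneg _) (hG.integral_sub x)
    (fun _ => hH.nonneg _) fun _ => hB _

theorem integral_kernel_mul_densityLaw_le (hf : IsSmoothDensity f) (hG : IsContinuousKernel G)
    (hH : IsContinuousKernel H) {D : ℝ} (hD : ∀ x, f x ≤ D) (x : ℝ) :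
    ∫ y, (∫ t, G (x - t) * H (y - t)) ∂densityLaw f ≤ D := by
  have := isProbabilityMeasure_densityLaw hf
  have hc := hG.continuous
  obtain ⟨C, hC⟩ := hG.continuous.bounded_above_of_compact_support hG.hasCompactSupport
  have h1 : Integrable (fun p : ℝ × ℝ => G (x - p.2) * H (p.1 - p.2))
      ((densityLaw f).prod volume) :=
    (hH.integrable_prod hf).bdd_mul (c := C)
      (by fun_prop : Continuous fun p : ℝ × ℝ => G (x - p.2)).aestronglyMeasurable
      (Eventually.of_forall fun p => hC _)
  rw [integral_integral_swap (f := fun y t => G (x - t) * H (y - t)) h1]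
  simp_rw [integral_const_mul, ← IsContinuousKernel.smoothed_eq_integral_densityLaw hf]
  exact (integral_mul_mem_Icc (hG.integrable_sub x) (fun _ => hG.nonneg _) (hG.integral_sub x)
    (hH.smoothed_nonneg hf) (hH.smoothed_le hf hD)).2

/-- With `B` of order `h⁻¹`, this is a bound of order `h⁻¹`. The trivial bound `B²` would be of
order `h⁻²`, which is too large: one factor has to be averaged against the bounded density `f`. -/
theorem integral_sq_noiseKernel_le (hf : IsSmoothDensity f) (hG : IsContinuousKernel G)
    (hH : IsContinuousKernel H) {D B : ℝ} (hD : ∀ x, f x ≤ D) (hB : ∀ u, H u ≤ B) :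
    ∫ x, (∫ y, noiseKernel f G H x y ^ 2 ∂densityLaw f) ∂densityLaw f
      ≤ 2 * B * D + 8 * D ^ 2 := by
  have := isProbabilityMeasure_densityLaw hf
  have hcG := hG.continuous.measurable
  have hcH := hH.continuous.measurable
  have hQm : ∀ x, Measurable fun y => ∫ t, G (x - t) * H (y - t) := by
    intro x
    have h1 : StronglyMeasurable (Function.uncurry fun y t => G (x - t) * H (y - t)) := by
      refine Measurable.stronglyMeasurable ?_
      unfold Function.uncurry
      fun_prop
    exact (h1.integral_prod_right (ν := volume)).measurable
  have hQi : ∀ x, Integrable (fun y => ∫ t, G (x - t) * H (y - t)) (densityLaw f) := fun x =>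
    Integrable.of_bound (hQm x).aestronglyMeasurable B (Eventually.of_forall fun y => by
      have h1 := integral_kernel_mul_mem_Icc hG hH hB x y
      rw [Real.norm_of_nonneg h1.1]
      exact h1.2)
  have hB0 : 0 ≤ B := (hH.nonneg 0).trans (hB 0)
  have hrow : ∀ x, ∫ y, noiseKernel f G H x y ^ 2 ∂densityLaw f ≤ 2 * B * D + 8 * D ^ 2 := by
    intro x
    calc ∫ y, noiseKernel f G H x y ^ 2 ∂densityLaw f
        ≤ ∫ y, (2 * B * (∫ t, G (x - t) * H (y - t)) + 8 * D ^ 2) ∂densityLaw f := by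
          refine integral_mono_of_nonneg (Eventually.of_forall fun y => sq_nonneg _)
            (((hQi x).const_mul _).add (integrable_const _)) (Eventually.of_forall fun y => ?_)
          have h1 := integral_kernel_mul_mem_Icc hG hH hB x y
          have h2 := abs_le.1 (abs_noiseKernel_sub_le hf hG hH hD x y)
          dsimp only
          set Q := ∫ t, G (x - t) * H (y - t)
          have h3 : (noiseKernel f G H x y - Q) ^ 2 ≤ (2 * D) ^ 2 :=
            sq_le_sq' (by linarith [h2.1]) h2.2
          nlinarith [sq_nonneg (noiseKernel f G H x y - 2 * Q), mul_nonneg h1.1 (sub_nonneg.2 h1.2)]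
      _ = 2 * B * (∫ y, (∫ t, G (x - t) * H (y - t)) ∂densityLaw f) + 8 * D ^ 2 := by
          rw [integral_add ((hQi x).const_mul _) (integrable_const _), integral_const_mul]
          simp
      _ ≤ _ := by
          have h1 := integral_kernel_mul_densityLaw_le hf hG hH hD x
          nlinarith [mul_le_mul_of_nonneg_left h1 hB0]
  calc _ ≤ ∫ _, (2 * B * D + 8 * D ^ 2) ∂densityLaw f :=
        integral_mono_of_nonneg (Eventually.of_forall fun x => integral_nonneg fun y => sq_nonneg _)
          (integrable_const _) (Eventually.of_forall hrow)
    _ = _ := by simp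

theorem integral_noise_mul_noise (hf : IsSmoothDensity f) (hG : IsContinuousKernel G)
    (hH : IsContinuousKernel H) (n : ℕ) (x : ℕ → ℝ) :
    ∫ t, noise f G n x t * noise f H n x t = ((n : ℝ)⁻¹) ^ 2 *
      (∑ m ∈ Finset.range n, noiseKernel f G H (x m) (x m)
        + ∑ b ∈ (Finset.range n).offDiag, noiseKernel f G H (x b.1) (x b.2)) := by
  have hint : ∀ b : ℕ × ℕ, Integrable fun t =>
      (G (x b.1 - t) - smoothed f G t) * (H (x b.2 - t) - smoothed f H t) := fun b =>
    (memLp_centred hf hG (x b.1)).integrable_mul (memLp_centred hf hH (x b.2))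
  have h1 : ∀ t, noise f G n x t * noise f H n x t = ((n : ℝ)⁻¹) ^ 2 *
      ∑ b ∈ Finset.range n ×ˢ Finset.range n,
        (G (x b.1 - t) - smoothed f G t) * (H (x b.2 - t) - smoothed f H t) := by
    intro t
    rw [noise, noise, mul_mul_mul_comm, Finset.sum_mul_sum, ← Finset.sum_product', sq]
  simp_rw [h1]
  rw [integral_const_mul, integral_finsetSum _ fun b _ => hint b, ← Finset.diag_union_offDiag,
    Finset.sum_union (Finset.disjoint_diag_offDiag _), Finset.sum_diag]
  rfl

end Noise

section NoiseMoments

variable {Ω : Type*} [MeasurableSpace Ω] {μ : Measure Ω} {f G H : ℝ → ℝ} {X : ℕ → Ω → ℝ}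

theorem measurable_noiseKernel_sample (hf : IsSmoothDensity f) (hG : IsContinuousKernel G)
    (hH : IsContinuousKernel H) (hX : IsIIDSample μ X f) (m l : ℕ) :
    Measurable fun ω => noiseKernel f G H (X m ω) (X l ω) :=
  (measurable_noiseKernel hf hG hH).comp ((hX.measurable m).prodMk (hX.measurable l))

theorem aemeasurable_integral_noise_mul_noise (hf : IsSmoothDensity f)
    (hG : IsContinuousKernel G) (hH : IsContinuousKernel H) (hX : IsIIDSample μ X f) (n : ℕ) :
    AEMeasurable (fun ω =>
      ∫ t, noise f G n (fun m => X m ω) t * noise f H n (fun m => X m ω) t) μ := by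
  simp_rw [integral_noise_mul_noise hf hG hH]
  have hm := measurable_noiseKernel_sample hf hG hH hX
  fun_prop

theorem integral_noise_mul_eq (hf : IsSmoothDensity f) (hG : IsContinuousKernel G) {b : ℝ → ℝ}
    (hb : Measurable b) {C : ℝ} (hC : ∀ t, |b t| ≤ C) (n : ℕ) (x : ℕ → ℝ) :
    ∫ t, noise f G n x t * b t
      = (n : ℝ)⁻¹ * ∑ m ∈ Finset.range n, ∫ t, (G (x m - t) - smoothed f G t) * b t := by
  have hint : ∀ m, Integrable fun t => (G (x m - t) - smoothed f G t) * b t := fun m =>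
    ((hG.integrable_sub (x m)).sub (hG.integrable_smoothed hf)).mul_bdd (c := C)
      hb.aestronglyMeasurable (Eventually.of_forall hC)
  simp_rw [noise, mul_assoc, Finset.sum_mul]
  rw [integral_const_mul, integral_finsetSum _ fun m _ => hint m]

theorem measurable_integral_centred_mul (hf : IsSmoothDensity f) (hG : IsContinuousKernel G)
    {b : ℝ → ℝ} (hb : Measurable b) :
    Measurable fun x => ∫ t, (G (x - t) - smoothed f G t) * b t := by
  have hcG := hG.continuous.measurable
  have hsG := hG.measurable_smoothed hf
  have : StronglyMeasurable (Function.uncurry fun (x : ℝ) t =>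
      (G (x - t) - smoothed f G t) * b t) := by
    refine Measurable.stronglyMeasurable ?_
    unfold Function.uncurry
    fun_prop
  exact (this.integral_prod_right (ν := volume)).measurable

theorem aemeasurable_integral_noise_mul (hf : IsSmoothDensity f) (hG : IsContinuousKernel G)
    (hX : IsIIDSample μ X f) {b : ℝ → ℝ} (hb : Measurable b) {C : ℝ} (hC : ∀ t, |b t| ≤ C)
    (n : ℕ) :
    AEMeasurable (fun ω => ∫ t, noise f G n (fun m => X m ω) t * b t) μ := by
  simp_rw [integral_noise_mul_eq hf hG hb hC]
  have h1 := measurable_integral_centred_mul hf hG hb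
  have h2 := hX.measurable
  exact (Finset.measurable_sum _ fun m _ => h1.comp (h2 m)).const_mul _ |>.aemeasurable

variable [IsProbabilityMeasure μ]

/-- The inner product of two noise terms concentrates around `n⁻¹ ∫ G H`, the contribution of the
diagonal of the double sum; the rest is a degenerate U-statistic. -/
theorem lintegral_sq_noise_mul_noise_le (hf : IsSmoothDensity f) (hG : IsContinuousKernel G)
    (hH : IsContinuousKernel H) (hX : IsIIDSample μ X f) {D B : ℝ} (hD : ∀ x, f x ≤ D)
    (hB : ∀ u, H u ≤ B) {n : ℕ} (hn : 1 ≤ n) :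
    ∫⁻ ω, ENNReal.ofReal (((∫ t, noise f G n (fun m => X m ω) t * noise f H n (fun m => X m ω) t)
        - (n : ℝ)⁻¹ * ∫ u, G u * H u) ^ 2) ∂μ
      ≤ ENNReal.ofReal ((8 * B * D + 40 * D ^ 2) * ((n : ℝ)⁻¹) ^ 2) := by
  have := isProbabilityMeasure_densityLaw hf
  have hn0 : (n : ℝ) ≠ 0 := by positivity
  have hB0 : 0 ≤ B := (hH.nonneg 0).trans (hB 0)
  have hD0 : 0 ≤ D := (hf.nonneg 0).trans (hD 0)
  have hψb : ∀ x y, |noiseKernel f G H x y| ≤ 2 * D + B := by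
    intro x y
    have h1 := integral_kernel_mul_mem_Icc hG hH hB x y
    have h2 := abs_le.1 (abs_noiseKernel_sub_le hf hG hH hD x y)
    rw [abs_le]
    constructor <;> linarith [h1.1, h1.2, h2.1, h2.2]
  have hbdd : ∀ {M : ℝ → ℝ}, IsContinuousKernel M →
      ∃ C, ∀ y t, |M (y - t) - smoothed f M t| ≤ C := by
    intro M hM
    obtain ⟨C, hC⟩ := hM.continuous.bounded_above_of_compact_support hM.hasCompactSupport
    refine ⟨C + D, fun y t => (abs_sub _ _).trans (add_le_add (hC _) ?_)⟩
    rw [abs_of_nonneg (hM.smoothed_nonneg hf t)]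
    exact hM.smoothed_le hf hD t
  have hdeg1 : ∀ y, ∫ x, noiseKernel f G H x y ∂densityLaw f = 0 := by
    intro y
    obtain ⟨C, hC⟩ := hbdd hH
    have hm := hH.measurable_smoothed hf
    have hcm := hH.continuous.measurable
    exact hG.integral_centred_mul_eq_zero hf (b := fun t => H (y - t) - smoothed f H t)
      (by fun_prop) (hC y)
  have hdeg2 : ∀ x, ∫ y, noiseKernel f G H x y ∂densityLaw f = 0 := by
    intro x
    obtain ⟨C, hC⟩ := hbdd hG
    have hm := hG.measurable_smoothed hf
    have hcm := hG.continuous.measurable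
    have h := hH.integral_centred_mul_eq_zero hf (b := fun t => G (x - t) - smoothed f G t)
      (by fun_prop) (hC x)
    simpa only [noiseKernel, mul_comm] using h
  have hU := integral_sq_degenerate_le hX.measurable hX.indep hX.law
    (measurable_noiseKernel hf hG hH) hψb hdeg1 hdeg2 n
  set U : Ω → ℝ := fun ω => ∑ b ∈ (Finset.range n).offDiag, noiseKernel f G H (X b.1 ω) (X b.2 ω)
    with hUdef
  have hUL : MemLp U 2 μ := memLp_finsetSum _ fun b _ => MemLp.of_bound
    (measurable_noiseKernel_sample hf hG hH hX b.1 b.2).aestronglyMeasurable _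
    (Eventually.of_forall fun ω => hψb _ _)
  have hθ := integral_sq_noiseKernel_le hf hG hH hD hB
  -- On the diagonal `∫ G(x - t) H(x - t) dt` does not depend on the observation `x`.
  have hdiag : ∀ ω, |((n : ℝ)⁻¹) ^ 2 * ∑ m ∈ Finset.range n, noiseKernel f G H (X m ω) (X m ω)
      - (n : ℝ)⁻¹ * ∫ u, G u * H u| ≤ (n : ℝ)⁻¹ * (2 * D) := by
    intro ω
    have hGH : ∀ x, ∫ t, G (x - t) * H (x - t) = ∫ u, G u * H u := fun x =>
      integral_sub_left_eq_self (fun u => G u * H u) volume x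
    have h1 : ((n : ℝ)⁻¹) ^ 2 * ∑ m ∈ Finset.range n, noiseKernel f G H (X m ω) (X m ω)
        - (n : ℝ)⁻¹ * ∫ u, G u * H u = ((n : ℝ)⁻¹) ^ 2 * ∑ m ∈ Finset.range n,
          (noiseKernel f G H (X m ω) (X m ω) - ∫ u, G u * H u) := by
      rw [Finset.sum_sub_distrib, Finset.sum_const, Finset.card_range, nsmul_eq_mul]
      field_simp
    rw [h1, abs_mul, abs_of_nonneg (sq_nonneg _)]
    have h2 : |∑ m ∈ Finset.range n, (noiseKernel f G H (X m ω) (X m ω) - ∫ u, G u * H u)|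
        ≤ n * (2 * D) := by
      refine (Finset.abs_sum_le_sum_abs _ _).trans ((Finset.sum_le_sum fun m _ => ?_).trans
        (le_of_eq (by rw [Finset.sum_const, Finset.card_range, nsmul_eq_mul])))
      have := abs_noiseKernel_sub_le hf hG hH hD (X m ω) (X m ω)
      rwa [hGH] at this
    refine (mul_le_mul_of_nonneg_left h2 (sq_nonneg _)).trans (le_of_eq ?_)
    field_simp
  have hpt : ∀ ω, ((∫ t, noise f G n (fun m => X m ω) t * noise f H n (fun m => X m ω) t)
      - (n : ℝ)⁻¹ * ∫ u, G u * H u) ^ 2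
      ≤ 2 * (((n : ℝ)⁻¹) ^ 4 * U ω ^ 2) + 2 * ((n : ℝ)⁻¹ * (2 * D)) ^ 2 := by
    intro ω
    rw [integral_noise_mul_noise hf hG hH]
    have h1 := hdiag ω
    set d := ((n : ℝ)⁻¹) ^ 2 * ∑ m ∈ Finset.range n, noiseKernel f G H (X m ω) (X m ω)
      - (n : ℝ)⁻¹ * ∫ u, G u * H u
    have h2 : d ^ 2 ≤ ((n : ℝ)⁻¹ * (2 * D)) ^ 2 := by
      rw [← sq_abs d]
      exact pow_le_pow_left₀ (abs_nonneg _) h1 2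
    have h3 : ((n : ℝ)⁻¹) ^ 2 * (∑ m ∈ Finset.range n, noiseKernel f G H (X m ω) (X m ω) + U ω)
        - (n : ℝ)⁻¹ * (∫ u, G u * H u) = ((n : ℝ)⁻¹) ^ 2 * U ω + d := by
      ring
    rw [h3]
    nlinarith [sq_nonneg (((n : ℝ)⁻¹) ^ 2 * U ω - d)]
  refine (lintegral_mono fun ω => ENNReal.ofReal_le_ofReal (hpt ω)).trans ?_
  have hint : Integrable (fun ω => 2 * (((n : ℝ)⁻¹) ^ 4 * U ω ^ 2)
      + 2 * ((n : ℝ)⁻¹ * (2 * D)) ^ 2) μ :=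
    ((hUL.integrable_sq.const_mul _).const_mul _).add (integrable_const _)
  rw [← ofReal_integral_eq_lintegral_ofReal hint (Eventually.of_forall fun ω => by positivity)]
  refine ENNReal.ofReal_le_ofReal ?_
  rw [integral_add ((hUL.integrable_sq.const_mul _).const_mul _) (integrable_const _),
    integral_const_mul, integral_const_mul]
  simp only [integral_const, probReal_univ, one_smul]
  have h4 : ∫ ω, U ω ^ 2 ∂μ ≤ 2 * n ^ 2 * (2 * B * D + 8 * D ^ 2) :=
    hU.trans (mul_le_mul_of_nonneg_left hθ (by positivity))
  have h5 := mul_le_mul_of_nonneg_left h4 (by positivity : 0 ≤ 2 * ((n : ℝ)⁻¹) ^ 4)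
  have h6 : 2 * ((n : ℝ)⁻¹) ^ 4 * (2 * n ^ 2 * (2 * B * D + 8 * D ^ 2))
      = 4 * (2 * B * D + 8 * D ^ 2) * ((n : ℝ)⁻¹) ^ 2 := by
    field_simp
    ring
  nlinarith

/-- The inner product of the noise with a fixed bounded function is an average of centred terms. -/
theorem lintegral_sq_noise_mul_le (hf : IsSmoothDensity f) (hG : IsContinuousKernel G)
    (hX : IsIIDSample μ X f) {b : ℝ → ℝ} (hb : Measurable b) {C : ℝ} (hC : ∀ t, |b t| ≤ C)
    {n : ℕ} (hn : 1 ≤ n) :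
    ∫⁻ ω, ENNReal.ofReal ((∫ t, noise f G n (fun m => X m ω) t * b t) ^ 2) ∂μ
      ≤ ENNReal.ofReal (4 * C ^ 2 * (n : ℝ)⁻¹) := by
  have := isProbabilityMeasure_densityLaw hf
  have hbound : ∀ x, |∫ t, (G (x - t) - smoothed f G t) * b t| ≤ 2 * C := by
    intro x
    have hi := ((hG.integrable_sub x).add (hG.integrable_smoothed hf)).mul_const C
    rw [← Real.norm_eq_abs]
    refine (norm_integral_le_of_norm_le hi (Eventually.of_forall fun t => ?_)).trans (le_of_eq ?_)
    · rw [norm_mul]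
      refine mul_le_mul ?_ (hC t) (norm_nonneg _) (add_nonneg (hG.nonneg _)
        (hG.smoothed_nonneg hf t))
      refine (abs_sub _ _).trans (le_of_eq ?_)
      rw [abs_of_nonneg (hG.nonneg _), abs_of_nonneg (hG.smoothed_nonneg hf t)]
      rfl
    · rw [integral_mul_const]
      simp only [Pi.add_apply]
      rw [integral_add (hG.integrable_sub x) (hG.integrable_smoothed hf), hG.integral_sub,
        hG.integral_smoothed hf]
      ring
  simp_rw [integral_noise_mul_eq hf hG hb hC]
  have hlaw : ∀ m, μ.map (X m) = densityLaw f := hX.law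
  refine (lintegral_sq_average_le hX.measurable hX.indep hlaw
    (measurable_integral_centred_mul hf hG hb) hbound hn).trans (ENNReal.ofReal_le_ofReal ?_)
  rw [hG.integral_centred_mul_eq_zero hf hb hC]
  have h1 : ∫ x, (∫ t, (G (x - t) - smoothed f G t) * b t) ^ 2 ∂densityLaw f ≤ (2 * C) ^ 2 := by
    calc _ ≤ ∫ _, (2 * C) ^ 2 ∂densityLaw f := by
          refine integral_mono_of_nonneg (Eventually.of_forall fun x => sq_nonneg _)
            (integrable_const _) (Eventually.of_forall fun x => ?_)
          dsimp only
          rw [← sq_abs]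
          exact pow_le_pow_left₀ (abs_nonneg _) (hbound x) 2
      _ = _ := by simp
  have h2 := mul_le_mul_of_nonneg_left h1 (by positivity : 0 ≤ (n : ℝ)⁻¹)
  nlinarith

end NoiseMoments

/-! ### Random bandwidths -/

/-- The kernel `(u K(u))' = K(u) + u K'(u)` that governs the dependence of the kernel estimator on
its bandwidth. -/
def scaleKernel (K : ℝ → ℝ) (u : ℝ) : ℝ := K u + u * deriv K u

section ScaleKernel

variable {K : ℝ → ℝ}

theorem continuous_scaleKernel (hK : ContDiff ℝ 2 K) : Continuous (scaleKernel K) := by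
  have h1 := hK.continuous
  have h2 := hK.continuous_deriv (by norm_num)
  unfold scaleKernel
  fun_prop

theorem hasCompactSupport_scaleKernel (hKs : HasCompactSupport K) :
    HasCompactSupport (scaleKernel K) :=
  hKs.add hKs.deriv.mul_left

theorem integral_scaleKernel (hK : ContDiff ℝ 2 K) (hKs : HasCompactSupport K) :
    ∫ u, scaleKernel K u = 0 := by
  have hc := hK.continuous
  refine integral_eq_zero_of_hasDerivAt_of_integrable (f := fun u => u * K u) (fun u => ?_)
    ((continuous_scaleKernel hK).integrable_of_hasCompactSupport
      (hasCompactSupport_scaleKernel hKs))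
    ((by fun_prop : Continuous fun u => u * K u).integrable_of_hasCompactSupport hKs.mul_left)
  have h := (hasDerivAt_id u).mul ((hK.differentiable (by norm_num) u).hasDerivAt)
  exact h.congr_deriv (by simp [scaleKernel])

theorem kde_eq_average (n : ℕ) (x : ℕ → ℝ) (h t : ℝ) :
    kde K n x h t = (n : ℝ)⁻¹ * ∑ m ∈ Finset.range n, dilate K h (x m - t) := by
  simp only [kde, dilate, ← Finset.mul_sum, mul_inv, mul_assoc]

theorem hasDerivAt_dilate (hK : ContDiff ℝ 2 K) {s : ℝ} (hs : 0 < s) (u : ℝ) :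
    HasDerivAt (fun s => dilate K s u) (-s⁻¹ * dilate (scaleKernel K) s u) s := by
  have h1 : HasDerivAt (fun s : ℝ => s⁻¹) (-(s ^ 2)⁻¹) s := hasDerivAt_inv hs.ne'
  have h2 : HasDerivAt K (deriv K (s⁻¹ * u)) (s⁻¹ * u) :=
    (hK.differentiable (by norm_num) _).hasDerivAt
  have h3 := h1.mul (h2.comp s (h1.mul_const u))
  refine h3.congr_deriv ?_
  simp only [dilate, scaleKernel, Function.comp_apply]
  field_simp
  ring

theorem hasDerivAt_kde (hK : ContDiff ℝ 2 K) {s : ℝ} (hs : 0 < s) (n : ℕ) (x : ℕ → ℝ) (t : ℝ) :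
    HasDerivAt (fun s => kde K n x s t) (-s⁻¹ * kde (scaleKernel K) n x s t) s := by
  simp_rw [kde_eq_average]
  have h1 := (HasDerivAt.fun_sum fun m (_ : m ∈ Finset.range n) =>
    hasDerivAt_dilate hK hs (x m - t)).const_mul (n : ℝ)⁻¹
  refine h1.congr_deriv ?_
  rw [← Finset.mul_sum]
  ring

/-- The change of the kernel estimator over a window of bandwidths is controlled by the mean square
of its derivative over that window. -/
theorem lintegral_sq_kde_sub_le (hK : ContDiff ℝ 2 K) {h h₀ δ : ℝ} (hδ : |h - h₀| ≤ δ)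
    (hδ₀ : δ ≤ h₀ / 2) (hh₀ : 0 < h₀) (n : ℕ) (x : ℕ → ℝ) :
    ∫⁻ t, ENNReal.ofReal ((kde K n x h t - kde K n x h₀ t) ^ 2) ≤
      ENNReal.ofReal δ * ∫⁻ t, ∫⁻ s in Set.Icc (h₀ - δ) (h₀ + δ),
        ENNReal.ofReal ((s⁻¹ * kde (scaleKernel K) n x s t) ^ 2) := by
  have hδabs := abs_le.1 hδ
  have hMc := continuous_scaleKernel hK
  have hM := hMc.measurable
  have hpos : ∀ s ∈ Set.uIcc h₀ h, 0 < s := by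
    intro s hs
    have : min h₀ h ≤ s := hs.1
    rcases min_le_iff.1 this with h1 | h1 <;> linarith
  rw [← lintegral_const_mul']
  swap
  · exact ENNReal.ofReal_ne_top
  refine lintegral_mono fun t => ?_
  have hcont : ContinuousOn (fun s => -s⁻¹ * kde (scaleKernel K) n x s t) (Set.uIcc h₀ h) := by
    intro s hs
    have hs0 := (hpos s hs).ne'
    refine ContinuousAt.continuousWithinAt ?_
    have h1 : ContinuousAt (fun s : ℝ => s⁻¹) s := continuousAt_inv₀ hs0
    simp_rw [kde_eq_average, dilate]
    refine h1.neg.mul (continuousAt_const.mul (tendsto_finsetSum _ fun m _ => ?_))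
    exact h1.mul (hMc.continuousAt.comp (h1.mul continuousAt_const))
  have hftc : kde K n x h t - kde K n x h₀ t
      = ∫ s in h₀..h, -s⁻¹ * kde (scaleKernel K) n x s t :=
    (intervalIntegral.integral_eq_sub_of_hasDerivAt
      (fun s hs => hasDerivAt_kde hK (hpos s hs) n x t) hcont.intervalIntegrable).symm
  have hmeas : Measurable fun s => -s⁻¹ * kde (scaleKernel K) n x s t := by
    unfold kde
    fun_prop
  have hsq : (kde K n x h t - kde K n x h₀ t) ^ 2
      = (∫ s in Set.uIoc h₀ h, 1 * (-s⁻¹ * kde (scaleKernel K) n x s t)) ^ 2 := by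
    rw [hftc, ← sq_abs, intervalIntegral.abs_integral_eq_abs_integral_uIoc, sq_abs]
    simp_rw [one_mul]
  rw [hsq]
  refine (ofReal_sq_integral_mul_le aemeasurable_const hmeas.aemeasurable).trans
    (mul_le_mul' ?_ ?_)
  · simp only [one_pow, ENNReal.ofReal_one, lintegral_const, Measure.restrict_apply_univ, one_mul]
    rw [Real.volume_uIoc]
    exact ENNReal.ofReal_le_ofReal hδ
  · simp_rw [neg_mul, neg_sq]
    refine lintegral_mono_set fun s hs => ?_
    rw [Set.uIoc, Set.mem_Ioc] at hs
    refine ⟨?_, ?_⟩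
    · rcases min_lt_iff.1 hs.1 with h1 | h1 <;> linarith
    · rcases le_max_iff.1 hs.2 with h1 | h1 <;> linarith

end ScaleKernel

section Derivative

variable {Ω : Type*} [MeasurableSpace Ω] {μ : Measure Ω} [IsProbabilityMeasure μ]
  {f K M : ℝ → ℝ} {X : ℕ → Ω → ℝ}

theorem lintegral_sq_dilate (hM : Continuous M) (hMs : HasCompactSupport M) {s : ℝ} (hs : 0 < s) :
    ∫⁻ u, ENNReal.ofReal (dilate M s u ^ 2) = ENNReal.ofReal (s⁻¹ * ∫ u, M u ^ 2) := by
  have hL : MemLp (dilate M s) 2 := (continuous_dilate hM s).memLp_of_hasCompactSupport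
    (hasCompactSupport_dilate hMs hs)
  rw [← ofReal_integral_eq_lintegral_ofReal hL.integrable_sq
    (Eventually.of_forall fun u => sq_nonneg _)]
  congr 1
  have h1 := Measure.integral_comp_mul_left (fun u => M u ^ 2) s⁻¹
  rw [inv_inv, abs_of_pos hs, smul_eq_mul] at h1
  simp_rw [dilate, mul_pow]
  rw [integral_const_mul, h1]
  field_simp

/-- Mean integrated square of an average of kernels with total mass zero. -/
theorem exists_lintegral_lintegral_sq_kde_le (hf : IsSmoothDensity f) (hX : IsIIDSample μ X f)
    (hM : Continuous M) (hMs : HasCompactSupport M) (hM0 : ∫ u, M u = 0) :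
    ∃ C : ℝ, 0 ≤ C ∧ ∀ n : ℕ, 1 ≤ n → ∀ s : ℝ, 0 < s →
      ∫⁻ t, ∫⁻ ω, ENNReal.ofReal (kde M n (fun m => X m ω) s t ^ 2) ∂μ ≤
        ENNReal.ofReal (C * ((n * s)⁻¹ + s ^ 2)) := by
  have := isProbabilityMeasure_densityLaw hf
  obtain ⟨C, hC0, hC⟩ := exists_lintegral_sq_smoothed_dilate_le hf hM hMs hM0
  have hM20 : 0 ≤ ∫ u, M u ^ 2 := integral_nonneg fun u => sq_nonneg _
  refine ⟨max C (∫ u, M u ^ 2), by positivity, fun n hn s hs => ?_⟩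
  have hn0 : (0 : ℝ) < n := by positivity
  have hdc := continuous_dilate hM s
  obtain ⟨B, hB⟩ := hdc.bounded_above_of_compact_support (hasCompactSupport_dilate hMs hs)
  have hlaw : ∀ m, μ.map (X m) = densityLaw f := hX.law
  have hint : ∀ t, Integrable (fun x => dilate M s (x - t) ^ 2) (densityLaw f) := fun t =>
    Integrable.of_bound
      (by fun_prop : Continuous fun x => dilate M s (x - t) ^ 2).aestronglyMeasurable (B ^ 2)
      (Eventually.of_forall fun x => by
        rw [norm_pow]
        exact pow_le_pow_left₀ (norm_nonneg _) (hB _) 2)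
  have hpt : ∀ t, ∫⁻ ω, ENNReal.ofReal (kde M n (fun m => X m ω) s t ^ 2) ∂μ ≤
      ENNReal.ofReal (n : ℝ)⁻¹ * (∫⁻ x, ENNReal.ofReal (dilate M s (x - t) ^ 2) ∂densityLaw f)
        + ENNReal.ofReal (smoothed f (dilate M s) t ^ 2) := by
    intro t
    simp_rw [kde_eq_average]
    refine (lintegral_sq_average_le hX.measurable hX.indep hlaw
      (φ := fun x => dilate M s (x - t)) (by fun_prop) (C := B) (fun x => hB _) hn).trans ?_
    rw [ENNReal.ofReal_add (mul_nonneg (inv_pos.2 hn0).le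
        (integral_nonneg fun x => sq_nonneg _)) (sq_nonneg _),
      ENNReal.ofReal_mul (inv_pos.2 hn0).le, ofReal_integral_eq_lintegral_ofReal (hint t)
        (Eventually.of_forall fun x => sq_nonneg _),
      IsContinuousKernel.smoothed_eq_integral_densityLaw hf]
  have hmeas : Measurable fun p : ℝ × ℝ => ENNReal.ofReal (dilate M s (p.2 - p.1) ^ 2) := by
    have := hdc.measurable
    fun_prop
  have hdiag : ∫⁻ t, ∫⁻ x, ENNReal.ofReal (dilate M s (x - t) ^ 2) ∂densityLaw f
      = ENNReal.ofReal (s⁻¹ * ∫ u, M u ^ 2) := by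
    rw [lintegral_lintegral_swap hmeas.aemeasurable]
    have h1 : ∀ x, ∫⁻ t, ENNReal.ofReal (dilate M s (x - t) ^ 2)
        = ENNReal.ofReal (s⁻¹ * ∫ u, M u ^ 2) := fun x => by
      rw [lintegral_sub_left_eq_self (fun u => ENNReal.ofReal (dilate M s u ^ 2)) x,
        lintegral_sq_dilate hM hMs hs]
    simp_rw [h1]
    simp
  refine (lintegral_mono hpt).trans ?_
  rw [lintegral_add_left ((Measurable.lintegral_prod_right' (ν := densityLaw f) hmeas).const_mul _),
    lintegral_const_mul _ (Measurable.lintegral_prod_right' (ν := densityLaw f) hmeas), hdiag,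
    ← ENNReal.ofReal_mul (inv_pos.2 hn0).le]
  refine (add_le_add_right (hC s hs) _).trans ?_
  rw [← ENNReal.ofReal_add (by positivity) (by positivity)]
  refine ENNReal.ofReal_le_ofReal ?_
  have h1 : (n : ℝ)⁻¹ * (s⁻¹ * ∫ u, M u ^ 2) = (∫ u, M u ^ 2) * (n * s)⁻¹ := by
    rw [mul_inv]
    ring
  rw [h1, mul_add]
  exact add_le_add (mul_le_mul_of_nonneg_right (le_max_right _ _) (by positivity))
    (mul_le_mul_of_nonneg_right (le_max_left _ _) (sq_nonneg s))

theorem measurable_kde_sample {E : Type*} [MeasurableSpace E] {a : E → Ω} {σ τ : E → ℝ}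
    (hX : ∀ m, Measurable (X m)) (hM : Continuous M) (n : ℕ) (ha : Measurable a)
    (hσ : Measurable σ) (hτ : Measurable τ) :
    Measurable fun p =>
      ENNReal.ofReal (((σ p)⁻¹ * kde M n (fun m => X m (a p)) (σ p) (τ p)) ^ 2) := by
  have hm := hM.measurable
  unfold kde
  fun_prop

/-- With `h₀` of order `n ^ (-1/5)` the factor `1 + (n h₀³)⁻¹` is bounded, so the mean over a window
of bandwidths of width `δ` is of order `δ`. -/
theorem exists_lintegral_sq_window_le (hf : IsSmoothDensity f) (hX : IsIIDSample μ X f)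
    (hM : Continuous M) (hMs : HasCompactSupport M) (hM0 : ∫ u, M u = 0) :
    ∃ C : ℝ, 0 ≤ C ∧ ∀ n : ℕ, 1 ≤ n → ∀ h₀ δ : ℝ, 0 < h₀ → 0 ≤ δ → δ ≤ h₀ / 2 →
      ∫⁻ ω, (∫⁻ t, ∫⁻ s in Set.Icc (h₀ - δ) (h₀ + δ),
          ENNReal.ofReal ((s⁻¹ * kde M n (fun m => X m ω) s t) ^ 2)) ∂μ ≤
        ENNReal.ofReal (C * (1 + (n * h₀ ^ 3)⁻¹) * δ) := by
  obtain ⟨C, hC0, hC⟩ := exists_lintegral_lintegral_sq_kde_le hf hX hM hMs hM0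
  refine ⟨16 * C, by positivity, fun n hn h₀ δ hh₀ hδ0 hδ => ?_⟩
  have hn0 : (0 : ℝ) < n := by positivity
  set ν : Measure ℝ := volume.restrict (Set.Icc (h₀ - δ) (h₀ + δ)) with hν
  have hF1 : Measurable fun p : Ω × ℝ =>
      ∫⁻ s, ENNReal.ofReal ((s⁻¹ * kde M n (fun m => X m p.1) s p.2) ^ 2) ∂ν :=
    Measurable.lintegral_prod_right' (f := fun q : (Ω × ℝ) × ℝ =>
      ENNReal.ofReal ((q.2⁻¹ * kde M n (fun m => X m q.1.1) q.2 q.1.2) ^ 2))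
      (measurable_kde_sample hX.measurable hM n measurable_fst.fst measurable_snd
        measurable_fst.snd)
  rw [lintegral_lintegral_swap hF1.aemeasurable]
  have hswap : ∀ t, ∫⁻ ω, (∫⁻ s, ENNReal.ofReal ((s⁻¹ * kde M n (fun m => X m ω) s t) ^ 2) ∂ν) ∂μ
      = ∫⁻ s, (∫⁻ ω, ENNReal.ofReal ((s⁻¹ * kde M n (fun m => X m ω) s t) ^ 2) ∂μ) ∂ν := by
    intro t
    refine lintegral_lintegral_swap (Measurable.aemeasurable ?_)
    exact measurable_kde_sample hX.measurable hM n measurable_fst measurable_snd measurable_const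
  simp_rw [hswap]
  have hF2 : Measurable fun p : ℝ × ℝ =>
      ∫⁻ ω, ENNReal.ofReal ((p.2⁻¹ * kde M n (fun m => X m ω) p.2 p.1) ^ 2) ∂μ :=
    Measurable.lintegral_prod_right' (f := fun q : (ℝ × ℝ) × Ω =>
      ENNReal.ofReal ((q.1.2⁻¹ * kde M n (fun m => X m q.2) q.1.2 q.1.1) ^ 2))
      (measurable_kde_sample hX.measurable hM n measurable_snd measurable_fst.snd
        measurable_fst.fst)
  rw [lintegral_lintegral_swap hF2.aemeasurable]
  calc _ ≤ ∫⁻ _ in Set.Icc (h₀ - δ) (h₀ + δ), ENNReal.ofReal (8 * C * (1 + (n * h₀ ^ 3)⁻¹)) := by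
        refine setLIntegral_mono measurable_const fun s hs => ?_
        have hs0 : h₀ / 2 ≤ s := by linarith [hs.1]
        have hspos : 0 < s := by linarith
        simp_rw [mul_pow, ENNReal.ofReal_mul (sq_nonneg s⁻¹)]
        have h1 : ∀ t, ∫⁻ ω, ENNReal.ofReal (s⁻¹ ^ 2) *
            ENNReal.ofReal (kde M n (fun m => X m ω) s t ^ 2) ∂μ = ENNReal.ofReal (s⁻¹ ^ 2) *
              ∫⁻ ω, ENNReal.ofReal (kde M n (fun m => X m ω) s t ^ 2) ∂μ := fun t =>
          lintegral_const_mul' _ _ ENNReal.ofReal_ne_top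
        simp_rw [h1]
        rw [lintegral_const_mul' _ _ ENNReal.ofReal_ne_top]
        refine (mul_le_mul_right (hC n hn s hspos) _).trans ?_
        rw [← ENNReal.ofReal_mul (sq_nonneg _)]
        refine ENNReal.ofReal_le_ofReal ?_
        have h2 : s⁻¹ ^ 2 * (C * ((n * s)⁻¹ + s ^ 2)) = C * ((n * s ^ 3)⁻¹ + 1) := by
          field_simp
        rw [h2]
        have h3 : ((n : ℝ) * s ^ 3)⁻¹ ≤ 8 * (n * h₀ ^ 3)⁻¹ := by
          have h4 : (h₀ / 2) ^ 3 ≤ s ^ 3 := pow_le_pow_left₀ (by positivity) hs0 3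
          have h5 : ((n : ℝ) * s ^ 3)⁻¹ ≤ (n * (h₀ / 2) ^ 3)⁻¹ :=
            inv_anti₀ (by positivity) (mul_le_mul_of_nonneg_left h4 hn0.le)
          refine h5.trans (le_of_eq ?_)
          field_simp
          norm_num
        nlinarith [mul_le_mul_of_nonneg_left h3 hC0]
    _ = _ := by
        rw [setLIntegral_const, Real.volume_Icc, ← ENNReal.ofReal_mul (by positivity)]
        congr 1
        ring

/-- Replacing a random bandwidth by a deterministic one at distance `o_p(n ^ (-2/5))` changes the
kernel estimator by `o_p(n ^ (-2/5))` in `L²`. -/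
theorem isLittleOp_integral_sq_kde_sub (hK : ContDiff ℝ 2 K) (hKs : HasCompactSupport K)
    (hf : IsSmoothDensity f) (hX : IsIIDSample μ X f) {h : ℕ → Ω → ℝ} (hh : ∀ n ω, 0 < h n ω)
    {hs : ℕ → ℝ} (hs0 : ∀ n, 0 < hs n) {c : ℝ} (hc : 0 < c)
    (hsc : ∀ᶠ n : ℕ in atTop, c ≤ (n : ℝ) ^ (1 / 5 : ℝ) * hs n)
    (hclose : IsLittleOp μ (fun n ω => h n ω - hs n) fun n _ => (n : ℝ) ^ (-(2 / 5) : ℝ)) :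
    IsLittleOp μ (fun n ω => ∫ t, (kde K n (fun m => X m ω) (h n ω) t
      - kde K n (fun m => X m ω) (hs n) t) ^ 2) fun n _ => (n : ℝ) ^ (-(4 / 5) : ℝ) := by
  have hMc := continuous_scaleKernel hK
  obtain ⟨C, hC0, hC⟩ := exists_lintegral_sq_window_le hf hX hMc
    (hasCompactSupport_scaleKernel hKs) (integral_scaleKernel hK hKs)
  intro ε hε
  set L := C * (1 + (c ^ 3)⁻¹) with hL
  have hL0 : 0 ≤ L := by positivity
  rw [ENNReal.tendsto_nhds_zero]
  intro η hη
  -- Markov's inequality on the window of half-width `κ n ^ (-2/5)` gives the bound `κ² L / ε`; the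
  -- hypothesis on `h - hs` allows every `κ > 0`.
  obtain ⟨κ, hκ, hκη⟩ : ∃ κ : ℝ, 0 < κ ∧ ENNReal.ofReal (κ ^ 2 * L / ε) ≤ η / 2 := by
    have h1 : Tendsto (fun κ : ℝ => ENNReal.ofReal (κ ^ 2 * L / ε)) (𝓝[>] 0) (𝓝 0) := by
      have h2 : Continuous fun κ : ℝ => ENNReal.ofReal (κ ^ 2 * L / ε) :=
        ENNReal.continuous_ofReal.comp (by fun_prop)
      have h3 := (h2.tendsto 0).mono_left (nhdsWithin_le_nhds (s := Set.Ioi 0))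
      simpa using h3
    have h4 := (ENNReal.tendsto_nhds_zero.1 h1) (η / 2) (ENNReal.half_pos hη.ne')
    obtain ⟨κ, hκ1, hκ2⟩ := (h4.and self_mem_nhdsWithin).exists
    exact ⟨κ, hκ2, hκ1⟩
  have hbig : ∀ᶠ n : ℕ in atTop, 2 * κ / c ≤ (n : ℝ) ^ (1 / 5 : ℝ) :=
    ((tendsto_rpow_atTop (by norm_num : (0 : ℝ) < 1 / 5)).comp
      tendsto_natCast_atTop_atTop).eventually_ge_atTop _
  have hcl := (ENNReal.tendsto_nhds_zero.1 (hclose κ hκ)) (η / 2) (ENNReal.half_pos hη.ne')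
  filter_upwards [hsc, hbig, hcl, eventually_ge_atTop 1] with n hn1 hn2 hn3 hn4
  set s := (n : ℝ) ^ (1 / 5 : ℝ) with hsdef
  have hspos : 0 < s := rpow_fifth_pos hn4
  have hs5 : s ^ 5 = n := rpow_fifth_pow_five n
  have hr2 : (n : ℝ) ^ (-(2 / 5) : ℝ) = (s ^ 2)⁻¹ := by
    exact_mod_cast rpow_neg_div_five n 2
  have hr4 : (n : ℝ) ^ (-(4 / 5) : ℝ) = (s ^ 4)⁻¹ := by
    exact_mod_cast rpow_neg_div_five n 4
  rw [hr2] at hn3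
  rw [hr4]
  set δ := κ * (s ^ 2)⁻¹ with hδ
  have hδ0 : 0 ≤ δ := by positivity
  have hδh : δ ≤ hs n / 2 := by
    have h1 : 2 * κ ≤ s * c := (div_le_iff₀ hc).1 hn2
    have h2 : 2 * κ ≤ s * (s * hs n) := h1.trans (mul_le_mul_of_nonneg_left hn1 hspos.le)
    rw [hδ, mul_inv_le_iff₀ (by positivity)]
    nlinarith
  set V : Ω → ENNReal := fun ω => ∫⁻ t, ∫⁻ s in Set.Icc (hs n - δ) (hs n + δ),
    ENNReal.ofReal ((s⁻¹ * kde (scaleKernel K) n (fun m => X m ω) s t) ^ 2) with hV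
  have hVm : Measurable V := by
    refine Measurable.lintegral_prod_right' (f := fun p : Ω × ℝ =>
      ∫⁻ s in Set.Icc (hs n - δ) (hs n + δ),
        ENNReal.ofReal ((s⁻¹ * kde (scaleKernel K) n (fun m => X m p.1) s p.2) ^ 2)) ?_
    exact Measurable.lintegral_prod_right' (f := fun q : (Ω × ℝ) × ℝ =>
      ENNReal.ofReal ((q.2⁻¹ * kde (scaleKernel K) n (fun m => X m q.1.1) q.2 q.1.2) ^ 2))
      (measurable_kde_sample hX.measurable hMc n measurable_fst.fst measurable_snd
        measurable_fst.snd)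
  have hsub : {ω | ε * |(s ^ 4)⁻¹| < |∫ t, (kde K n (fun m => X m ω) (h n ω) t
      - kde K n (fun m => X m ω) (hs n) t) ^ 2|} ⊆
      {ω | κ * |(s ^ 2)⁻¹| < |h n ω - hs n|} ∪
      {ω | ENNReal.ofReal (ε * (s ^ 4)⁻¹) ≤ ENNReal.ofReal δ * V ω} := by
    intro ω hω
    by_cases hfar : κ * |(s ^ 2)⁻¹| < |h n ω - hs n|
    · exact Or.inl hfar
    · right
      rw [abs_of_pos (by positivity), not_lt] at hfar
      have h1 : ε * |(s ^ 4)⁻¹| < |∫ t, (kde K n (fun m => X m ω) (h n ω) t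
        - kde K n (fun m => X m ω) (hs n) t) ^ 2| := hω
      rw [abs_of_pos (by positivity), abs_of_nonneg (integral_nonneg fun t => sq_nonneg _)] at h1
      have h2 := lintegral_sq_kde_sub_le hK hfar hδh (hs0 n) n (fun m => X m ω)
      refine le_trans (le_of_lt ?_) h2
      by_contra hle
      rw [not_lt] at hle
      refine absurd (integral_sq_le_of_lintegral_sq_le ?_ (by positivity) hle) (not_le.2 h1)
      exact ((memLp_kde hK.continuous hKs (hh n ω)).sub
        (memLp_kde hK.continuous hKs (hs0 n))).aestronglyMeasurable
  refine (measure_mono hsub).trans ((measure_union_le _ _).trans ?_)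
  rw [← ENNReal.add_halves η]
  refine add_le_add hn3 (le_trans ?_ hκη)
  have hpos : 0 < ε * (s ^ 4)⁻¹ := by positivity
  refine (meas_ge_le_lintegral_div (hVm.const_mul _).aemeasurable (by simpa using hpos)
    ENNReal.ofReal_ne_top).trans ?_
  rw [lintegral_const_mul _ hVm]
  have hVle : ∫⁻ ω, V ω ∂μ ≤ ENNReal.ofReal (L * δ) := by
    refine (hC n hn4 (hs n) δ (hs0 n) hδ0 hδh).trans (ENNReal.ofReal_le_ofReal ?_)
    refine mul_le_mul_of_nonneg_right (mul_le_mul_of_nonneg_left ?_ hC0) hδ0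
    have h1 : c ^ 3 ≤ n * hs n ^ 3 := by
      have h2 : c ^ 3 ≤ (s * hs n) ^ 3 := pow_le_pow_left₀ hc.le hn1 3
      have h3 : 1 ≤ s := Real.one_le_rpow (by exact_mod_cast hn4) (by norm_num)
      have h4 : s ^ 3 ≤ s ^ 5 := pow_le_pow_right₀ h3 (by norm_num)
      rw [← hs5]
      refine h2.trans ?_
      rw [mul_pow]
      exact mul_le_mul_of_nonneg_right h4 (pow_pos (hs0 n) 3).le
    linarith [inv_anti₀ (by positivity) h1]
  refine (ENNReal.div_le_div_right (mul_le_mul_right hVle _) _).trans ?_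
  rw [← ENNReal.ofReal_mul hδ0, ← ENNReal.ofReal_div_of_pos hpos]
  refine ENNReal.ofReal_le_ofReal (le_of_eq ?_)
  rw [hδ]
  field_simp

end Derivative

/-! ### The error Gram matrix at deterministic bandwidths -/

section Rates

theorem rpow_neg_four_fifths (n : ℕ) :
    (n : ℝ) ^ (-(4 / 5) : ℝ) = (((n : ℝ) ^ (1 / 5 : ℝ)) ^ 4)⁻¹ := by
  exact_mod_cast rpow_neg_div_five n 4

theorem rpow_neg_two_fifths (n : ℕ) :
    (n : ℝ) ^ (-(2 / 5) : ℝ) = (((n : ℝ) ^ (1 / 5 : ℝ)) ^ 2)⁻¹ := by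
  exact_mod_cast rpow_neg_div_five n 2

theorem rpow_neg_one_fifth (n : ℕ) :
    (n : ℝ) ^ (-(1 / 5) : ℝ) = ((n : ℝ) ^ (1 / 5 : ℝ))⁻¹ :=
  Real.rpow_neg (Nat.cast_nonneg n) _

theorem one_le_rpow_fifth {n : ℕ} (hn : 1 ≤ n) : 1 ≤ (n : ℝ) ^ (1 / 5 : ℝ) :=
  Real.one_le_rpow (by exact_mod_cast hn) (by norm_num)

theorem tendsto_rpow_fifth : Tendsto (fun n : ℕ => (n : ℝ) ^ (1 / 5 : ℝ)) atTop atTop :=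
  (tendsto_rpow_atTop (by norm_num : (0 : ℝ) < 1 / 5)).comp tendsto_natCast_atTop_atTop

/-- Second moments of order `n ^ (-9/5)` give `o_p(n ^ (-4/5))`. -/
theorem isLittleOp_of_lintegral_sq_le {Ω : Type*} [MeasurableSpace Ω] {μ : Measure Ω}
    {Z : ℕ → Ω → ℝ} (hZ : ∀ n, AEMeasurable (Z n) μ) {L : ℝ}
    (h : ∀ᶠ n : ℕ in atTop, ∫⁻ ω, ENNReal.ofReal (Z n ω ^ 2) ∂μ ≤
      ENNReal.ofReal (L * (((n : ℝ) ^ (1 / 5 : ℝ)) ^ 9)⁻¹)) :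
    IsLittleOp μ Z fun n _ => (n : ℝ) ^ (-(4 / 5) : ℝ) := by
  refine isLittleOp_of_lintegral_sq hZ ?_ h ?_
  · filter_upwards [eventually_ge_atTop 1] with n hn
    have : (0 : ℝ) < n := by positivity
    positivity
  · have h1 : Tendsto (fun n : ℕ => L * ((n : ℝ) ^ (1 / 5 : ℝ))⁻¹) atTop (𝓝 (L * 0)) :=
      (tendsto_inv_atTop_zero.comp tendsto_rpow_fifth).const_mul L
    rw [mul_zero] at h1
    refine h1.congr' ?_
    filter_upwards [eventually_ge_atTop 1] with n hn
    have := rpow_fifth_pos hn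
    rw [rpow_neg_four_fifths]
    field_simp

end Rates

section Deterministic

variable {Ω : Type*} [MeasurableSpace Ω] {μ : Measure Ω} [IsProbabilityMeasure μ]
  {f K : ℝ → ℝ} {X : ℕ → Ω → ℝ} {a b : ℕ → ℝ} {C : ℝ}

theorem roughness_nonneg (f : ℝ → ℝ) : 0 ≤ roughness f :=
  integral_nonneg fun _ => sq_nonneg _

/-- The inner product of two bias terms is `¼ a² b² c_K² γ` up to smaller order. -/
theorem eventually_abs_integral_bias_sub_le (hf : IsSmoothDensity f) (hK : IsKernel K)
    (hKc : Continuous K) (hKs : HasCompactSupport K) (ha : ∀ n, 0 < a n) (hb : ∀ n, 0 < b n)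
    (haC : ∀ᶠ n : ℕ in atTop, (n : ℝ) ^ (1 / 5 : ℝ) * a n ≤ C)
    (hbC : ∀ᶠ n : ℕ in atTop, (n : ℝ) ^ (1 / 5 : ℝ) * b n ≤ C) {ε : ℝ} (hε : 0 < ε) :
    ∀ᶠ n : ℕ in atTop, |(∫ t, (smoothed f (dilate K (a n)) t - f t)
        * (smoothed f (dilate K (b n)) t - f t))
      - roughness f * (1 / 4 * a n ^ 2 * b n ^ 2 * (∫ u, u ^ 2 * K u) ^ 2)|
      ≤ ε * (n : ℝ) ^ (-(4 / 5) : ℝ) := by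
  set γ := roughness f with hγ
  have hγ0 : 0 ≤ γ := roughness_nonneg f
  set c := ∫ u, u ^ 2 * K u with hc
  have hc0 : 0 ≤ c := integral_nonneg fun u => mul_nonneg (sq_nonneg u) (hK.nonneg u)
  -- The final estimate has the factor `C⁴ (c √γ τ + τ²)`, where `τ h²` bounds the norm of the
  -- remainder of the bias.
  obtain ⟨τ, hτ, hτε⟩ : ∃ τ : ℝ, 0 < τ ∧ C ^ 4 * (c * √γ * τ + τ ^ 2) ≤ ε := by
    have h1 : Continuous fun τ : ℝ => C ^ 4 * (c * √γ * τ + τ ^ 2) := by fun_prop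
    have h2 := (h1.tendsto 0).mono_left (nhdsWithin_le_nhds (s := Set.Ioi 0))
    have h3 := h2.eventually (gt_mem_nhds (show C ^ 4 * (c * √γ * 0 + 0 ^ 2) < ε by simpa))
    obtain ⟨τ, hτ1, hτ2⟩ := (h3.and self_mem_nhdsWithin).exists
    exact ⟨τ, hτ2, hτ1.le⟩
  obtain ⟨δ, hδ, H⟩ := exists_delta_bias hf hK hKc hKs (ε := τ ^ 2) (by positivity)
  filter_upwards [haC, hbC, eventually_ge_atTop 1,
    tendsto_rpow_fifth.eventually_ge_atTop (C / δ)] with n hna hnb hn hnδ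
  rw [rpow_neg_four_fifths]
  set s := (n : ℝ) ^ (1 / 5 : ℝ)
  have hs : 0 < s := rpow_fifth_pos hn
  have hC0 : 0 < C := (mul_pos hs (ha n)).trans_le hna
  have key : ∀ h : ℝ, 0 < h → s * h ≤ C → h ^ 2 ≤ C ^ 2 * (s ^ 2)⁻¹ ∧
      MemLp (fun t => smoothed f (dilate K h) t - f t - h ^ 2 / 2 * c * iteratedDeriv 2 f t) 2 ∧
      √(∫ t, (smoothed f (dilate K h) t - f t - h ^ 2 / 2 * c * iteratedDeriv 2 f t) ^ 2)
        ≤ τ * h ^ 2 := by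
    intro h hh hsh
    have hL : MemLp (fun t => smoothed f (dilate K h) t - f t
        - h ^ 2 / 2 * c * iteratedDeriv 2 f t) 2 :=
      (((isContinuousKernel_dilate hK hKc hKs hh).memLp_smoothed hf).sub (memLp_density hf)).sub
        (hf.memLp_iteratedDeriv_two.const_mul _)
    refine ⟨?_, hL, ?_⟩
    · rw [← div_eq_mul_inv, ← div_pow]
      exact pow_le_pow_left₀ hh.le ((le_div_iff₀ hs).2 (by linarith)) 2
    · have hhδ : h ≤ δ := by
        have h1 : C ≤ s * δ := (div_le_iff₀ hδ).1 hnδ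
        exact le_of_mul_le_mul_left (hsh.trans h1) hs
      refine (Real.sqrt_le_sqrt (integral_sq_le_of_lintegral_sq_le hL.aestronglyMeasurable
        (by positivity) (H h hh hhδ))).trans (le_of_eq ?_)
      rw [show τ ^ 2 * h ^ 4 = (τ * h ^ 2) ^ 2 by ring]
      exact Real.sqrt_sq (by positivity)
  obtain ⟨ha2, haL, haN⟩ := key (a n) (ha n) hna
  obtain ⟨hb2, hbL, hbN⟩ := key (b n) (hb n) hnb
  set ρa : ℝ → ℝ := fun t => smoothed f (dilate K (a n)) t - f t
    - a n ^ 2 / 2 * c * iteratedDeriv 2 f t with hρa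
  set ρb : ℝ → ℝ := fun t => smoothed f (dilate K (b n)) t - f t
    - b n ^ 2 / 2 * c * iteratedDeriv 2 f t with hρb
  set g := iteratedDeriv 2 f with hg
  have hgL : MemLp g 2 := hf.memLp_iteratedDeriv_two
  have i1 : Integrable fun t => (a n ^ 2 / 2 * c) * (b n ^ 2 / 2 * c) * g t ^ 2 :=
    hgL.integrable_sq.const_mul _
  have i2 : Integrable fun t => (a n ^ 2 / 2 * c) * (g t * ρb t) :=
    (hgL.integrable_mul hbL).const_mul _
  have i3 : Integrable fun t => (b n ^ 2 / 2 * c) * (g t * ρa t) :=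
    (hgL.integrable_mul haL).const_mul _
  have i4 : Integrable fun t => ρa t * ρb t := haL.integrable_mul hbL
  have i12 : Integrable fun t => (a n ^ 2 / 2 * c) * (b n ^ 2 / 2 * c) * g t ^ 2
      + (a n ^ 2 / 2 * c) * (g t * ρb t) := i1.add i2
  have i123 : Integrable fun t => (a n ^ 2 / 2 * c) * (b n ^ 2 / 2 * c) * g t ^ 2
      + (a n ^ 2 / 2 * c) * (g t * ρb t) + (b n ^ 2 / 2 * c) * (g t * ρa t) := i12.add i3
  have hexp : ∫ t, (smoothed f (dilate K (a n)) t - f t) * (smoothed f (dilate K (b n)) t - f t)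
      = (a n ^ 2 / 2 * c) * (b n ^ 2 / 2 * c) * γ + (a n ^ 2 / 2 * c) * (∫ t, g t * ρb t)
        + (b n ^ 2 / 2 * c) * (∫ t, g t * ρa t) + ∫ t, ρa t * ρb t := by
    have hsum : ∀ t, (smoothed f (dilate K (a n)) t - f t) * (smoothed f (dilate K (b n)) t - f t)
        = (a n ^ 2 / 2 * c) * (b n ^ 2 / 2 * c) * g t ^ 2 + (a n ^ 2 / 2 * c) * (g t * ρb t)
          + (b n ^ 2 / 2 * c) * (g t * ρa t) + ρa t * ρb t := by
      intro t
      simp only [hρa, hρb]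
      ring
    simp_rw [hsum]
    rw [integral_add i123 i4, integral_add i12 i3, integral_add i1 i2, integral_const_mul,
      integral_const_mul, integral_const_mul]
    rfl
  rw [hexp]
  have e1 : |∫ t, g t * ρb t| ≤ √γ * (τ * b n ^ 2) := (abs_integral_mul_le hgL hbL).trans
    (mul_le_mul_of_nonneg_left hbN (Real.sqrt_nonneg _))
  have e2 : |∫ t, g t * ρa t| ≤ √γ * (τ * a n ^ 2) := (abs_integral_mul_le hgL haL).trans
    (mul_le_mul_of_nonneg_left haN (Real.sqrt_nonneg _))
  have e3 : |∫ t, ρa t * ρb t| ≤ (τ * a n ^ 2) * (τ * b n ^ 2) :=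
    (abs_integral_mul_le haL hbL).trans
      (mul_le_mul haN hbN (Real.sqrt_nonneg _) (by positivity))
  have hab : a n ^ 2 * b n ^ 2 ≤ C ^ 4 * (s ^ 4)⁻¹ := by
    refine (mul_le_mul ha2 hb2 (sq_nonneg _) (by positivity)).trans (le_of_eq ?_)
    field_simp
  have p1 : 0 ≤ a n ^ 2 / 2 * c := by positivity
  have p2 : 0 ≤ b n ^ 2 / 2 * c := by positivity
  calc _ = |(a n ^ 2 / 2 * c) * (∫ t, g t * ρb t) + (b n ^ 2 / 2 * c) * (∫ t, g t * ρa t)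
        + ∫ t, ρa t * ρb t| := by
        congr 1
        ring
    _ ≤ (a n ^ 2 / 2 * c) * (√γ * (τ * b n ^ 2)) + (b n ^ 2 / 2 * c) * (√γ * (τ * a n ^ 2))
        + (τ * a n ^ 2) * (τ * b n ^ 2) := by
        refine (abs_add_three _ _ _).trans (add_le_add (add_le_add ?_ ?_) e3)
        · rw [abs_mul, abs_of_nonneg p1]
          exact mul_le_mul_of_nonneg_left e1 p1
        · rw [abs_mul, abs_of_nonneg p2]
          exact mul_le_mul_of_nonneg_left e2 p2
    _ = (c * √γ * τ + τ ^ 2) * (a n ^ 2 * b n ^ 2) := by ring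
    _ ≤ (c * √γ * τ + τ ^ 2) * (C ^ 4 * (s ^ 4)⁻¹) :=
        mul_le_mul_of_nonneg_left hab (by positivity)
    _ = C ^ 4 * (c * √γ * τ + τ ^ 2) * (s ^ 4)⁻¹ := by ring
    _ ≤ ε * (s ^ 4)⁻¹ := mul_le_mul_of_nonneg_right hτε (by positivity)

/-- The second moment is of order `n⁻² h⁻¹`, hence `n ^ (-9/5)`. -/
theorem isLittleOp_noise_mul_noise (hf : IsSmoothDensity f) (hX : IsIIDSample μ X f)
    (hK : IsKernel K) (hKc : Continuous K) (hKs : HasCompactSupport K) (ha : ∀ n, 0 < a n)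
    (hb : ∀ n, 0 < b n) {c : ℝ} (hc : 0 < c)
    (hbc : ∀ᶠ n : ℕ in atTop, c ≤ (n : ℝ) ^ (1 / 5 : ℝ) * b n) :
    IsLittleOp μ (fun n ω => (∫ t, noise f (dilate K (a n)) n (fun m => X m ω) t
        * noise f (dilate K (b n)) n (fun m => X m ω) t)
      - (n : ℝ)⁻¹ * ∫ u, dilate K (a n) u * dilate K (b n) u)
      fun n _ => (n : ℝ) ^ (-(4 / 5) : ℝ) := by
  have hG : ∀ h : ℝ, 0 < h → IsContinuousKernel (dilate K h) := fun h hh =>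
    isContinuousKernel_dilate hK hKc hKs hh
  obtain ⟨D, hD0, hD⟩ := hf.exists_bound
  obtain ⟨M, hM⟩ := hK.bounded
  have hM0 : 0 ≤ M := (hK.nonneg 0).trans (hM 0)
  refine isLittleOp_of_lintegral_sq_le (L := 8 * (M / c) * D + 40 * D ^ 2) (fun n =>
    (aemeasurable_integral_noise_mul_noise hf (hG _ (ha n)) (hG _ (hb n)) hX n).sub_const _) ?_
  filter_upwards [hbc, eventually_ge_atTop 1] with n hnb hn
  have hB : ∀ u, dilate K (b n) u ≤ (b n)⁻¹ * M := fun u =>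
    mul_le_mul_of_nonneg_left (hM _) (inv_pos.2 (hb n)).le
  refine (lintegral_sq_noise_mul_noise_le hf (hG _ (ha n)) (hG _ (hb n)) hX hD hB hn).trans
    (ENNReal.ofReal_le_ofReal ?_)
  have hn5 : (n : ℝ) = ((n : ℝ) ^ (1 / 5 : ℝ)) ^ 5 := (rpow_fifth_pow_five n).symm
  set s := (n : ℝ) ^ (1 / 5 : ℝ) with hs
  have hspos : 0 < s := rpow_fifth_pos hn
  have hs1 : 1 ≤ s := one_le_rpow_fifth hn
  have hbs : (b n)⁻¹ ≤ s / c := by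
    rw [inv_le_comm₀ (hb n) (by positivity), inv_div, div_le_iff₀ hspos]
    linarith
  have h1 : 8 * ((b n)⁻¹ * M) * D + 40 * D ^ 2 ≤ s * (8 * (M / c) * D + 40 * D ^ 2) := by
    have h2 : (b n)⁻¹ * M * D ≤ s / c * M * D := by gcongr
    have h3 : 40 * D ^ 2 ≤ s * (40 * D ^ 2) := le_mul_of_one_le_left (by positivity) hs1
    have h4 : s * (8 * (M / c) * D + 40 * D ^ 2) = 8 * (s / c * M * D) + s * (40 * D ^ 2) := by
      ring
    rw [h4]
    linarith
  rw [hn5]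
  refine (mul_le_mul_of_nonneg_right h1 (by positivity)).trans (le_of_eq ?_)
  field_simp

/-- The bias is uniformly of order `h²`, so the second moment is of order `n⁻¹ h⁴`, hence
`n ^ (-9/5)`. -/
theorem isLittleOp_noise_mul_bias (hf : IsSmoothDensity f) (hX : IsIIDSample μ X f)
    (hK : IsKernel K) (hKc : Continuous K) (hKs : HasCompactSupport K) (ha : ∀ n, 0 < a n)
    (hb : ∀ n, 0 < b n) (hbC : ∀ᶠ n : ℕ in atTop, (n : ℝ) ^ (1 / 5 : ℝ) * b n ≤ C) :
    IsLittleOp μ (fun n ω => ∫ t, noise f (dilate K (a n)) n (fun m => X m ω) t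
        * (smoothed f (dilate K (b n)) t - f t)) fun n _ => (n : ℝ) ^ (-(4 / 5) : ℝ) := by
  have hG : ∀ h : ℝ, 0 < h → IsContinuousKernel (dilate K h) := fun h hh =>
    isContinuousKernel_dilate hK hKc hKs hh
  obtain ⟨D, hD0, hD⟩ := exists_abs_bias_le hf hK hKc hKs
  have hm : ∀ n, Measurable fun t => smoothed f (dilate K (b n)) t - f t := fun n =>
    ((hG _ (hb n)).measurable_smoothed hf).sub hf.continuous.measurable
  refine isLittleOp_of_lintegral_sq_le (L := 4 * (D * C ^ 2) ^ 2) (fun n =>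
    aemeasurable_integral_noise_mul hf (hG _ (ha n)) hX (hm n) (hD _ (hb n)) n) ?_
  filter_upwards [hbC, eventually_ge_atTop 1] with n hnb hn
  refine (lintegral_sq_noise_mul_le hf (hG _ (ha n)) hX (hm n) (hD _ (hb n)) hn).trans
    (ENNReal.ofReal_le_ofReal ?_)
  have hn5 : (n : ℝ) = ((n : ℝ) ^ (1 / 5 : ℝ)) ^ 5 := (rpow_fifth_pow_five n).symm
  set s := (n : ℝ) ^ (1 / 5 : ℝ) with hs
  have hspos : 0 < s := rpow_fifth_pos hn
  have h1 : b n ^ 2 ≤ C ^ 2 * (s ^ 2)⁻¹ := by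
    rw [← div_eq_mul_inv, ← div_pow]
    exact pow_le_pow_left₀ (hb n).le ((le_div_iff₀ hspos).2 (by linarith)) 2
  have h2 : (D * b n ^ 2) ^ 2 ≤ (D * (C ^ 2 * (s ^ 2)⁻¹)) ^ 2 := by gcongr
  rw [hn5]
  calc 4 * (D * b n ^ 2) ^ 2 * (s ^ 5)⁻¹ ≤ 4 * (D * (C ^ 2 * (s ^ 2)⁻¹)) ^ 2 * (s ^ 5)⁻¹ := by
        gcongr
    _ = _ := by field_simp

theorem inv_mul_integral_dilate_mul (n : ℕ) (a b : ℝ) :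
    (n : ℝ)⁻¹ * ∫ u, dilate K a u * dilate K b u
      = (n * a * b)⁻¹ * ∫ u, K (u / a) * K (u / b) := by
  have h1 : ∀ u, dilate K a u * dilate K b u = (a * b)⁻¹ * (K (u / a) * K (u / b)) := fun u => by
    simp only [dilate, div_eq_inv_mul, mul_inv]
    ring
  simp_rw [h1]
  rw [integral_const_mul]
  simp only [mul_inv]
  ring

theorem memLp_kde_sub (hf : IsSmoothDensity f) (hKc : Continuous K) (hKs : HasCompactSupport K)
    (n : ℕ) (x : ℕ → ℝ) {h : ℝ} (hh : 0 < h) : MemLp (fun t => kde K n x h t - f t) 2 :=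
  (memLp_kde hKc hKs hh).sub (memLp_density hf)

/-- At deterministic bandwidths, the error Gram matrix is `A + γ B` up to `o_p(n ^ (-4/5))`. -/
theorem isLittleOp_errorGram_sub {k : ℕ} {hs : ℕ → Fin k → ℝ} (hf : IsSmoothDensity f)
    (hX : IsIIDSample μ X f) (hK : IsKernel K) (hKc : Continuous K) (hKs : HasCompactSupport K)
    (hs0 : ∀ n i, 0 < hs n i) {c : ℝ} (hc : 0 < c)
    (hsc : ∀ i, ∀ᶠ n : ℕ in atTop, (n : ℝ) ^ (1 / 5 : ℝ) * hs n i ∈ Set.Icc c C) (i j : Fin k) :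
    IsLittleOp μ (fun n ω => errorGram K f n (fun m => X m ω) (hs n) i j
      - approxGram K n (hs n) (roughness f) i j) fun n _ => (n : ℝ) ^ (-(4 / 5) : ℝ) := by
  have hsc1 : ∀ i, ∀ᶠ n : ℕ in atTop, c ≤ (n : ℝ) ^ (1 / 5 : ℝ) * hs n i := fun i =>
    (hsc i).mono fun n h => h.1
  have hsC : ∀ i, ∀ᶠ n : ℕ in atTop, (n : ℝ) ^ (1 / 5 : ℝ) * hs n i ≤ C := fun i =>
    (hsc i).mono fun n h => h.2
  have h1 := isLittleOp_iff.1 (isLittleOp_noise_mul_noise hf hX hK hKc hKs (fun n => hs0 n i)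
    (fun n => hs0 n j) hc (hsc1 j))
  have h2 := isLittleOp_iff.1 (isLittleOp_noise_mul_bias hf hX hK hKc hKs (fun n => hs0 n i)
    (fun n => hs0 n j) (hsC j))
  have h3 := isLittleOp_iff.1 (isLittleOp_noise_mul_bias hf hX hK hKc hKs (fun n => hs0 n j)
    (fun n => hs0 n i) (hsC i))
  rw [isLittleOp_iff]
  intro ε hε
  have hε4 : 0 < ε / 4 := by positivity
  refine (((h1 _ hε4).and (h2 _ hε4)).and (h3 _ hε4)).mono ?_
  filter_upwards [eventually_abs_integral_bias_sub_le hf hK hKc hKs (fun n => hs0 n i)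
    (fun n => hs0 n j) (hsC i) (hsC j) hε4, eventually_ge_atTop 1] with n hn4 hn ω ⟨⟨hn1, hn2⟩, hn3⟩
  rw [abs_of_nonneg (Real.rpow_nonneg (Nat.cast_nonneg n) _)] at hn1 hn2 hn3 ⊢
  set Ni := noise f (dilate K (hs n i)) n (fun m => X m ω)
  set Nj := noise f (dilate K (hs n j)) n (fun m => X m ω)
  set Bi : ℝ → ℝ := fun t => smoothed f (dilate K (hs n i)) t - f t with hBi
  set Bj : ℝ → ℝ := fun t => smoothed f (dilate K (hs n j)) t - f t with hBj
  have hG : ∀ i, IsContinuousKernel (dilate K (hs n i)) := fun i =>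
    isContinuousKernel_dilate hK hKc hKs (hs0 n i)
  have lNi : MemLp Ni 2 := memLp_noise hf (hG i) n _
  have lNj : MemLp Nj 2 := memLp_noise hf (hG j) n _
  have lBi : MemLp Bi 2 := ((hG i).memLp_smoothed hf).sub (memLp_density hf)
  have lBj : MemLp Bj 2 := ((hG j).memLp_smoothed hf).sub (memLp_density hf)
  have i1 : Integrable fun t => Ni t * Nj t := lNi.integrable_mul lNj
  have i2 : Integrable fun t => Ni t * Bj t := lNi.integrable_mul lBj
  have i3 : Integrable fun t => Nj t * Bi t := lNj.integrable_mul lBi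
  have i4 : Integrable fun t => Bi t * Bj t := lBi.integrable_mul lBj
  have i12 : Integrable fun t => Ni t * Nj t + Ni t * Bj t := i1.add i2
  have i123 : Integrable fun t => Ni t * Nj t + Ni t * Bj t + Nj t * Bi t := i12.add i3
  have hexp : errorGram K f n (fun m => X m ω) (hs n) i j
      = (∫ t, Ni t * Nj t) + (∫ t, Ni t * Bj t) + (∫ t, Nj t * Bi t) + ∫ t, Bi t * Bj t := by
    rw [← integral_add i1 i2, ← integral_add i12 i3, ← integral_add i123 i4, errorGram,
      Matrix.of_apply]
    refine integral_congr_ae (Eventually.of_forall fun t => ?_)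
    simp only [kde_sub_eq hn]
    ring
  have happ : approxGram K n (hs n) (roughness f) i j
      = (n : ℝ)⁻¹ * (∫ u, dilate K (hs n i) u * dilate K (hs n j) u)
        + roughness f * (1 / 4 * hs n i ^ 2 * hs n j ^ 2 * (∫ u, u ^ 2 * K u) ^ 2) := by
    rw [inv_mul_integral_dilate_mul]
    rfl
  rw [hexp, happ]
  rw [abs_le] at hn1 hn2 hn3 hn4 ⊢
  constructor <;> linarith [hn1.1, hn1.2, hn2.1, hn2.2, hn3.1, hn3.2, hn4.1, hn4.2]

end Deterministic

/-! ### The error Gram matrix and its estimate at random bandwidths -/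

section RandomBandwidths

variable {Ω : Type*} [MeasurableSpace Ω] {μ : Measure Ω} {f K : ℝ → ℝ} {X : ℕ → Ω → ℝ} {k : ℕ}
  {h : ℕ → Ω → Fin k → ℝ} {hs : ℕ → Fin k → ℝ} {c C : ℝ}

/-- Inner products of functions of norm at most `D √r` change by at most `(2 D τ + τ²) r` when the
functions are perturbed by at most `τ √r` in norm. -/
theorem abs_integral_mul_sub_le {p q p' q' : ℝ → ℝ} (hp : MemLp p 2) (hq : MemLp q 2)
    (hp' : MemLp p' 2) (hq' : MemLp q' 2) {τ D r : ℝ} (hτ : 0 ≤ τ) (hD : 0 ≤ D) (hr : 0 ≤ r)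
    (h1 : ∫ t, (p' t - p t) ^ 2 ≤ τ ^ 2 * r) (h2 : ∫ t, (q' t - q t) ^ 2 ≤ τ ^ 2 * r)
    (h3 : ∫ t, p t ^ 2 ≤ D ^ 2 * r) (h4 : ∫ t, q t ^ 2 ≤ D ^ 2 * r) :
    |(∫ t, p' t * q' t) - ∫ t, p t * q t| ≤ (2 * D * τ + τ ^ 2) * r := by
  have hpd : MemLp (fun t => p' t - p t) 2 := hp'.sub hp
  have hqd : MemLp (fun t => q' t - q t) 2 := hq'.sub hq
  have i0 : Integrable fun t => p t * q t := hp.integrable_mul hq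
  have i1 : Integrable fun t => p t * (q' t - q t) := hp.integrable_mul hqd
  have i2 : Integrable fun t => q t * (p' t - p t) := hq.integrable_mul hpd
  have i3 : Integrable fun t => (p' t - p t) * (q' t - q t) := hpd.integrable_mul hqd
  have i01 : Integrable fun t => p t * q t + p t * (q' t - q t) := i0.add i1
  have i012 : Integrable fun t => p t * q t + p t * (q' t - q t) + q t * (p' t - p t) := i01.add i2
  have hexp : ∫ t, p' t * q' t = (∫ t, p t * q t) + (∫ t, p t * (q' t - q t))
      + (∫ t, q t * (p' t - p t)) + ∫ t, (p' t - p t) * (q' t - q t) := by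
    rw [← integral_add i0 i1, ← integral_add i01 i2, ← integral_add i012 i3]
    exact integral_congr_ae (Eventually.of_forall fun t => by ring)
  have hsqrt : ∀ {x a : ℝ}, 0 ≤ a → x ≤ a ^ 2 * r → √x ≤ a * √r := by
    intro x a ha hx
    rw [← Real.sqrt_sq ha, ← Real.sqrt_mul (sq_nonneg a)]
    exact Real.sqrt_le_sqrt hx
  have s1 := hsqrt hτ h1
  have s2 := hsqrt hτ h2
  have s3 := hsqrt hD h3
  have s4 := hsqrt hD h4
  have e1 : |∫ t, p t * (q' t - q t)| ≤ (D * √r) * (τ * √r) := (abs_integral_mul_le hp hqd).trans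
    (mul_le_mul s3 s2 (Real.sqrt_nonneg _) (by positivity))
  have e2 : |∫ t, q t * (p' t - p t)| ≤ (D * √r) * (τ * √r) := (abs_integral_mul_le hq hpd).trans
    (mul_le_mul s4 s1 (Real.sqrt_nonneg _) (by positivity))
  have e3 : |∫ t, (p' t - p t) * (q' t - q t)| ≤ (τ * √r) * (τ * √r) :=
    (abs_integral_mul_le hpd hqd).trans (mul_le_mul s1 s2 (Real.sqrt_nonneg _) (by positivity))
  have hrr : √r * √r = r := Real.mul_self_sqrt hr
  have hsum : (2 * D * τ + τ ^ 2) * r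
      = (D * √r) * (τ * √r) + (D * √r) * (τ * √r) + (τ * √r) * (τ * √r) := by
    linear_combination (-(2 * D * τ + τ ^ 2)) * hrr
  rw [hexp, hsum]
  rw [abs_le] at e1 e2 e3 ⊢
  constructor <;> linarith [e1.1, e1.2, e2.1, e2.2, e3.1, e3.2]

theorem eventually_abs_approxGram_le (hKc : Continuous K) (hKs : HasCompactSupport K)
    (hs0 : ∀ n i, 0 < hs n i) (hc : 0 < c)
    (hsc : ∀ i, ∀ᶠ n : ℕ in atTop, (n : ℝ) ^ (1 / 5 : ℝ) * hs n i ∈ Set.Icc c C) (γ : ℝ) :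
    ∃ D : ℝ, 0 ≤ D ∧ ∀ᶠ n : ℕ in atTop, ∀ i j,
      |approxGram K n (hs n) γ i j| ≤ D * (n : ℝ) ^ (-(4 / 5) : ℝ) := by
  obtain ⟨D, hD⟩ := exists_bound_scaledGram hKc hKs (c₂ := C) hc γ
  refine ⟨max D 0, le_max_right _ _, ?_⟩
  filter_upwards [eventually_all.2 hsc, eventually_ge_atTop 1] with n hn hn1 i j
  have hspos : 0 < (n : ℝ) ^ (1 / 5 : ℝ) := rpow_fifth_pos hn1
  rw [approxGram_eq_scaledGram hspos (rpow_fifth_pow_five n) (hs0 n), abs_mul,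
    rpow_neg_four_fifths, abs_of_pos (by positivity), mul_comm]
  exact mul_le_mul_of_nonneg_right ((hD _ (hn i) _ (hn j)).trans (le_max_left _ _)) (by positivity)

theorem isLittleOp_errorGram_sub_random [IsProbabilityMeasure μ] (hf : IsSmoothDensity f)
    (hX : IsIIDSample μ X f) (hK : IsKernel K) (hKd : ContDiff ℝ 2 K) (hKs : HasCompactSupport K)
    (hh : ∀ n ω i, 0 < h n ω i) (hs0 : ∀ n i, 0 < hs n i) (hc : 0 < c)
    (hsc : ∀ i, ∀ᶠ n : ℕ in atTop, (n : ℝ) ^ (1 / 5 : ℝ) * hs n i ∈ Set.Icc c C)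
    (hclose : ∀ i, IsLittleOp μ (fun n ω => h n ω i - hs n i)
      fun n _ => (n : ℝ) ^ (-(2 / 5) : ℝ)) (i j : Fin k) :
    IsLittleOp μ (fun n ω => errorGram K f n (fun m => X m ω) (h n ω) i j
      - approxGram K n (hs n) (roughness f) i j) fun n _ => (n : ℝ) ^ (-(4 / 5) : ℝ) := by
  have hKc := hKd.continuous
  have hG := fun i j => isLittleOp_iff.1
    (isLittleOp_errorGram_sub hf hX hK hKc hKs hs0 hc hsc i j)
  have hV := fun i => isLittleOp_iff.1 (isLittleOp_integral_sq_kde_sub hKd hKs hf hX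
    (fun n ω => hh n ω i) (fun n => hs0 n i) hc ((hsc i).mono fun n h => h.1) (hclose i))
  obtain ⟨D, hD0, hD⟩ := eventually_abs_approxGram_le hKc hKs hs0 hc hsc (roughness f)
  rw [isLittleOp_iff]
  intro ε hε
  obtain ⟨τ, hτ, hτε⟩ : ∃ τ : ℝ, 0 < τ ∧ 2 * √(D + 1) * τ + τ ^ 2 ≤ ε / 2 := by
    have h1 : Continuous fun τ : ℝ => 2 * √(D + 1) * τ + τ ^ 2 := by fun_prop
    have h2 := (h1.tendsto 0).mono_left (nhdsWithin_le_nhds (s := Set.Ioi 0))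
    have h3 := h2.eventually (gt_mem_nhds
      (show 2 * √(D + 1) * 0 + 0 ^ 2 < ε / 2 by simpa using hε))
    obtain ⟨τ, hτ1, hτ2⟩ := (h3.and self_mem_nhdsWithin).exists
    exact ⟨τ, hτ2, hτ1.le⟩
  refine ((((hG i j (ε / 2) (half_pos hε)).and (hG i i 1 one_pos)).and (hG j j 1 one_pos)).and
    ((hV i (τ ^ 2) (by positivity)).and (hV j (τ ^ 2) (by positivity)))).mono ?_
  filter_upwards [hD] with n hn ω ⟨⟨⟨hij, hii⟩, hjj⟩, hvi, hvj⟩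
  have hr : 0 ≤ (n : ℝ) ^ (-(4 / 5) : ℝ) := Real.rpow_nonneg (Nat.cast_nonneg n) _
  rw [abs_of_nonneg hr] at hij hii hjj hvi hvj ⊢
  have lp : ∀ i, MemLp (fun t => kde K n (fun m => X m ω) (hs n i) t - f t) 2 := fun i =>
    memLp_kde_sub hf hKc hKs n _ (hs0 n i)
  have lp' : ∀ i, MemLp (fun t => kde K n (fun m => X m ω) (h n ω i) t - f t) 2 := fun i =>
    memLp_kde_sub hf hKc hKs n _ (hh n ω i)
  have hdiag : ∀ i, |errorGram K f n (fun m => X m ω) (hs n) i i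
      - approxGram K n (hs n) (roughness f) i i| ≤ 1 * (n : ℝ) ^ (-(4 / 5) : ℝ) →
      ∫ t, (kde K n (fun m => X m ω) (hs n i) t - f t) ^ 2
        ≤ √(D + 1) ^ 2 * (n : ℝ) ^ (-(4 / 5) : ℝ) := by
    intro i hi
    have h1 : errorGram K f n (fun m => X m ω) (hs n) i i
        = ∫ t, (kde K n (fun m => X m ω) (hs n i) t - f t) ^ 2 := by
      rw [errorGram, Matrix.of_apply]
      simp_rw [← sq]
    rw [Real.sq_sqrt (by positivity), ← h1]
    linarith [(abs_le.1 hi).2, (abs_le.1 (hn i i)).2]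
  have hvar : ∀ i, |∫ t, (kde K n (fun m => X m ω) (h n ω i) t
      - kde K n (fun m => X m ω) (hs n i) t) ^ 2| ≤ τ ^ 2 * (n : ℝ) ^ (-(4 / 5) : ℝ) →
      ∫ t, ((kde K n (fun m => X m ω) (h n ω i) t - f t)
        - (kde K n (fun m => X m ω) (hs n i) t - f t)) ^ 2
        ≤ τ ^ 2 * (n : ℝ) ^ (-(4 / 5) : ℝ) := by
    intro i hi
    simp_rw [sub_sub_sub_cancel_right]
    exact (le_abs_self _).trans hi
  have hmain := abs_integral_mul_sub_le (lp i) (lp j) (lp' i) (lp' j) hτ.le (Real.sqrt_nonneg _) hr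
    (hvar i hvi) (hvar j hvj) (hdiag i hii) (hdiag j hjj)
  have h2 := mul_le_mul_of_nonneg_right hτε hr
  have h3 : |errorGram K f n (fun m => X m ω) (h n ω) i j
      - errorGram K f n (fun m => X m ω) (hs n) i j| ≤ ε / 2 * (n : ℝ) ^ (-(4 / 5) : ℝ) :=
    hmain.trans h2
  rw [abs_le] at h3 hij ⊢
  constructor <;> linarith [h3.1, h3.2, hij.1, hij.2]

theorem isLittleOp_approxGram_sub {γ : ℝ} {g : ℕ → Ω → ℝ} (hKc : Continuous K)
    (hKs : HasCompactSupport K) (hh : ∀ n ω i, 0 < h n ω i) (hs0 : ∀ n i, 0 < hs n i) (hc : 0 < c)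
    (hsc : ∀ i, ∀ᶠ n : ℕ in atTop, (n : ℝ) ^ (1 / 5 : ℝ) * hs n i ∈ Set.Icc c C)
    (hclose : ∀ i, IsLittleOp μ (fun n ω => h n ω i - hs n i)
      fun n _ => (n : ℝ) ^ (-(2 / 5) : ℝ))
    (hg : IsLittleOp μ (fun n ω => g n ω - γ) fun _ _ => 1) (i j : Fin k) :
    IsLittleOp μ (fun n ω => approxGram K n (h n ω) (g n ω) i j
      - approxGram K n (hs n) γ i j) fun n _ => (n : ℝ) ^ (-(4 / 5) : ℝ) := by
  rw [isLittleOp_iff]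
  intro ε hε
  obtain ⟨δ, hδ, H⟩ := exists_delta_scaledGram hKc hKs (c₂ := C) hc γ hε
  refine (((isLittleOp_iff.1 (hclose i) δ hδ).and (isLittleOp_iff.1 (hclose j) δ hδ)).and
    (isLittleOp_iff.1 hg δ hδ)).mono ?_
  filter_upwards [hsc i, hsc j, eventually_ge_atTop 1] with n hni hnj hn ω ⟨⟨hi, hj⟩, hgn⟩
  rw [abs_one, mul_one] at hgn
  rw [rpow_neg_two_fifths] at hi hj
  rw [rpow_neg_four_fifths]
  have hs5 := rpow_fifth_pow_five n
  have hs1 := one_le_rpow_fifth hn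
  set s := (n : ℝ) ^ (1 / 5 : ℝ)
  have hspos : 0 < s := rpow_fifth_pos hn
  have hscale : ∀ {x y : ℝ}, |x - y| ≤ δ * |(s ^ 2)⁻¹| → |s * x - s * y| ≤ δ := by
    intro x y hxy
    rw [abs_of_pos (show 0 < (s ^ 2)⁻¹ by positivity)] at hxy
    rw [← mul_sub, abs_mul, abs_of_pos hspos]
    calc s * |x - y| ≤ s * (δ * (s ^ 2)⁻¹) := mul_le_mul_of_nonneg_left hxy hspos.le
      _ = δ * s⁻¹ := by field_simp
      _ ≤ δ := mul_le_of_le_one_right hδ.le (inv_le_one_of_one_le₀ hs1)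
  rw [approxGram_eq_scaledGram hspos hs5 (hh n ω), approxGram_eq_scaledGram hspos hs5 (hs0 n),
    ← mul_sub, abs_mul, mul_comm]
  exact mul_le_mul_of_nonneg_right (H _ _ _ _ _ hni hnj (hscale hi) (hscale hj) hgn) (abs_nonneg _)

/-- The form of `A + γ B` at the deterministic bandwidths is at least of order `n ^ (-4/5)`. -/
theorem exists_eventually_le_quadForm_approxGram (hK : IsKernel K) (hKc : Continuous K)
    (hKs : HasCompactSupport K) (hs0 : ∀ n i, 0 < hs n i) (hc : 0 < c)
    (hsc : ∀ i, ∀ᶠ n : ℕ in atTop, (n : ℝ) ^ (1 / 5 : ℝ) * hs n i ∈ Set.Icc c C)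
    (hsep : ∀ i j, i ≠ j → ∀ᶠ n : ℕ in atTop, c ≤ (n : ℝ) ^ (1 / 5 : ℝ) * |hs n i - hs n j|)
    {γ : ℝ} (hγ : 0 ≤ γ) :
    ∃ d > 0, ∀ᶠ n : ℕ in atTop, ∀ w : Fin k → ℝ,
      d * (n : ℝ) ^ (-(4 / 5) : ℝ) * ∑ i, w i ^ 2 ≤ w ⬝ᵥ (approxGram K n (hs n) γ *ᵥ w) := by
  obtain ⟨d, hd, H⟩ := exists_lower_bound_dilationGram (k := k) hK hKc hKs (c₂ := C) hc hc
  refine ⟨d, hd, ?_⟩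
  have hsep' : ∀ᶠ n : ℕ in atTop, ∀ i j, i ≠ j →
      c ≤ (n : ℝ) ^ (1 / 5 : ℝ) * |hs n i - hs n j| := by
    simp only [eventually_all]
    exact hsep
  filter_upwards [eventually_all.2 hsc, hsep', eventually_ge_atTop 1] with n hn hnsep hn1 w
  rw [rpow_neg_four_fifths]
  have hs5 := rpow_fifth_pow_five n
  set s := (n : ℝ) ^ (1 / 5 : ℝ)
  have hspos : 0 < s := rpow_fifth_pos hn1
  have h1 := H (fun i => s * hs n i) hn (fun i j hij => by
    rw [← mul_sub, abs_mul, abs_of_pos hspos]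
    exact hnsep i j hij) w
  have h2 : w ⬝ᵥ (approxGram K n (hs n) γ *ᵥ w) = (s ^ 4)⁻¹ *
      ((∑ i, ∑ j, w i * w j * ((s * hs n i * (s * hs n j))⁻¹ *
        ∫ u, K (u / (s * hs n i)) * K (u / (s * hs n j))))
      + γ * (1 / 4) * (∫ u, u ^ 2 * K u) ^ 2 * (∑ i, w i * (s * hs n i) ^ 2) ^ 2) := by
    rw [quadForm_eq_sum, sq (∑ i, w i * (s * hs n i) ^ 2), Finset.sum_mul_sum, Finset.mul_sum,
      ← Finset.sum_add_distrib, Finset.mul_sum]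
    refine Finset.sum_congr rfl fun i _ => ?_
    rw [Finset.mul_sum, ← Finset.sum_add_distrib, Finset.mul_sum]
    refine Finset.sum_congr rfl fun j _ => ?_
    rw [approxGram_eq_scaledGram hspos hs5 (hs0 n), scaledGram]
    ring
  rw [h2, mul_comm d, mul_assoc]
  refine mul_le_mul_of_nonneg_left (h1.trans (le_add_of_nonneg_right ?_)) (by positivity)
  positivity

theorem isHermitian_approxGram (n : ℕ) (x : Fin k → ℝ) (g : ℝ) :
    (approxGram K n x g).IsHermitian := by
  ext i j
  simp only [Matrix.conjTranspose_apply, star_trivial, approxGram, matA, matB, Matrix.add_apply,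
    Matrix.smul_apply, Matrix.of_apply, smul_eq_mul]
  simp_rw [mul_comm (K (_ / x j))]
  ring

theorem posDef_of_quadForm_pos {S : Matrix (Fin k) (Fin k) ℝ} (hS : S.IsHermitian)
    (h : ∀ w : Fin k → ℝ, w ≠ 0 → 0 < w ⬝ᵥ (S *ᵥ w)) : S.PosDef :=
  Matrix.PosDef.of_dotProduct_mulVec_pos hS fun w hw => by simpa using h w hw

theorem sum_sq_pos {w : Fin k → ℝ} (hw : w ≠ 0) : 0 < ∑ i, w i ^ 2 := by
  obtain ⟨i, hi⟩ := Function.ne_iff.1 hw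
  exact Finset.sum_pos' (fun j _ => sq_nonneg _) ⟨i, Finset.mem_univ i, by
    have : w i ≠ 0 := hi
    positivity⟩

/-- If `S` and `T` are entrywise close to a matrix whose form is bounded below, then the weights
of `T` are nearly optimal for `S`. Entries within `δ` of each other give forms that differ by at
most `k δ ∑ w_i²`, whence the factor `1 / (4 k)` in the tolerance. -/
theorem quadForm_weights_sub_le_of_close {S T M : Matrix (Fin k) (Fin k) ℝ} (hk : 1 ≤ k)
    (hS : S.IsHermitian) (hT : T.IsHermitian) {d r η : ℝ} (hd : 0 < d) (hr : 0 < r) (hη : 0 < η)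
    (hη2 : η ≤ 1 / 2) (hM : ∀ w : Fin k → ℝ, d * r * ∑ i, w i ^ 2 ≤ w ⬝ᵥ (M *ᵥ w))
    (hSM : ∀ i j, |S i j - M i j| ≤ d * η / (4 * k) * r)
    (hTM : ∀ i j, |T i j - M i j| ≤ d * η / (4 * k) * r) :
    S.PosDef ∧ T.PosDef ∧ weights T ⬝ᵥ (S *ᵥ weights T) - weights S ⬝ᵥ (S *ᵥ weights S)
      ≤ 4 * η * (weights S ⬝ᵥ (S *ᵥ weights S)) := by
  have hk0 : (0 : ℝ) < k := by exact_mod_cast hk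
  have hSle : ∀ w : Fin k → ℝ, d * r / 2 * ∑ i, w i ^ 2 ≤ w ⬝ᵥ (S *ᵥ w) := by
    intro w
    have h1 := (abs_le.1 (abs_quadForm_sub_le hSM w)).1
    have h2 : (k : ℝ) * (d * η / (4 * k) * r) = d * r * (η / 4) := by field_simp
    rw [h2] at h1
    have h3 : d * r * (η / 4) * ∑ i, w i ^ 2 ≤ d * r / 2 * ∑ i, w i ^ 2 := by
      refine mul_le_mul_of_nonneg_right ?_ (Finset.sum_nonneg fun i _ => sq_nonneg _)
      nlinarith [mul_pos hd hr]
    linarith [hM w]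
  have hTS : ∀ w : Fin k → ℝ, |w ⬝ᵥ (T *ᵥ w) - w ⬝ᵥ (S *ᵥ w)| ≤ η * (w ⬝ᵥ (S *ᵥ w)) := by
    intro w
    have h1 : ∀ i j, |T i j - S i j| ≤ 2 * (d * η / (4 * k) * r) := by
      intro i j
      have h2 := abs_le.1 (hSM i j)
      have h3 := abs_le.1 (hTM i j)
      rw [abs_le]
      constructor <;> linarith [h2.1, h2.2, h3.1, h3.2]
    refine (abs_quadForm_sub_le h1 w).trans ?_
    have h2 : (k : ℝ) * (2 * (d * η / (4 * k) * r)) * ∑ i, w i ^ 2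
        = η * (d * r / 2 * ∑ i, w i ^ 2) := by
      field_simp
      ring
    rw [h2]
    exact mul_le_mul_of_nonneg_left (hSle w) hη.le
  have hSpos : ∀ w : Fin k → ℝ, w ≠ 0 → 0 < w ⬝ᵥ (S *ᵥ w) := fun w hw =>
    (mul_pos (by positivity) (sum_sq_pos hw)).trans_le (hSle w)
  have hSd := posDef_of_quadForm_pos hS hSpos
  have hTd : T.PosDef := posDef_of_quadForm_pos hT fun w hw => by
    have h1 := (abs_le.1 (hTS w)).1
    nlinarith [hSpos w hw]
  exact ⟨hSd, hTd, quadForm_weights_sub_le hSd hTd hk hη2 hTS⟩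

end RandomBandwidths

section Constants

variable {k : ℕ} {hs : ℕ → Fin k → ℝ}

/-- The order conditions on the deterministic bandwidths, with constants uniform in the indices. -/
theorem exists_uniform_bandwidth_bounds (hs0 : ∀ n i, 0 < hs n i)
    (horder : ∀ i, (fun n => hs n i) =Θ[atTop] fun n : ℕ => (n : ℝ) ^ (-(1 / 5) : ℝ))
    (hsep : ∀ i j, i ≠ j →
      (fun n : ℕ => (n : ℝ) ^ (-(1 / 5) : ℝ)) =O[atTop] fun n => hs n i - hs n j) :
    ∃ c C : ℝ, 0 < c ∧
      (∀ i, ∀ᶠ n : ℕ in atTop, (n : ℝ) ^ (1 / 5 : ℝ) * hs n i ∈ Set.Icc c C) ∧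
      ∀ i j, i ≠ j → ∀ᶠ n : ℕ in atTop, c ≤ (n : ℝ) ^ (1 / 5 : ℝ) * |hs n i - hs n j| := by
  have h1 : ∀ᶠ C : ℝ in atTop, ∀ i, IsBigOWith C atTop (fun n => hs n i)
      fun n : ℕ => (n : ℝ) ^ (-(1 / 5) : ℝ) :=
    eventually_all.2 fun i => isBigO_iff_eventually_isBigOWith.1 (horder i).isBigO
  have h2 : ∀ᶠ C : ℝ in atTop, ∀ i, IsBigOWith C atTop
      (fun n : ℕ => (n : ℝ) ^ (-(1 / 5) : ℝ)) fun n => hs n i :=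
    eventually_all.2 fun i => isBigO_iff_eventually_isBigOWith.1 (horder i).symm.isBigO
  have h3 : ∀ᶠ C : ℝ in atTop, ∀ i j, i ≠ j → IsBigOWith C atTop
      (fun n : ℕ => (n : ℝ) ^ (-(1 / 5) : ℝ)) fun n => hs n i - hs n j := by
    simp only [eventually_all]
    exact fun i j hij => isBigO_iff_eventually_isBigOWith.1 (hsep i j hij)
  obtain ⟨C, ⟨⟨hC1, hC2⟩, hC3⟩, hC0⟩ := (((h1.and h2).and h3).and (eventually_gt_atTop 0)).exists
  have hlow : ∀ {n : ℕ} {x : ℝ}, 1 ≤ n → ‖(n : ℝ) ^ (-(1 / 5) : ℝ)‖ ≤ C * ‖x‖ →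
      C⁻¹ ≤ (n : ℝ) ^ (1 / 5 : ℝ) * |x| := by
    intro n x hn hx
    have hspos := rpow_fifth_pos hn
    rw [rpow_neg_one_fifth, norm_inv, Real.norm_of_nonneg hspos.le, Real.norm_eq_abs,
      inv_le_iff_one_le_mul₀ hspos] at hx
    rw [inv_le_iff_one_le_mul₀ hC0]
    linarith
  refine ⟨C⁻¹, C, inv_pos.2 hC0, fun i => ?_, fun i j hij => ?_⟩
  · filter_upwards [(hC1 i).bound, (hC2 i).bound, eventually_ge_atTop 1] with n hn1 hn2 hn
    have hspos := rpow_fifth_pos hn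
    refine ⟨?_, ?_⟩
    · simpa only [abs_of_pos (hs0 n i)] using hlow hn hn2
    · rw [rpow_neg_one_fifth, norm_inv, Real.norm_of_nonneg hspos.le,
        Real.norm_of_nonneg (hs0 n i).le, ← div_eq_mul_inv, le_div_iff₀ hspos] at hn1
      linarith
  · filter_upwards [(hC3 i j hij).bound, eventually_ge_atTop 1] with n hn1 hn
    exact hlow hn hn1

end Constants

end

end KernelAveraging

open KernelAveraging in
theorem theorem3p1
    {Ω : Type*} [MeasurableSpace Ω] (μ : MeasureTheory.Measure Ω)
    [MeasureTheory.IsProbabilityMeasure μ]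
    -- the kernel
    (K : ℝ → ℝ) (hK : KernelAveraging.IsKernel K)
    (hKsupp : HasCompactSupport K) (hKdiff : ContDiff ℝ 2 K)
    -- the density and the sample
    (f : ℝ → ℝ) (hf : KernelAveraging.IsSmoothDensity f)
    (X : ℕ → Ω → ℝ) (hX : KernelAveraging.IsIIDSample μ X f)
    -- the data-driven bandwidths: `h n ω i` is the `i`-th bandwidth at sample size `n`
    (k : ℕ) (hk : 1 ≤ k) (h : ℕ → Ω → Fin k → ℝ)
    (hmeas : ∀ n i, Measurable fun ω => h n ω i) (hpos : ∀ n ω i, 0 < h n ω i)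
    -- their deterministic counterparts, of exact order `n ^ (-1/5)`, as are their differences
    (hstar : ℕ → Fin k → ℝ) (hstar_pos : ∀ n i, 0 < hstar n i)
    (hstar_order : ∀ i,
      (fun n => hstar n i) =Θ[Filter.atTop] fun n : ℕ => (n : ℝ) ^ (-(1 / 5) : ℝ))
    (hstar_sep : ∀ i j, i ≠ j →
      (fun n : ℕ => (n : ℝ) ^ (-(1 / 5) : ℝ)) =O[Filter.atTop] fun n => hstar n i - hstar n j)
    (hclose : ∀ i, KernelAveraging.IsLittleOp μ (fun n ω => h n ω i - hstar n i)
      fun n _ => (n : ℝ) ^ (-(2 / 5) : ℝ))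
    -- the estimator of `γ`
    (gammaHat : ℕ → Ω → ℝ) (hgmeas : ∀ n, Measurable (gammaHat n))
    (hgamma : KernelAveraging.IsLittleOp μ
      (fun n ω => gammaHat n ω - KernelAveraging.roughness f) fun _ _ => 1)
    -- `Σ` and `Σ̂` are invertible, with probability tending to one
    (hinv : Filter.Tendsto (fun n => μ {ω | ¬ IsUnit
      (KernelAveraging.errorGram K f n (fun m => X m ω) (h n ω))}) Filter.atTop (nhds 0))
    (hinvHat : Filter.Tendsto (fun n => μ {ω | ¬ IsUnit
      (KernelAveraging.approxGram K n (h n ω) (gammaHat n ω))}) Filter.atTop (nhds 0)) :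
    -- the oracle has the smallest integrated square error among weights that sum to one
    (∀ n ω, 1 ≤ n → IsUnit (KernelAveraging.errorGram K f n (fun m => X m ω) (h n ω)) →
      ∑ i, KernelAveraging.weights
        (KernelAveraging.errorGram K f n (fun m => X m ω) (h n ω)) i = 1 ∧
      ∀ w : Fin k → ℝ, ∑ i, w i = 1 →
        KernelAveraging.ISE f (KernelAveraging.oracle K f n (fun m => X m ω) (h n ω)) ≤
        KernelAveraging.ISE f (KernelAveraging.combination K n (fun m => X m ω) (h n ω) w)) ∧
    -- `ISE(f̂_AV) - ISE(f̂*) = o_p(ISE(f̂*))`, that is, `ISE(f̂_AV) = ISE(f̂*) (1 + o_p(1))`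
    KernelAveraging.IsLittleOp μ
      (fun n ω =>
        KernelAveraging.ISE f (KernelAveraging.averageEstimator K n (fun m => X m ω) (h n ω)
          (gammaHat n ω)) -
        KernelAveraging.ISE f (KernelAveraging.oracle K f n (fun m => X m ω) (h n ω)))
      (fun n ω =>
        KernelAveraging.ISE f (KernelAveraging.oracle K f n (fun m => X m ω) (h n ω))) := by
  have hKc := hKdiff.continuous
  have he : ∀ n ω i, MemLp (fun t => kde K n (fun m => X m ω) (h n ω i) t - f t) 2 :=
    fun n ω i => memLp_kde_sub hf hKc hKsupp n _ (hpos n ω i)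
  -- A Gram matrix is positive semidefinite, so it is positive definite once it is invertible.
  refine ⟨fun n ω _ hunit => ?_, ?_⟩
  · have hS := (posSemidef_errorGram (he n ω)).posDef_iff_isUnit.2 hunit
    refine ⟨sum_weights hS hk, fun w hw => ?_⟩
    rw [oracle, ISE_combination (he n ω) (sum_weights hS hk), ISE_combination (he n ω) hw]
    exact quadForm_weights_le hS hk hw
  obtain ⟨c, C, hc, hsc, hsep⟩ := exists_uniform_bandwidth_bounds hstar_pos hstar_order hstar_sep
  obtain ⟨d, hd, hlow⟩ := exists_eventually_le_quadForm_approxGram hK hKc hKsupp hstar_pos hc hsc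
    hsep (roughness_nonneg f)
  rw [isLittleOp_iff]
  intro ε hε
  have hk0 : (0 : ℝ) < k := by exact_mod_cast hk
  -- `4 η ≤ ε` gives the claimed factor, and `η ≤ 1/2` keeps the comparison of the two forms useful.
  set η := min (1 / 2) (ε / 4) with hη
  have hη0 : 0 < η := by positivity
  have hθ : 0 < d * η / (4 * k) := by positivity
  have hS := EventuallyInProb.forall fun i => EventuallyInProb.forall fun j => isLittleOp_iff.1
    (isLittleOp_errorGram_sub_random hf hX hK hKdiff hKsupp hpos hstar_pos hc hsc hclose i j) _ hθ
  have hT := EventuallyInProb.forall fun i => EventuallyInProb.forall fun j => isLittleOp_iff.1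
    (isLittleOp_approxGram_sub hKc hKsupp hpos hstar_pos hc hsc hclose hgamma i j) _ hθ
  refine (hS.and hT).mono ?_
  filter_upwards [hlow, eventually_ge_atTop 1] with n hn hn1 ω ⟨hSn, hTn⟩
  have hn0 : (0 : ℝ) < n := by positivity
  have hr : 0 < (n : ℝ) ^ (-(4 / 5) : ℝ) := Real.rpow_pos_of_pos hn0 _
  simp only [abs_of_pos hr] at hSn hTn
  obtain ⟨hSd, hTd, hle⟩ := quadForm_weights_sub_le_of_close hk
    (posSemidef_errorGram (he n ω)).isHermitian
    (isHermitian_approxGram n (h n ω) (gammaHat n ω)) hd hr hη0 (min_le_left _ _) hn hSn hTn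
  have hmin := quadForm_weights_le hSd hk (sum_weights hTd hk)
  have hnn := hSd.posSemidef.dotProduct_mulVec_nonneg
    (weights (errorGram K f n (fun m => X m ω) (h n ω)))
  rw [star_trivial] at hnn
  rw [averageEstimator, oracle, ISE_combination (he n ω) (sum_weights hTd hk),
    ISE_combination (he n ω) (sum_weights hSd hk), abs_of_nonneg (sub_nonneg.2 hmin),
    abs_of_nonneg hnn]
  refine hle.trans (mul_le_mul_of_nonneg_right ?_ hnn)
  linarith [min_le_right (1 / 2) (ε / 4)]
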